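/- **Conventions.** A *symmetric multicategory* $Q$ with category of objects $\mathbf C$ consists of: for all objects $x_1,\dots,x_m,x$ of $\mathbf C$ ($m\ge 0$) a set $Q(x_1,\dots,x_m;x)$ of arrows; an action of permutations, $f\in Q(x_1,\dots,x_m;x)$, $\sigma\in S_m$ giving $f\sigma\in Q(x_{\sigma(1)},\dots,x_{\sigma(m)};x)$; associative composition $f\circ(g_1,\dots,g_m)$, equivariant for the permutations of the inputs of $f$ and of each $g_i$; and for each $t\in\mathbf C(x,y)$ an arrow $\iota(t)\in Q(x;y)$, with $\iota(t')\circ\iota(t)=\iota(t't)$ and the $\iota(1_x)$ units for composition. The category $\mathrm{elt}(Q)$ has the arrows of $Q$ (with their sources and target) as objects. A morphism from $f\in Q(x_1,\dots,x_m;x)$ to $g\in Q(y_1,\dots,y_m;y)$ is given by $\sigma\in S_m$, $t_i:y_i\to x_{\sigma(i)}$ and $t:x\to y$ in $\mathbf C$ with $g=\iota(t)\circ (f\sigma)\circ(\iota(t_1),\dots,\iota(t_m))$; there are none between arrows with different numbers of sources. *Shapes* are built from a constant $I$ and a variable $1$ by $\otimes$ and $[\,,]$; each occurrence of $1$ has a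 variance, reversed by the first argument of $[\,,]$. A *graph* $T\to S$ is a perfect matching between the occurrences of opposite variance in $[T,S]$; the *allowable* graphs (Kelly–Mac Lane) are the smallest class containing the identities, the associativity, unit and symmetry isomorphisms of $\otimes$, the (co)evaluation graphs $T\to[S,T\otimes S]$ and $[T,S]\otimes T\to S$, and closed under composition, $\otimes$ and $[\,,]$. The category $A\mathbf C$ has as objects the shapes with each occurrence of $1$ labelled by an object of $\mathbf C$, and as morphisms the allowable graphs with each edge labelled by a morphism from the label of its negative end to the label of its positive end in $[T,S]$. A functor $F:\mathbf C\to A\mathbf D$ induces $AF:A\mathbf C\to A\mathbf D$, which substitutes $F(x)$ for each label $x$ and the graph $F(h)$ for each edge labelled $h$. The *frame functor* $\phi:\mathrm{elt}(Q)\to A\mathbf C$ takes $f\in Q(x_1,\dots,x_m;x)$ to $[x_1\otimes\cdots\otimes x_m,\,x]$ and the morphism $(\sigma,(t_i),t)$ to the graph with edges labelled $t_i$ and $t$. The *slice* $Q^+$ is the symmetric multicategory with category of objects $\mathrm{elt}(Q)$ in which an arrow $\theta\in Q^+(f_1,\dots,f_n;f)$ is a morphism $$\theta: I\longrightarrow A\phi\,[f_1\otimes\cdots\otimes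 f_n,\,f]=[\phi f_1\otimes\cdots\otimes\phi f_n,\ \phi f]$$ of $A\mathbf C$ such that composing the arrows $f_1,\dots,f_n$ in the configuration given by $\theta$ (the $k$-th node is $f_k$, and an edge labelled $h$ is $\iota(h)$) yields $f$. Its composition is the replacement of nodes by graphs, permutations renumber the nodes, and $\iota(\gamma)$, for $\gamma:f\to g$, is the morphism $I\to[\phi f,\phi g]$ that corresponds to $\phi\gamma$. **Lemma.** Let $Q$ be a symmetric multicategory with category of objects $\mathbf C$, and let $\phi:\mathrm{elt}(Q)\to A\mathbf C$ be its frame functor. Then the category $\mathrm{elt}(Q^+)$ is isomorphic to a full subcategory of the comma category $(I\downarrow A\phi)$, by an isomorphism that takes the arrow $\theta\in Q^+(f_1,\dots,f_n;f)$ to the object $(\theta,[f_1\otimes\cdots\otimes f_n,f])$. Under this isomorphism the frame functor $\mathrm{elt}(Q^+)\to A(\mathrm{elt}(Q))$ of $Q^+$ is equal to the composite $$\mathrm{elt}(Q^+)\hookrightarrow(I\downarrow A\phi)\longrightarrow A(\mathrm{elt}(Q))$$ of the inclusion and the forgetful functor. -/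

import Mathlib

open CategoryTheory
universe w v u v' u' v'' u'' w'
set_option linter.unusedSectionVars false
set_option linter.unusedVariables false

namespace KML

/-- A finite set of variables with signs (variances) and labels -/
structure SignedSet (C : Type u) where
  Var : Type
  fin : Finite Var
  sign : Var → Bool
  label : Var → C

namespace SignedSet

abbrev unit (C : Type u) : SignedSet C where
  Var := Empty
  fin := inferInstance
  sign := Empty.elim
  label := Empty.elim

abbrev single {C : Type u} (c : C) : SignedSet C where
  Var := Unit
  fin := inferInstance
  sign := fun _ => true
  label := fun _ => c

abbrev tensor {C : Type u} (X Y : SignedSet C) : SignedSet C where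
  Var := X.Var ⊕ Y.Var
  fin := by have := X.fin; have := Y.fin; infer_instance
  sign := Sum.elim X.sign Y.sign
  label := Sum.elim X.label Y.label

/-- The twisted sum -/
abbrev hom {C : Type u} (X Y : SignedSet C) : SignedSet C where
  Var := X.Var ⊕ Y.Var
  fin := by have := X.fin; have := Y.fin; infer_instance
  sign := Sum.elim (fun a => !X.sign a) Y.sign
  label := Sum.elim X.label Y.label

abbrev sigma {C : Type u} {ι : Type} [Finite ι] (X : ι → SignedSet C) : SignedSet C where
  Var := Σ i, (X i).Var
  fin := by have := fun i => (X i).fin; infer_instance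
  sign := fun a => (X a.1).sign a.2
  label := fun a => (X a.1).label a.2

end SignedSet

open SignedSet

/-- A graph on a set of signed variables: a pairing of the negative with the positive variables,
each pair joined by a morphism from the label of the negative to the label of the positive variable.
The relation `edge a b h` says that `a` and `b` are mates with edge label `h`. -/
structure Linking {C : Type u} [Category.{v} C] (X : SignedSet C) where
  edge : ∀ a b : X.Var, (X.label a ⟶ X.label b) → Prop
  sign_src : ∀ {a b h}, edge a b h → X.sign a = false
  sign_tgt : ∀ {a b h}, edge a b h → X.sign b = true
  exists_of_neg : ∀ a, X.sign a = false → ∃ b h, edge a b h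
  exists_of_pos : ∀ b, X.sign b = true → ∃ a h, edge a b h
  unique_of_neg : ∀ {a b b' h h'}, edge a b h → edge a b' h' → b = b' ∧ HEq h h'
  unique_of_pos : ∀ {a a' b h h'}, edge a b h → edge a' b h' → a = a'

section Basic
variable {C : Type u} [Category.{v} C]

/-- The relation `edge` for morphisms between arbitrary objects (equal to the labels) -/
inductive Linking.Edge {X : SignedSet C} (θ : Linking X) :
    X.Var → X.Var → ∀ {c d : C}, (c ⟶ d) → Prop
  | mk {a b : X.Var} {h : X.label a ⟶ X.label b} : θ.edge a b h → θ.Edge a b h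

namespace Linking
variable {X Y Z : SignedSet C}

theorem edge_iff (θ : Linking X) {a b : X.Var} {h : X.label a ⟶ X.label b} :
    θ.Edge a b h ↔ θ.edge a b h :=
  ⟨fun h => by cases h; assumption, .mk⟩

theorem Edge.lab {θ : Linking X} {a b : X.Var} {c d : C} {h : c ⟶ d} (e : θ.Edge a b h) :
    c = X.label a ∧ d = X.label b := by cases e; exact ⟨rfl, rfl⟩

theorem Edge.neg {θ : Linking X} {a b : X.Var} {c d : C} {h : c ⟶ d} (e : θ.Edge a b h) :
    X.sign a = false := by cases e with | mk e => exact θ.sign_src e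

theorem Edge.pos {θ : Linking X} {a b : X.Var} {c d : C} {h : c ⟶ d} (e : θ.Edge a b h) :
    X.sign b = true := by cases e with | mk e => exact θ.sign_tgt e

theorem Edge.unique {θ : Linking X} {a b b' : X.Var} {c d c' d' : C} {h : c ⟶ d} {h' : c' ⟶ d'}
    (e : θ.Edge a b h) (e' : θ.Edge a b' h') : b = b' ∧ HEq h h' := by
  cases e with | mk e => cases e' with | mk e' => exact θ.unique_of_neg e e'

theorem Edge.unique' {θ : Linking X} {a a' b : X.Var} {c d c' d' : C} {h : c ⟶ d} {h' : c' ⟶ d'}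
    (e : θ.Edge a b h) (e' : θ.Edge a' b h') : a = a' := by
  cases e with | mk e => cases e' with | mk e' => exact θ.unique_of_pos e e'

theorem ext_of_le {θ θ' : Linking X} (H : ∀ a b h, θ.edge a b h → θ'.edge a b h) : θ = θ' := by
  have : θ.edge = θ'.edge := by
    funext a b h
    refine propext ⟨H a b h, fun e => ?_⟩
    obtain ⟨b', h', e'⟩ := θ.exists_of_neg a (θ'.sign_src e)
    obtain ⟨rfl, hh⟩ := θ'.unique_of_neg e (H _ _ _ e')
    cases hh
    exact e'
  cases θ; cases θ'; cases this; rfl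

def ofRel (R : X.Var → X.Var → ∀ {c d : C}, (c ⟶ d) → Prop)
    (lab : ∀ {a b c d} {h : c ⟶ d}, R a b h → c = X.label a ∧ d = X.label b)
    (neg : ∀ {a b c d} {h : c ⟶ d}, R a b h → X.sign a = false)
    (pos : ∀ {a b c d} {h : c ⟶ d}, R a b h → X.sign b = true)
    (exn : ∀ a, X.sign a = false → ∃ b c d, ∃ h : c ⟶ d, R a b h)
    (exp : ∀ b, X.sign b = true → ∃ a c d, ∃ h : c ⟶ d, R a b h)
    (un : ∀ {a b b' c d c' d'} {h : c ⟶ d} {h' : c' ⟶ d'}, R a b h → R a b' h' →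
      b = b' ∧ HEq h h')
    (un' : ∀ {a a' b c d c' d'} {h : c ⟶ d} {h' : c' ⟶ d'}, R a b h → R a' b h' → a = a') :
    Linking X where
  edge a b h := R a b h
  sign_src := neg
  sign_tgt := pos
  exists_of_neg a ha := by
    obtain ⟨b, c, d, h, r⟩ := exn a ha
    obtain ⟨rfl, rfl⟩ := lab r
    exact ⟨b, h, r⟩
  exists_of_pos a ha := by
    obtain ⟨b, c, d, h, r⟩ := exp a ha
    obtain ⟨rfl, rfl⟩ := lab r
    exact ⟨b, h, r⟩
  unique_of_neg := un
  unique_of_pos := un'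

theorem ofRel_Edge {R : X.Var → X.Var → ∀ {c d : C}, (c ⟶ d) → Prop}
    {lab neg pos exn exp un un'} {a b : X.Var} {c d : C} {h : c ⟶ d} :
    (ofRel (X := X) R lab neg pos exn exp un un').Edge a b h ↔ R a b h := by
  constructor
  · intro e; cases e with | mk e => exact e
  · intro r
    obtain ⟨rfl, rfl⟩ := lab r
    exact .mk r

theorem Edge.exists_of_neg (θ : Linking X) (a : X.Var) (ha : X.sign a = false) :
    ∃ b c d, ∃ h : c ⟶ d, θ.Edge a b h := by
  obtain ⟨b, h, e⟩ := θ.exists_of_neg a ha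
  exact ⟨b, _, _, h, .mk e⟩

theorem Edge.exists_of_pos (θ : Linking X) (a : X.Var) (ha : X.sign a = true) :
    ∃ b c d, ∃ h : c ⟶ d, θ.Edge b a h := by
  obtain ⟨b, h, e⟩ := θ.exists_of_pos a ha
  exact ⟨b, _, _, h, .mk e⟩

end Linking

/-! ### Systems of wires and paths -/

/-- Points with labels, and steps labelled by morphisms, with at most one step from each point -/
structure Sys (C : Type u) [Category.{v} C] where
  V : Type
  lab : V → C
  step : V → V → ∀ {c d : C}, (c ⟶ d) → Prop
  step_lab : ∀ {a b c d} {h : c ⟶ d}, step a b h → c = lab a ∧ d = lab b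
  det : ∀ {a b b' c d c' d'} {h : c ⟶ d} {h' : c' ⟶ d'}, step a b h → step a b' h' →
      b = b' ∧ HEq h h'

/-- Paths of steps, labelled by the composite of their labels -/
inductive Path {V : Type} (lab : V → C) (step : V → V → ∀ {c d : C}, (c ⟶ d) → Prop) :
    V → V → ∀ {c d : C}, (c ⟶ d) → Prop
  | refl (a : V) : Path lab step a a (𝟙 (lab a))
  | cons {a b e : V} {c d f : C} {g : c ⟶ d} {h : d ⟶ f} :
      step a b g → Path lab step b e h → Path lab step a e (g ≫ h)

namespace Sys

abbrev Path (S : Sys C) (a b : S.V) {c d : C} (h : c ⟶ d) : Prop := KML.Path S.lab S.step a b h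

variable {S : Sys C}

theorem Path.lab {a b : S.V} {c d : C} {h : c ⟶ d} (p : S.Path a b h) :
    c = S.lab a ∧ d = S.lab b := by
  induction p with
  | refl a => exact ⟨rfl, rfl⟩
  | cons s p ih => exact ⟨(S.step_lab s).1, ih.2⟩

theorem Path.trans {a b e : S.V} {c d f : C} {h : c ⟶ d} {k : d ⟶ f} (p : S.Path a b h)
    (q : S.Path b e k) : S.Path a e (h ≫ k) := by
  induction p with
  | refl a => simpa using q
  | cons s p ih => rw [Category.assoc]; exact .cons s (ih q)

theorem Path.of_step {a b : S.V} {c d : C} {h : c ⟶ d} (s : S.step a b h) : S.Path a b h := by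
  obtain ⟨rfl, rfl⟩ := S.step_lab s
  rw [← Category.comp_id h]
  exact .cons s (.refl b)

theorem Path.refl' {a : S.V} {c : C} (h : S.lab a = c) : S.Path a a (𝟙 c) := by
  subst h; exact .refl a

def Terminal (S : Sys C) (a : S.V) : Prop := ∀ b c d, ∀ h : c ⟶ d, ¬ S.step a b h

theorem Path.unique {a b b' : S.V} {c d c' d' : C} {h : c ⟶ d} {h' : c' ⟶ d'}
    (p : S.Path a b h) (q : S.Path a b' h') (t : S.Terminal b) (t' : S.Terminal b') :
    b = b' ∧ HEq h h' := by
  induction p generalizing c' d' with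
  | refl a =>
    cases q with
    | refl => exact ⟨rfl, HEq.rfl⟩
    | cons s q => exact (t _ _ _ _ s).elim
  | cons s p ih =>
    cases q with
    | refl => exact (t' _ _ _ _ s).elim
    | cons s' q =>
      obtain ⟨rfl, hh⟩ := S.det s s'
      obtain ⟨h1, h2⟩ := S.step_lab s
      obtain ⟨h3, h4⟩ := S.step_lab s'
      subst h1 h2 h3 h4
      cases hh
      obtain ⟨rfl, hh⟩ := ih q t
      obtain ⟨_, h6⟩ := Path.lab p
      obtain ⟨_, h7⟩ := Path.lab q
      subst h6 h7
      cases hh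
      exact ⟨rfl, HEq.rfl⟩

end Sys

namespace Linking
variable {X Y Z W : SignedSet C}

abbrev sys (θ : Linking X) : Sys C where
  V := X.Var
  lab := X.label
  step := θ.Edge
  step_lab := Edge.lab
  det := Edge.unique

/-- The graph `θ` is realized by paths in the system `S`. -/
def Sits (θ : Linking X) (S : Sys C) (i : X.Var → S.V) : Prop :=
  (∀ a, S.lab (i a) = X.label a) ∧
    ∀ a b, ∀ h : X.label a ⟶ X.label b, θ.edge a b h → S.Path (i a) (i b) h

theorem Sits.path {θ : Linking X} {S : Sys C} {i : X.Var → S.V} (H : θ.Sits S i)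
    {a b : X.Var} {c d : C} {h : c ⟶ d} (e : θ.Edge a b h) : S.Path (i a) (i b) h := by
  cases e with | mk e => exact H.2 _ _ _ e

theorem sits_self (θ : Linking X) : θ.Sits θ.sys id :=
  ⟨fun _ => rfl, fun _ _ _ e => Sys.Path.of_step (S := θ.sys) (.mk e)⟩

theorem eq_of_sits {θ θ' : Linking X} {S : Sys C} {i : X.Var → S.V} (H : θ.Sits S i)
    (H' : θ'.Sits S i) (inj : Function.Injective i)
    (t : ∀ a, X.sign a = true → S.Terminal (i a)) : θ = θ' := by
  refine ext_of_le fun a b h e => ?_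
  obtain ⟨b', h', e'⟩ := θ'.exists_of_neg a (θ.sign_src e)
  obtain ⟨hb, hh⟩ := Sys.Path.unique (H.2 _ _ _ e) (H'.2 _ _ _ e') (t _ (θ.sign_tgt e))
    (t _ (θ'.sign_tgt e'))
  obtain rfl := inj hb
  cases hh
  exact e'

theorem eq_of_sits_sys {θ θ' : Linking X} (H : θ'.Sits θ.sys id) : θ' = θ :=
  eq_of_sits H θ.sits_self Function.injective_id fun a ha _ _ _ _ s => by
    have := Edge.neg s
    simp_all

end Linking
end Basic
open SignedSet
section
variable {C : Type u} [Category.{v} C]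

theorem exists_terminal {V : Type} [Finite V] {R : V → V → Prop}
    (codet : ∀ {a a' b}, R a b → R a' b → a = a')
    (a : V) (ha : ∀ b, ¬ R b a) : ∃ b, Relation.ReflTransGen R a b ∧ ∀ c, ¬ R b c := by
  by_contra hc
  have hc' : ∀ b : {b // Relation.ReflTransGen R a b}, ∃ c, R b.1 c := by
    intro b
    by_contra hn
    exact hc ⟨b.1, b.2, fun c h => hn ⟨c, h⟩⟩
  choose f hf using hc'
  let g : {b // Relation.ReflTransGen R a b} →
      {b // Relation.ReflTransGen R a b} :=
    fun b => ⟨f b, b.2.tail (hf b)⟩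
  have inj : Function.Injective g := by
    intro b b' h
    have h' : f b = f b' := congrArg Subtype.val h
    have := hf b'
    rw [← h'] at this
    exact Subtype.ext (codet (hf b) this)
  obtain ⟨b, hb⟩ := (Finite.injective_iff_surjective.1 inj) ⟨a, .refl⟩
  have h' : f b = a := congrArg Subtype.val hb
  have h2 := hf b
  rw [h'] at h2
  exact ha b.1 h2

theorem exists_initial {V : Type} [Finite V] {R : V → V → Prop}
    (det : ∀ {a b b'}, R a b → R a b' → b = b')
    (b : V) (hb : ∀ c, ¬ R b c) : ∃ a, Relation.ReflTransGen R a b ∧ ∀ c, ¬ R c a := by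
  obtain ⟨a, h1, h2⟩ := exists_terminal (R := Function.swap R)
    (fun h h' => det h h') b hb
  exact ⟨a, Relation.reflTransGen_swap.1 h1, h2⟩

namespace Linking
variable {X Y Z W : SignedSet C}

section Comp

abbrev embL (X Y Z : SignedSet C) : (hom X Y).Var → X.Var ⊕ Y.Var ⊕ Z.Var :=
  Sum.elim Sum.inl (Sum.inr ∘ Sum.inl)
abbrev embR (X Y Z : SignedSet C) : (hom Y Z).Var → X.Var ⊕ Y.Var ⊕ Z.Var :=
  Sum.elim (Sum.inr ∘ Sum.inl) (Sum.inr ∘ Sum.inr)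
abbrev embO (X Y Z : SignedSet C) : (hom X Z).Var → X.Var ⊕ Y.Var ⊕ Z.Var :=
  Sum.elim Sum.inl (Sum.inr ∘ Sum.inr)

/-- The edges of two composable graphs, placed on the union of the three sets of variables -/
inductive CompStep (ξ : Linking (hom X Y)) (η : Linking (hom Y Z)) :
    X.Var ⊕ Y.Var ⊕ Z.Var → X.Var ⊕ Y.Var ⊕ Z.Var → ∀ {c d : C}, (c ⟶ d) → Prop
  | left {a b : (hom X Y).Var} {c d : C} {h : c ⟶ d} : ξ.Edge a b h →
      CompStep ξ η (embL X Y Z a) (embL X Y Z b) h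
  | right {a b : (hom Y Z).Var} {c d : C} {h : c ⟶ d} : η.Edge a b h →
      CompStep ξ η (embR X Y Z a) (embR X Y Z b) h

abbrev compLab (X Y Z : SignedSet C) : X.Var ⊕ Y.Var ⊕ Z.Var → C :=
  Sum.elim X.label (Sum.elim Y.label Z.label)

theorem embL_inj : Function.Injective (embL X Y Z) := by
  rintro (a | a) (b | b) h <;> simp_all
theorem embR_inj : Function.Injective (embR X Y Z) := by
  rintro (a | a) (b | b) h <;> simp_all
theorem embO_inj : Function.Injective (embO X Y Z) := by
  rintro (a | a) (b | b) h <;> simp_all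
theorem embLR {a : (hom X Y).Var} {b : (hom Y Z).Var} (h : embL X Y Z a = embR X Y Z b) :
    (hom X Y).sign a = !(hom Y Z).sign b := by
  rcases a with a | a <;> rcases b with b | b <;> simp_all

variable {ξ : Linking (hom X Y)} {η : Linking (hom Y Z)}

theorem CompStep.lab {a b} {c d : C} {h : c ⟶ d} (s : CompStep ξ η a b h) :
    c = compLab X Y Z a ∧ d = compLab X Y Z b := by
  cases s with
  | @left a b _ _ _ e =>
    obtain ⟨rfl, rfl⟩ := e.lab
    rcases a with a | a <;> rcases b with b | b <;> exact ⟨rfl, rfl⟩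
  | @right a b _ _ _ e =>
    obtain ⟨rfl, rfl⟩ := e.lab
    rcases a with a | a <;> rcases b with b | b <;> exact ⟨rfl, rfl⟩

theorem CompStep.det {a b b'} {c d c' d' : C} {h : c ⟶ d} {h' : c' ⟶ d'}
    (s : CompStep ξ η a b h) (s' : CompStep ξ η a b' h') : b = b' ∧ HEq h h' := by
  cases s with
  | left e =>
    generalize hv : embL X Y Z _ = v at s'
    cases s' with
    | left e' =>
      obtain rfl := embL_inj hv
      obtain ⟨rfl, hh⟩ := e.unique e'
      exact ⟨rfl, hh⟩
    | right e' => have := embLR hv; have := e.neg; have := e'.neg; simp_all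
  | right e =>
    generalize hv : embR X Y Z _ = v at s'
    cases s' with
    | right e' =>
      obtain rfl := embR_inj hv
      obtain ⟨rfl, hh⟩ := e.unique e'
      exact ⟨rfl, hh⟩
    | left e' => have := embLR hv.symm; have := e.neg; have := e'.neg; simp_all

theorem CompStep.codet {a a' b} {c d c' d' : C} {h : c ⟶ d} {h' : c' ⟶ d'}
    (s : CompStep ξ η a b h) (s' : CompStep ξ η a' b h') : a = a' := by
  cases s with
  | left e =>
    generalize hv : embL X Y Z _ = v at s'
    cases s' with
    | left e' =>
      obtain rfl := embL_inj hv
      exact congrArg _ (e.unique' e')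
    | right e' => have := embLR hv; have := e.pos; have := e'.pos; simp_all
  | right e =>
    generalize hv : embR X Y Z _ = v at s'
    cases s' with
    | right e' =>
      obtain rfl := embR_inj hv
      exact congrArg _ (e.unique' e')
    | left e' => have := embLR hv.symm; have := e.pos; have := e'.pos; simp_all

abbrev compSys (ξ : Linking (hom X Y)) (η : Linking (hom Y Z)) : Sys C where
  V := X.Var ⊕ Y.Var ⊕ Z.Var
  lab := compLab X Y Z
  step := CompStep ξ η
  step_lab := CompStep.lab
  det := CompStep.det

theorem compStep_cases {a b} {c d : C} {h : c ⟶ d} (s : CompStep ξ η a b h) :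
    (∃ a' b', a = embL X Y Z a' ∧ b = embL X Y Z b' ∧ ξ.Edge a' b' h) ∨
    (∃ a' b', a = embR X Y Z a' ∧ b = embR X Y Z b' ∧ η.Edge a' b' h) := by
  cases s with
  | left e => exact .inl ⟨_, _, rfl, rfl, e⟩
  | right e => exact .inr ⟨_, _, rfl, rfl, e⟩

theorem compSys_terminal (b : (hom X Z).Var) (hb : (hom X Z).sign b = true) :
    (compSys ξ η).Terminal (embO X Y Z b) := by
  intro _ _ _ _ s
  obtain ⟨a', b', h1, -, e⟩ | ⟨a', b', h1, -, e⟩ := compStep_cases s <;>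
  · have := e.neg
    rcases b with b | b <;> rcases a' with a' | a' <;> simp_all

theorem compSys_initial (a : (hom X Z).Var) (ha : (hom X Z).sign a = false) (b) {c d : C}
    {h : c ⟶ d} : ¬ CompStep ξ η b (embO X Y Z a) h := by
  intro s
  obtain ⟨a', b', -, h1, e⟩ | ⟨a', b', -, h1, e⟩ := compStep_cases s <;>
  · have := e.pos
    rcases a with a | a <;> rcases b' with b' | b' <;> simp_all

theorem terminal_cases (b : X.Var ⊕ Y.Var ⊕ Z.Var)
    (hb : ∀ b' c d, ∀ h : c ⟶ d, ¬ CompStep ξ η b b' h) :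
    ∃ b', b = embO X Y Z b' ∧ (hom X Z).sign b' = true := by
  rcases b with b | b | b
  · refine ⟨.inl b, rfl, ?_⟩
    by_contra hs
    obtain ⟨_, _, _, _, e⟩ := Edge.exists_of_neg ξ (.inl b) (by simpa using hs)
    exact hb _ _ _ _ (.left e)
  · exfalso
    cases hs : Y.sign b
    · obtain ⟨_, _, _, _, e⟩ := Edge.exists_of_neg ξ (.inr b) (by simpa using hs)
      exact hb _ _ _ _ (.left e)
    · obtain ⟨_, _, _, _, e⟩ := Edge.exists_of_neg η (.inl b) (by simpa using hs)
      exact hb _ _ _ _ (.right e)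
  · refine ⟨.inr b, rfl, ?_⟩
    by_contra hs
    obtain ⟨_, _, _, _, e⟩ := Edge.exists_of_neg η (.inr b) (by simpa using hs)
    exact hb _ _ _ _ (.right e)

theorem initial_cases (b : X.Var ⊕ Y.Var ⊕ Z.Var)
    (hb : ∀ b' c d, ∀ h : c ⟶ d, ¬ CompStep ξ η b' b h) :
    ∃ b', b = embO X Y Z b' ∧ (hom X Z).sign b' = false := by
  rcases b with b | b | b
  · refine ⟨.inl b, rfl, ?_⟩
    by_contra hs
    obtain ⟨_, _, _, _, e⟩ := Edge.exists_of_pos ξ (.inl b) (by simpa using hs)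
    exact hb _ _ _ _ (.left e)
  · exfalso
    cases hs : Y.sign b
    · obtain ⟨_, _, _, _, e⟩ := Edge.exists_of_pos η (.inl b) (by simpa using hs)
      exact hb _ _ _ _ (.right e)
    · obtain ⟨_, _, _, _, e⟩ := Edge.exists_of_pos ξ (.inr b) (by simpa using hs)
      exact hb _ _ _ _ (.left e)
  · refine ⟨.inr b, rfl, ?_⟩
    by_contra hs
    obtain ⟨_, _, _, _, e⟩ := Edge.exists_of_pos η (.inr b) (by simpa using hs)
    exact hb _ _ _ _ (.right e)

theorem exists_path_of_reach {a b : X.Var ⊕ Y.Var ⊕ Z.Var}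
    (r : Relation.ReflTransGen (fun a b => ∃ c d, ∃ h : c ⟶ d, CompStep ξ η a b h) a b) :
    ∃ c d, ∃ h : c ⟶ d, (compSys ξ η).Path a b h := by
  induction r using Relation.ReflTransGen.head_induction_on with
  | refl => exact ⟨_, _, _, .refl b⟩
  | head s _ ih =>
    obtain ⟨c, d, h, s⟩ := s
    obtain ⟨c', d', h', p⟩ := ih
    obtain ⟨rfl, rfl⟩ := s.lab
    obtain ⟨rfl, rfl⟩ := Sys.Path.lab p
    exact ⟨_, _, _, .cons s p⟩

theorem reach_of_path {a b : X.Var ⊕ Y.Var ⊕ Z.Var} {c d : C} {h : c ⟶ d}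
    (p : (compSys ξ η).Path a b h) :
    Relation.ReflTransGen (fun a b => ∃ c d, ∃ h : c ⟶ d, CompStep ξ η a b h) a b := by
  induction p with
  | refl a => exact .refl
  | cons s p ih => exact .head ⟨_, _, _, s⟩ ih

theorem reach_initial_unique {V : Type} {R : V → V → Prop}
    (codet : ∀ {a a' b}, R a b → R a' b → a = a') {a a' b : V}
    (p : Relation.ReflTransGen R a b) (q : Relation.ReflTransGen R a' b)
    (ha : ∀ c, ¬ R c a) (ha' : ∀ c, ¬ R c a') : a = a' := by
  induction p with
  | refl =>
    rcases q.cases_tail with rfl | ⟨c, _, h⟩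
    · rfl
    · exact (ha _ h).elim
  | tail p s ih =>
    rcases q.cases_tail with rfl | ⟨c, h', h⟩
    · exact (ha' _ s).elim
    · obtain rfl := codet s h
      exact ih h'

theorem compLab_embO (a : (hom X Z).Var) :
    compLab X Y Z (embO X Y Z a) = (hom X Z).label a := by
  rcases a with a | a <;> rfl

/-- Composition of graphs -/
def comp (ξ : Linking (hom X Y)) (η : Linking (hom Y Z)) : Linking (hom X Z) :=
  ofRel (fun a b _ _ h => (hom X Z).sign a = false ∧ (hom X Z).sign b = true ∧
      Path (compLab X Y Z) (CompStep ξ η) (embO X Y Z a) (embO X Y Z b) h)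
    (fun {a b c d h} p => by
      have := Sys.Path.lab (S := compSys ξ η) p.2.2
      exact ⟨this.1.trans (compLab_embO a), this.2.trans (compLab_embO b)⟩)
    (fun p => p.1) (fun p => p.2.1)
    (fun a ha => by
      have := X.fin; have := Y.fin; have := Z.fin
      obtain ⟨b, r, hb⟩ := exists_terminal
        (R := fun a b => ∃ c d, ∃ h : c ⟶ d, CompStep ξ η a b h)
        (fun ⟨_, _, _, h⟩ ⟨_, _, _, h'⟩ => h.codet h') (embO X Y Z a)
        (fun b ⟨_, _, _, h⟩ => compSys_initial a ha b h)
      obtain ⟨b', rfl, hb'⟩ := terminal_cases b (fun b' c d h s => hb b' ⟨c, d, h, s⟩)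
      obtain ⟨c, d, h, p⟩ := exists_path_of_reach r
      exact ⟨b', c, d, h, ha, hb', p⟩)
    (fun a ha => by
      have := X.fin; have := Y.fin; have := Z.fin
      obtain ⟨b, r, hb⟩ := exists_initial
        (R := fun a b => ∃ c d, ∃ h : c ⟶ d, CompStep ξ η a b h)
        (fun ⟨_, _, _, h⟩ ⟨_, _, _, h'⟩ => (h.det h').1)
        (embO X Y Z a)
        (fun b ⟨_, _, _, h⟩ => compSys_terminal a ha b _ _ _ h)
      obtain ⟨b', rfl, hb'⟩ := initial_cases b (fun b' c d h s => hb b' ⟨c, d, h, s⟩)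
      obtain ⟨c, d, h, p⟩ := exists_path_of_reach r
      exact ⟨b', c, d, h, hb', ha, p⟩)
    (fun {a b b' _ _ _ _ _ _} p p' => by
      obtain ⟨h1, h2⟩ := Sys.Path.unique (S := compSys ξ η) p.2.2 p'.2.2
        (compSys_terminal _ p.2.1) (compSys_terminal _ p'.2.1)
      exact ⟨embO_inj h1, h2⟩)
    (fun {a a' b _ _ _ _ _ _} p p' => by
      refine embO_inj (reach_initial_unique ?_ (reach_of_path p.2.2) (reach_of_path p'.2.2) ?_ ?_)
      · exact fun ⟨_, _, _, h⟩ ⟨_, _, _, h'⟩ => h.codet h'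
      · exact fun c ⟨_, _, _, h⟩ => compSys_initial _ p.1 _ h
      · exact fun c ⟨_, _, _, h⟩ => compSys_initial _ p'.1 _ h)

theorem comp_sits_compSys : (comp ξ η).Sits (compSys ξ η) (embO X Y Z) :=
  ⟨compLab_embO, fun _ _ _ e => e.2.2⟩

theorem left_sits_compSys : ξ.Sits (compSys ξ η) (embL X Y Z) :=
  ⟨fun a => by rcases a with a | a <;> rfl,
    fun _ _ _ e => Sys.Path.of_step (S := compSys ξ η) (.left (.mk e))⟩

theorem right_sits_compSys : η.Sits (compSys ξ η) (embR X Y Z) :=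
  ⟨fun a => by rcases a with a | a <;> rfl,
    fun _ _ _ e => Sys.Path.of_step (S := compSys ξ η) (.right (.mk e))⟩

theorem path_of_compPath {S : Sys C} {f : X.Var ⊕ Y.Var ⊕ Z.Var → S.V}
    (H : ξ.Sits S (f ∘ embL X Y Z)) (H' : η.Sits S (f ∘ embR X Y Z)) {a b} {c d : C} {h : c ⟶ d}
    (p : (compSys ξ η).Path a b h) : S.Path (f a) (f b) h := by
  have hl : ∀ a, S.lab (f a) = compLab X Y Z a := by
    rintro (a | a | a)
    · exact H.1 (.inl a)
    · exact H.1 (.inr a)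
    · exact H'.1 (.inr a)
  induction p with
  | refl a => exact Sys.Path.refl' (hl a)
  | cons s p ih =>
    refine Sys.Path.trans ?_ ih
    obtain ⟨a', b', rfl, rfl, e⟩ | ⟨a', b', rfl, rfl, e⟩ := compStep_cases s
    · exact H.path e
    · exact H'.path e

theorem Sits.comp {S : Sys C} {iX : X.Var → S.V} {iY : Y.Var → S.V} {iZ : Z.Var → S.V}
    (H : ξ.Sits S (Sum.elim iX iY)) (H' : η.Sits S (Sum.elim iY iZ)) :
    (comp ξ η).Sits S (Sum.elim iX iZ) := by
  refine ⟨?_, fun a b h e => ?_⟩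
  · rintro (a | a)
    · exact H.1 (.inl a)
    · exact H'.1 (.inr a)
  · have e1 : Sum.elim iX (Sum.elim iY iZ) ∘ embL X Y Z = Sum.elim iX iY := by
      funext a; rcases a with a | a <;> rfl
    have e2 : Sum.elim iX (Sum.elim iY iZ) ∘ embR X Y Z = Sum.elim iY iZ := by
      funext a; rcases a with a | a <;> rfl
    have := path_of_compPath (f := Sum.elim iX (Sum.elim iY iZ)) (by rwa [e1]) (by rwa [e2]) e.2.2
    rcases a with a | a <;> rcases b with b | b <;> exact this

end Comp

end Linking
end
open SignedSet
/-- Bijections that preserve signs and labels -/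
structure SIso {C : Type u} (X Y : SignedSet C) where
  e : X.Var ≃ Y.Var
  sign : ∀ a, Y.sign (e a) = X.sign a
  label : ∀ a, Y.label (e a) = X.label a

namespace SIso
variable {C : Type u} {X Y Z X' Y' : SignedSet C}

@[ext] theorem ext {e f : SIso X Y} (h : ∀ a, e.e a = f.e a) : e = f := by
  cases e; cases f
  congr
  exact Equiv.ext h

def refl (X : SignedSet C) : SIso X X := ⟨Equiv.refl _, fun _ => rfl, fun _ => rfl⟩

def symm (e : SIso X Y) : SIso Y X :=
  ⟨e.e.symm, fun a => by simpa using (e.sign (e.e.symm a)).symm,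
    fun a => by simpa using (e.label (e.e.symm a)).symm⟩

def trans (e : SIso X Y) (f : SIso Y Z) : SIso X Z :=
  ⟨e.e.trans f.e, fun a => (f.sign _).trans (e.sign _), fun a => (f.label _).trans (e.label _)⟩

def tensor (e : SIso X Y) (f : SIso X' Y') : SIso (X.tensor X') (Y.tensor Y') :=
  ⟨e.e.sumCongr f.e, by rintro (a | a) <;> simp [e.sign, f.sign],
    by rintro (a | a) <;> simp [e.label, f.label]⟩

def hom (e : SIso X Y) (f : SIso X' Y') : SIso (X.hom X') (Y.hom Y') :=
  ⟨e.e.sumCongr f.e, by rintro (a | a) <;> simp [e.sign, f.sign],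
    by rintro (a | a) <;> simp [e.label, f.label]⟩

def assoc (X Y Z : SignedSet C) : SIso ((X.tensor Y).tensor Z) (X.tensor (Y.tensor Z)) :=
  ⟨Equiv.sumAssoc _ _ _, by rintro ((a | a) | a) <;> rfl, by rintro ((a | a) | a) <;> rfl⟩

/-- `X ≅ X ⊗ I`. -/
def unitor (X : SignedSet C) : SIso X (X.tensor (SignedSet.unit C)) :=
  ⟨(Equiv.sumEmpty _ _).symm, fun _ => rfl, fun _ => rfl⟩

def comm (X Y : SignedSet C) : SIso (X.tensor Y) (Y.tensor X) :=
  ⟨Equiv.sumComm _ _, by rintro (a | a) <;> rfl, by rintro (a | a) <;> rfl⟩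

def curry (X Y Z : SignedSet C) : SIso ((X.tensor Y).hom Z) (X.hom (Y.hom Z)) :=
  ⟨Equiv.sumAssoc _ _ _, by rintro ((a | a) | a) <;> rfl, by rintro ((a | a) | a) <;> rfl⟩

/-- The union of two twisted sums is the twisted sum of the unions -/
def tensorHom (X Y X' Y' : SignedSet C) :
    SIso ((X.hom Y).tensor (X'.hom Y')) ((X.tensor X').hom (Y.tensor Y')) :=
  ⟨Equiv.sumSumSumComm _ _ _ _, by rintro ((a | a) | (a | a)) <;> rfl,
    by rintro ((a | a) | (a | a)) <;> rfl⟩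

def homHom (X Y X' Y' : SignedSet C) :
    SIso ((X.hom Y).tensor (X'.hom Y')) ((Y.hom X').hom (X.hom Y')) :=
  ⟨⟨Sum.elim (Sum.elim (Sum.inr ∘ Sum.inl) (Sum.inl ∘ Sum.inl))
      (Sum.elim (Sum.inl ∘ Sum.inr) (Sum.inr ∘ Sum.inr)),
    Sum.elim (Sum.elim (Sum.inl ∘ Sum.inr) (Sum.inr ∘ Sum.inl))
      (Sum.elim (Sum.inl ∘ Sum.inl) (Sum.inr ∘ Sum.inr)),
    by rintro ((a | a) | (a | a)) <;> rfl, by rintro ((a | a) | (a | a)) <;> rfl⟩,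
    by rintro ((a | a) | (a | a)) <;> simp, by rintro ((a | a) | (a | a)) <;> rfl⟩

def sigmaHom {ι : Type} [Finite ι] (X Y : ι → SignedSet C) :
    SIso (SignedSet.sigma fun i => (X i).hom (Y i)) ((SignedSet.sigma X).hom (SignedSet.sigma Y)) :=
  ⟨Equiv.sigmaSumDistrib _ _, by rintro ⟨i, (a | a)⟩ <;> rfl, by rintro ⟨i, (a | a)⟩ <;> rfl⟩

def sigma {ι : Type} [Finite ι] {X Y : ι → SignedSet C} (e : ∀ i, SIso (X i) (Y i)) :
    SIso (SignedSet.sigma X) (SignedSet.sigma Y) :=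
  ⟨Equiv.sigmaCongrRight fun i => (e i).e, fun a => (e a.1).sign a.2, fun a => (e a.1).label a.2⟩

end SIso

section
variable {C : Type u} [Category.{v} C]
namespace Linking
variable {X Y Z W X' Y' Z' : SignedSet C}

/-- Transport -/
def map (θ : Linking X) (e : SIso X Y) : Linking Y :=
  ofRel (fun a b _ _ h => θ.Edge (e.e.symm a) (e.e.symm b) h)
    (fun {a b _ _ _} h => ⟨h.lab.1.trans (e.symm.label a), h.lab.2.trans (e.symm.label b)⟩)
    (fun h => (e.symm.sign _).symm.trans h.neg)
    (fun h => (e.symm.sign _).symm.trans h.pos)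
    (fun a ha => by
      obtain ⟨b, c, d, h, r⟩ := Edge.exists_of_neg θ (e.e.symm a) ((e.symm.sign _).trans ha)
      exact ⟨e.e b, c, d, h, by simpa using r⟩)
    (fun a ha => by
      obtain ⟨b, c, d, h, r⟩ := Edge.exists_of_pos θ (e.e.symm a) ((e.symm.sign _).trans ha)
      exact ⟨e.e b, c, d, h, by simpa using r⟩)
    (fun r r' => by simpa using r.unique r')
    (fun r r' => by simpa using r.unique' r')

theorem map_Edge {θ : Linking X} {e : SIso X Y} {a b : Y.Var} {c d : C} {h : c ⟶ d} :
    (θ.map e).Edge a b h ↔ θ.Edge (e.e.symm a) (e.e.symm b) h := ofRel_Edge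

theorem Sits.of_edge {θ : Linking X} {S : Sys C} {i : X.Var → S.V}
    (H : ∀ a, S.lab (i a) = X.label a)
    (H' : ∀ {a b c d} {h : c ⟶ d}, θ.Edge a b h → S.Path (i a) (i b) h) : θ.Sits S i :=
  ⟨H, fun _ _ _ e => H' (.mk e)⟩

theorem sits_map {θ : Linking X} {e : SIso X Y} {S : Sys C} {i : Y.Var → S.V} :
    (θ.map e).Sits S i ↔ θ.Sits S (i ∘ e.e) := by
  constructor
  · intro H
    refine .of_edge (fun a => (H.1 _).trans (e.label a)) fun {a b _ _ h} r => ?_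
    exact H.path (map_Edge.2 (by simpa using r))
  · intro H
    refine .of_edge (fun a => ?_) fun {a b _ _ h} r => ?_
    · simpa [e.symm.label] using (H.1 (e.e.symm a)).trans (e.symm.label a)
    · simpa using H.path (map_Edge.1 r)

theorem map_map (θ : Linking X) (e : SIso X Y) (f : SIso Y Z) :
    (θ.map e).map f = θ.map (e.trans f) := by
  refine eq_of_sits_sys ?_
  rw [sits_map, sits_map]
  have := (sits_map (θ := θ) (e := e.trans f)).1 (sits_self _)
  exact this

theorem map_congr (θ : Linking X) {e f : SIso X Y} (h : ∀ a, e.e a = f.e a) :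
    θ.map e = θ.map f := by rw [SIso.ext h]

theorem map_refl (θ : Linking X) : θ.map (SIso.refl X) = θ := by
  refine eq_of_sits_sys ?_
  rw [sits_map]
  exact sits_self _

theorem map_symm_map (θ : Linking X) (e : SIso X Y) : (θ.map e).map e.symm = θ := by
  rw [map_map]
  conv_rhs => rw [← map_refl θ]
  exact map_congr _ fun a => by simp [SIso.trans, SIso.symm, SIso.refl]

theorem map_map_symm (θ : Linking Y) (e : SIso X Y) : (θ.map e.symm).map e = θ := by
  rw [map_map]
  conv_rhs => rw [← map_refl θ]
  exact map_congr _ fun a => by simp [SIso.trans, SIso.symm, SIso.refl]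

inductive SigmaRel {ι : Type} [Finite ι] {X : ι → SignedSet C} (θ : ∀ i, Linking (X i)) :
    (SignedSet.sigma X).Var → (SignedSet.sigma X).Var → ∀ {c d : C}, (c ⟶ d) → Prop
  | mk {i : ι} {a b : (X i).Var} {c d : C} {h : c ⟶ d} : (θ i).Edge a b h →
      SigmaRel θ ⟨i, a⟩ ⟨i, b⟩ h

/-- Disjoint union of graphs -/
def sigma {ι : Type} [Finite ι] {X : ι → SignedSet C} (θ : ∀ i, Linking (X i)) :
    Linking (SignedSet.sigma X) :=
  ofRel (SigmaRel θ)
    (fun r => by cases r with | mk e => exact e.lab)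
    (fun r => by cases r with | mk e => exact e.neg)
    (fun r => by cases r with | mk e => exact e.pos)
    (fun a ha => by
      obtain ⟨b, c, d, h, r⟩ := Edge.exists_of_neg (θ a.1) a.2 ha
      exact ⟨⟨a.1, b⟩, c, d, h, .mk r⟩)
    (fun a ha => by
      obtain ⟨b, c, d, h, r⟩ := Edge.exists_of_pos (θ a.1) a.2 ha
      exact ⟨⟨a.1, b⟩, c, d, h, .mk r⟩)
    (fun r r' => by
      cases r with | mk e => cases r' with | mk e' =>
      obtain ⟨rfl, h⟩ := e.unique e'
      exact ⟨rfl, h⟩)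
    (fun r r' => by
      cases r with | mk e => cases r' with | mk e' =>
      obtain rfl := e.unique' e'
      rfl)

theorem sits_sigma {ι : Type} [Finite ι] {X : ι → SignedSet C} {θ : ∀ i, Linking (X i)}
    {S : Sys C} {k : (SignedSet.sigma X).Var → S.V} :
    (sigma θ).Sits S k ↔ ∀ i, (θ i).Sits S fun a => k ⟨i, a⟩ := by
  constructor
  · intro H i
    exact .of_edge (fun a => H.1 ⟨i, a⟩) fun r => H.path (ofRel_Edge.2 (.mk r))
  · intro H
    refine .of_edge (fun a => (H a.1).1 a.2) fun r => ?_
    cases ofRel_Edge.1 r with | mk e => exact (H _).path e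

inductive SumRel (θ : Linking X) (θ' : Linking Y) :
    (X.tensor Y).Var → (X.tensor Y).Var → ∀ {c d : C}, (c ⟶ d) → Prop
  | inl {a b : X.Var} {c d : C} {h : c ⟶ d} : θ.Edge a b h → SumRel θ θ' (.inl a) (.inl b) h
  | inr {a b : Y.Var} {c d : C} {h : c ⟶ d} : θ'.Edge a b h → SumRel θ θ' (.inr a) (.inr b) h

/-- Disjoint union of two graphs -/
def sum (θ : Linking X) (θ' : Linking Y) : Linking (X.tensor Y) :=
  ofRel (SumRel θ θ')
    (fun r => by cases r with | inl e => exact e.lab | inr e => exact e.lab)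
    (fun r => by cases r with | inl e => exact e.neg | inr e => exact e.neg)
    (fun r => by cases r with | inl e => exact e.pos | inr e => exact e.pos)
    (fun a ha => by
      rcases a with a | a
      · obtain ⟨b, c, d, h, r⟩ := Edge.exists_of_neg θ a ha
        exact ⟨_, c, d, h, .inl r⟩
      · obtain ⟨b, c, d, h, r⟩ := Edge.exists_of_neg θ' a ha
        exact ⟨_, c, d, h, .inr r⟩)
    (fun a ha => by
      rcases a with a | a
      · obtain ⟨b, c, d, h, r⟩ := Edge.exists_of_pos θ a ha
        exact ⟨_, c, d, h, .inl r⟩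
      · obtain ⟨b, c, d, h, r⟩ := Edge.exists_of_pos θ' a ha
        exact ⟨_, c, d, h, .inr r⟩)
    (fun r r' => by
      cases r with
      | inl e =>
        cases r' with | inl e' =>
        obtain ⟨rfl, h⟩ := e.unique e'
        exact ⟨rfl, h⟩
      | inr e =>
        cases r' with | inr e' =>
        obtain ⟨rfl, h⟩ := e.unique e'
        exact ⟨rfl, h⟩)
    (fun r r' => by
      cases r with
      | inl e =>
        cases r' with | inl e' =>
        obtain rfl := e.unique' e'
        rfl
      | inr e =>
        cases r' with | inr e' =>
        obtain rfl := e.unique' e'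
        rfl)

theorem sits_sum {θ : Linking X} {θ' : Linking Y}
    {S : Sys C} {k : (X.tensor Y).Var → S.V} :
    (sum θ θ').Sits S k ↔ θ.Sits S (k ∘ Sum.inl) ∧ θ'.Sits S (k ∘ Sum.inr) := by
  constructor
  · intro H
    exact ⟨.of_edge (fun a => H.1 (.inl a)) fun r => H.path (ofRel_Edge.2 (.inl r)),
      .of_edge (fun a => H.1 (.inr a)) fun r => H.path (ofRel_Edge.2 (.inr r))⟩
  · intro H
    refine .of_edge ?_ fun r => ?_
    · rintro (a | a)
      · exact H.1.1 a
      · exact H.2.1 a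
    cases ofRel_Edge.1 r with
    | inl e => exact H.1.path e
    | inr e => exact H.2.path e

inductive IdRel (X : SignedSet C) :
    (X.hom X).Var → (X.hom X).Var → ∀ {c d : C}, (c ⟶ d) → Prop
  | pos {a : X.Var} : X.sign a = true → IdRel X (.inl a) (.inr a) (𝟙 (X.label a))
  | neg {a : X.Var} : X.sign a = false → IdRel X (.inr a) (.inl a) (𝟙 (X.label a))

/-- The identity graph -/
protected def id (X : SignedSet C) : Linking (X.hom X) :=
  ofRel (IdRel X)
    (fun r => by cases r <;> exact ⟨rfl, rfl⟩)
    (fun r => by cases r <;> simpa)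
    (fun r => by cases r <;> simpa)
    (fun a ha => by
      rcases a with a | a
      · exact ⟨_, _, _, _, .pos (by simpa using ha)⟩
      · exact ⟨_, _, _, _, .neg (by simpa using ha)⟩)
    (fun a ha => by
      rcases a with a | a
      · exact ⟨_, _, _, _, .neg (by simpa using ha)⟩
      · exact ⟨_, _, _, _, .pos (by simpa using ha)⟩)
    (fun r r' => by cases r <;> cases r' <;> exact ⟨rfl, HEq.rfl⟩)
    (fun r r' => by cases r <;> cases r' <;> rfl)

theorem sits_id {S : Sys C} {i : X.Var → S.V} (H : ∀ a, S.lab (i a) = X.label a) :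
    (Linking.id X).Sits S (Sum.elim i i) := by
  refine .of_edge (by rintro (a | a) <;> exact H a) fun r => ?_
  cases ofRel_Edge.1 r with
  | pos _ => exact Sys.Path.refl' (H _)
  | neg _ => exact Sys.Path.refl' (H _)

theorem elim_inl_inr {α β : Type} : Sum.elim (Sum.inl : α → α ⊕ β) Sum.inr = id := by
  funext a; rcases a with a | a <;> rfl

theorem comp_id (ξ : Linking (X.hom Y)) : comp ξ (Linking.id Y) = ξ := by
  refine eq_of_sits_sys ?_
  rw [← elim_inl_inr]
  exact Sits.comp (iY := Sum.inr) (by rw [elim_inl_inr]; exact sits_self ξ) (sits_id fun _ => rfl)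

theorem id_comp (ξ : Linking (X.hom Y)) : comp (Linking.id X) ξ = ξ := by
  refine eq_of_sits_sys ?_
  rw [← elim_inl_inr]
  exact Sits.comp (iY := Sum.inl) (sits_id fun _ => rfl) (by rw [elim_inl_inr]; exact sits_self ξ)

section Assoc

inductive TripleStep (ξ : Linking (X.hom Y)) (η : Linking (Y.hom Z)) (ζ : Linking (Z.hom W)) :
    (X.Var ⊕ Y.Var) ⊕ (Z.Var ⊕ W.Var) → (X.Var ⊕ Y.Var) ⊕ (Z.Var ⊕ W.Var) →
      ∀ {c d : C}, (c ⟶ d) → Prop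
  | one {a b : (X.hom Y).Var} {c d : C} {h : c ⟶ d} : ξ.Edge a b h →
      TripleStep ξ η ζ (.inl a) (.inl b) h
  | two {a b : (Y.hom Z).Var} {c d : C} {h : c ⟶ d} : η.Edge a b h →
      TripleStep ξ η ζ (Sum.map Sum.inr Sum.inl a) (Sum.map Sum.inr Sum.inl b) h
  | three {a b : (Z.hom W).Var} {c d : C} {h : c ⟶ d} : ζ.Edge a b h →
      TripleStep ξ η ζ (.inr a) (.inr b) h

variable {ξ : Linking (X.hom Y)} {η : Linking (Y.hom Z)} {ζ : Linking (Z.hom W)}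

theorem TripleStep.cases' {a b} {c d : C} {h : c ⟶ d} (s : TripleStep ξ η ζ a b h) :
    (∃ a' b', a = .inl a' ∧ b = .inl b' ∧ ξ.Edge a' b' h) ∨
    (∃ a' b', a = Sum.map Sum.inr Sum.inl a' ∧ b = Sum.map Sum.inr Sum.inl b' ∧ η.Edge a' b' h) ∨
    (∃ a' b', a = .inr a' ∧ b = .inr b' ∧ ζ.Edge a' b' h) := by
  cases s with
  | one e => exact .inl ⟨_, _, rfl, rfl, e⟩
  | two e => exact .inr (.inl ⟨_, _, rfl, rfl, e⟩)
  | three e => exact .inr (.inr ⟨_, _, rfl, rfl, e⟩)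

abbrev tripleSys (ξ : Linking (X.hom Y)) (η : Linking (Y.hom Z)) (ζ : Linking (Z.hom W)) : Sys C where
  V := (X.Var ⊕ Y.Var) ⊕ (Z.Var ⊕ W.Var)
  lab := Sum.elim (Sum.elim X.label Y.label) (Sum.elim Z.label W.label)
  step := TripleStep ξ η ζ
  step_lab s := by
    obtain ⟨a', b', rfl, rfl, e⟩ | ⟨a', b', rfl, rfl, e⟩ | ⟨a', b', rfl, rfl, e⟩ := s.cases' <;>
    obtain ⟨rfl, rfl⟩ := e.lab <;>
    rcases a' with a' | a' <;> rcases b' with b' | b' <;> exact ⟨rfl, rfl⟩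
  det s s' := by
    obtain ⟨a1, b1, h1, rfl, e⟩ | ⟨a1, b1, h1, rfl, e⟩ | ⟨a1, b1, h1, rfl, e⟩ := s.cases' <;>
    obtain ⟨a2, b2, h2, rfl, e'⟩ | ⟨a2, b2, h2, rfl, e'⟩ | ⟨a2, b2, h2, rfl, e'⟩ := s'.cases' <;>
    (have n1 := e.neg
     have n2 := e'.neg
     rcases a1 with a1 | a1 <;> rcases a2 with a2 | a2 <;> subst h1 <;>
     simp only [Sum.map_inl, Sum.map_inr, Sum.inl.injEq, Sum.inr.injEq, reduceCtorEq] at h2 <;>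
     first
     | (subst h2
        obtain ⟨rfl, h⟩ := e.unique e'
        exact ⟨rfl, h⟩)
     | (subst h2
        simp_all))

theorem comp_assoc (ξ : Linking (X.hom Y)) (η : Linking (Y.hom Z)) (ζ : Linking (Z.hom W)) :
    comp (comp ξ η) ζ = comp ξ (comp η ζ) := by
  have h1 : ξ.Sits (tripleSys ξ η ζ) (Sum.elim (Sum.inl ∘ Sum.inl) (Sum.inl ∘ Sum.inr)) :=
    .of_edge (by rintro (a | a) <;> rfl) fun {a b _ _ _} e => by
      have := Sys.Path.of_step (S := tripleSys ξ η ζ) (TripleStep.one e)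
      rcases a with a | a <;> rcases b with b | b <;> exact this
  have h2 : η.Sits (tripleSys ξ η ζ) (Sum.elim (Sum.inl ∘ Sum.inr) (Sum.inr ∘ Sum.inl)) :=
    .of_edge (by rintro (a | a) <;> rfl) fun {a b _ _ _} e => by
      have := Sys.Path.of_step (S := tripleSys ξ η ζ) (TripleStep.two e)
      rcases a with a | a <;> rcases b with b | b <;> exact this
  have h3 : ζ.Sits (tripleSys ξ η ζ) (Sum.elim (Sum.inr ∘ Sum.inl) (Sum.inr ∘ Sum.inr)) :=
    .of_edge (by rintro (a | a) <;> rfl) fun {a b _ _ _} e => by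
      have := Sys.Path.of_step (S := tripleSys ξ η ζ) (TripleStep.three e)
      rcases a with a | a <;> rcases b with b | b <;> exact this
  refine eq_of_sits ((h1.comp h2).comp h3) (h1.comp (h2.comp h3)) ?_ ?_
  · rintro (a | a) (b | b) h <;>
      simp only [Sum.elim_inl, Sum.elim_inr, Function.comp_apply, Sum.inl.injEq, Sum.inr.injEq,
        reduceCtorEq] at h <;> subst h <;> rfl
  · intro a ha b c d h s
    obtain ⟨a1, b1, h1, rfl, e⟩ | ⟨a1, b1, h1, rfl, e⟩ | ⟨a1, b1, h1, rfl, e⟩ :=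
      TripleStep.cases' s <;>
    have n1 := e.neg <;>
    rcases a with a | a <;> rcases a1 with a1 | a1 <;>
    simp only [Sum.elim_inl, Sum.elim_inr, Function.comp_apply, Sum.inl.injEq, Sum.inr.injEq,
      Sum.map_inl, Sum.map_inr, reduceCtorEq] at h1 <;> subst h1 <;> simp_all

end Assoc

end Linking

/-- signed sets and labelled graphs -/
instance : Category (SignedSet C) where
  Hom X Y := Linking (X.hom Y)
  id X := Linking.id X
  comp ξ η := Linking.comp ξ η
  id_comp := Linking.id_comp
  comp_id := Linking.comp_id
  assoc := Linking.comp_assoc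

end
open SignedSet

section
variable {C : Type u} [Category.{v} C] {D : Type u'} [Category.{v'} D]

namespace Linking
variable {X Y Z W X' Y' Z' : SignedSet C}

theorem Sits.congr {θ : Linking X} {S : Sys C} {i j : X.Var → S.V} (H : θ.Sits S i)
    (h : ∀ a, i a = j a) : θ.Sits S j := by
  obtain rfl : i = j := funext h
  exact H

theorem sits_id' {S : Sys C} {k : (X.hom X).Var → S.V}
    (h : ∀ a, k (.inl a) = k (.inr a)) (H : ∀ a, S.lab (k (.inl a)) = X.label a) :
    Sits (X := X.hom X) (𝟙 X) S k :=
  (sits_id (i := fun a => k (.inl a)) H).congr (by rintro (a | a); exacts [rfl, h a])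

/-- Conjugation by relabelling of variables -/
def conj (e : SIso X X') (f : SIso Y Y') (ξ : X ⟶ Y) : X' ⟶ Y' :=
  Linking.map (X := X.hom Y) ξ (e.hom f)

theorem sits_conj {e : SIso X X'} {f : SIso Y Y'} {ξ : X ⟶ Y} {S : Sys C}
    {k : (X'.hom Y').Var → S.V} :
    Sits (X := X'.hom Y') (conj e f ξ) S k ↔
      Sits (X := X.hom Y) ξ S (Sum.elim (fun a => k (.inl (e.e a))) fun a => k (.inr (f.e a))) := by
  unfold conj
  rw [sits_map]
  have : k ∘ (e.hom f).e = Sum.elim (fun a => k (.inl (e.e a))) fun a => k (.inr (f.e a)) := by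
    funext a; rcases a with a | a <;> rfl
  rw [this]

/-- The graph of a relabelling of variables -/
def ofSIso (e : SIso X Y) : X ⟶ Y := conj (SIso.refl X) e (𝟙 X)

theorem sits_ofSIso {e : SIso X Y} {S : Sys C} {k : (X.hom Y).Var → S.V}
    (h : ∀ a, k (.inl a) = k (.inr (e.e a))) (H : ∀ a, S.lab (k (.inl a)) = X.label a) :
    Sits (X := X.hom Y) (ofSIso e) S k :=
  sits_conj.2 (sits_id' h H)

/-- `ξ ⊗ η` -/
def tensorMap (ξ : X ⟶ Y) (η : X' ⟶ Y') : X.tensor X' ⟶ Y.tensor Y' :=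
  Linking.map (Linking.sum (X := X.hom Y) (Y := X'.hom Y') ξ η) (SIso.tensorHom X Y X' Y')

theorem sits_tensorMap {ξ : X ⟶ Y} {η : X' ⟶ Y'} {S : Sys C}
    {k : ((X.tensor X').hom (Y.tensor Y')).Var → S.V} :
    Sits (X := (X.tensor X').hom (Y.tensor Y')) (tensorMap ξ η) S k ↔
      Sits (X := X.hom Y) ξ S (Sum.elim (fun a => k (.inl (.inl a))) fun a => k (.inr (.inl a))) ∧
      Sits (X := X'.hom Y') η S
        (Sum.elim (fun a => k (.inl (.inr a))) fun a => k (.inr (.inr a))) := by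
  unfold tensorMap
  rw [sits_map, sits_sum]
  have h1 : (k ∘ (SIso.tensorHom X Y X' Y').e) ∘ Sum.inl =
    (Sum.elim (fun a => k (.inl (.inl a))) fun a => k (.inr (.inl a))) := by
    funext a; rcases a with a | a <;> rfl
  have h2 : (k ∘ (SIso.tensorHom X Y X' Y').e) ∘ Sum.inr =
    (Sum.elim (fun a => k (.inl (.inr a))) fun a => k (.inr (.inr a))) := by
    funext a; rcases a with a | a <;> rfl
  rw [h1, h2]

/-- `[ξ, η]` -/
def homMap (ξ : X ⟶ Y) (η : X' ⟶ Y') : Y.hom X' ⟶ X.hom Y' :=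
  Linking.map (Linking.sum (X := X.hom Y) (Y := X'.hom Y') ξ η) (SIso.homHom X Y X' Y')

theorem sits_homMap {ξ : X ⟶ Y} {η : X' ⟶ Y'} {S : Sys C}
    {k : ((Y.hom X').hom (X.hom Y')).Var → S.V} :
    Sits (X := (Y.hom X').hom (X.hom Y')) (homMap ξ η) S k ↔
      Sits (X := X.hom Y) ξ S (Sum.elim (fun a => k (.inr (.inl a))) fun a => k (.inl (.inl a))) ∧
      Sits (X := X'.hom Y') η S
        (Sum.elim (fun a => k (.inl (.inr a))) fun a => k (.inr (.inr a))) := by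
  unfold homMap
  rw [sits_map, sits_sum]
  have h1 : (k ∘ (SIso.homHom X Y X' Y').e) ∘ Sum.inl =
    (Sum.elim (fun a => k (.inr (.inl a))) fun a => k (.inl (.inl a))) := by
    funext a; rcases a with a | a <;> rfl
  have h2 : (k ∘ (SIso.homHom X Y X' Y').e) ∘ Sum.inr =
    (Sum.elim (fun a => k (.inl (.inr a))) fun a => k (.inr (.inr a))) := by
    funext a; rcases a with a | a <;> rfl
  rw [h1, h2]

def curry (ξ : X.tensor Y ⟶ Z) : X ⟶ Y.hom Z :=
  Linking.map (X := (X.tensor Y).hom Z) ξ (SIso.curry X Y Z)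

def uncurry (ξ : X ⟶ Y.hom Z) : X.tensor Y ⟶ Z :=
  Linking.map (X := X.hom (Y.hom Z)) ξ (SIso.curry X Y Z).symm

theorem sits_curry {ξ : X.tensor Y ⟶ Z} {S : Sys C} {k : (X.hom (Y.hom Z)).Var → S.V} :
    Sits (X := X.hom (Y.hom Z)) (curry ξ) S k ↔
      Sits (X := (X.tensor Y).hom Z) ξ S (Sum.elim (Sum.elim (fun a => k (.inl a))
        fun a => k (.inr (.inl a))) fun a => k (.inr (.inr a))) := by
  unfold curry
  rw [sits_map]
  have : k ∘ (SIso.curry X Y Z).e = (Sum.elim (Sum.elim (fun a => k (.inl a))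
        fun a => k (.inr (.inl a))) fun a => k (.inr (.inr a))) := by
    funext a; rcases a with (a | a) | a <;> rfl
  rw [this]

theorem sits_uncurry {ξ : X ⟶ Y.hom Z} {S : Sys C} {k : ((X.tensor Y).hom Z).Var → S.V} :
    Sits (X := (X.tensor Y).hom Z) (uncurry ξ) S k ↔
      Sits (X := X.hom (Y.hom Z)) ξ S (Sum.elim (fun a => k (.inl (.inl a)))
        (Sum.elim (fun a => k (.inl (.inr a))) fun a => k (.inr a))) := by
  unfold uncurry
  rw [sits_map]
  have : k ∘ (SIso.curry X Y Z).symm.e = (Sum.elim (fun a => k (.inl (.inl a)))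
        (Sum.elim (fun a => k (.inl (.inr a))) fun a => k (.inr a))) := by
    funext a; rcases a with a | (a | a) <;> rfl
  rw [this]

/-- `d : X ⟶ [Y, X ⊗ Y]` -/
def coev (X Y : SignedSet C) : X ⟶ Y.hom (X.tensor Y) := curry (𝟙 _)

/-- `e : [X, Y] ⊗ X ⟶ Y` -/
def ev (X Y : SignedSet C) : (X.hom Y).tensor X ⟶ Y := uncurry (𝟙 _)

end Linking
end

/-- Shapes: built from `I` and a variable by `⊗` and `[ , ]` -/
inductive Shape : Type
  | unit : Shape
  | one : Shape
  | tensor : Shape → Shape → Shape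
  | hom : Shape → Shape → Shape

namespace Shape

/-- The variables of a shape -/
def Var : Shape → Type
  | unit => Empty
  | one => Unit
  | tensor T S => T.Var ⊕ S.Var
  | hom T S => T.Var ⊕ S.Var

/-- The variances of the variables: `true` for covariant -/
def sign : (T : Shape) → T.Var → Bool
  | unit => Empty.elim
  | one => fun _ => true
  | tensor T S => Sum.elim T.sign S.sign
  | hom T S => Sum.elim (fun a => !T.sign a) S.sign

theorem finite_var : (T : Shape) → Finite T.Var
  | unit => inferInstanceAs (Finite Empty)
  | one => inferInstanceAs (Finite Unit)
  | tensor T S => by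
    have := T.finite_var; have := S.finite_var
    exact inferInstanceAs (Finite (T.Var ⊕ S.Var))
  | hom T S => by
    have := T.finite_var; have := S.finite_var
    exact inferInstanceAs (Finite (T.Var ⊕ S.Var))

abbrev signed (T : Shape) : SignedSet (Discrete PUnit.{1}) where
  Var := T.Var
  fin := T.finite_var
  sign := T.sign
  label := fun _ => ⟨⟨⟩⟩

end Shape

open SignedSet Linking

/-- The allowable graphs: the smallest class that contains identities, the associativity, unit and
symmetry isomorphisms and the adjunction graphs `d` and `e`, and is closed under composition, `⊗`
and `[ , ]`. Graphs between shapes are graphs whose labels carry no information. -/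
inductive Allowable : ∀ {T S : Shape}, (T.signed ⟶ S.signed) → Prop
  | id (T : Shape) : Allowable (𝟙 T.signed)
  | comp {T S R : Shape} {ξ : T.signed ⟶ S.signed} {η : S.signed ⟶ R.signed} :
      Allowable ξ → Allowable η → Allowable (ξ ≫ η)
  | tensor {T S T' S' : Shape} {ξ : T.signed ⟶ S.signed} {η : T'.signed ⟶ S'.signed} :
      Allowable ξ → Allowable η →
        Allowable (T := .tensor T T') (S := .tensor S S') (tensorMap ξ η)
  | hom {T S T' S' : Shape} {ξ : T.signed ⟶ S.signed} {η : T'.signed ⟶ S'.signed} :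
      Allowable ξ → Allowable η → Allowable (T := .hom S T') (S := .hom T S') (homMap ξ η)
  | assoc (T S R : Shape) :
      Allowable (T := .tensor (.tensor T S) R) (S := .tensor T (.tensor S R))
        (ofSIso (SIso.assoc T.signed S.signed R.signed))
  | assoc_inv (T S R : Shape) :
      Allowable (T := .tensor T (.tensor S R)) (S := .tensor (.tensor T S) R)
        (ofSIso (SIso.assoc T.signed S.signed R.signed).symm)
  | unitor (T : Shape) : Allowable (S := .tensor T .unit) (ofSIso (SIso.unitor T.signed))
  | unitor_inv (T : Shape) : Allowable (T := .tensor T .unit) (ofSIso (SIso.unitor T.signed).symm)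
  | comm (T S : Shape) :
      Allowable (T := .tensor T S) (S := .tensor S T) (ofSIso (SIso.comm T.signed S.signed))
  | coev (T S : Shape) : Allowable (S := .hom S (.tensor T S)) (coev T.signed S.signed)
  | ev (T S : Shape) : Allowable (T := .tensor (.hom T S) T) (ev T.signed S.signed)

section
variable {C : Type u} [Category.{v} C] {D : Type u'} [Category.{v'} D]
  {E : Type u''} [Category.{v''} E]

abbrev SignedSet.mapLabel (F : C ⥤ D) (X : SignedSet C) : SignedSet D where
  Var := X.Var
  fin := X.fin
  sign := X.sign
  label := fun a => F.obj (X.label a)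

def SIso.mapLabel (F : C ⥤ D) {X Y : SignedSet C} (e : SIso X Y) :
    SIso (X.mapLabel F) (Y.mapLabel F) :=
  ⟨e.e, e.sign, fun a => congrArg F.obj (e.label a)⟩

namespace Linking
variable {X Y Z X' Y' Z' : SignedSet C}

inductive MapLabelRel (F : C ⥤ D) (θ : Linking X) : X.Var → X.Var → ∀ {c d : D}, (c ⟶ d) → Prop
  | mk {a b : X.Var} {c d : C} {h : c ⟶ d} : θ.Edge a b h → MapLabelRel F θ a b (F.map h)

def mapLabel (F : C ⥤ D) (θ : Linking X) : Linking (X.mapLabel F) :=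
  ofRel (C := D) (X := X.mapLabel F) (fun a b _ _ h => MapLabelRel F θ a b h)
    (fun r => by cases r with | mk e => obtain ⟨rfl, rfl⟩ := e.lab; exact ⟨rfl, rfl⟩)
    (fun r => by cases r with | mk e => exact e.neg)
    (fun r => by cases r with | mk e => exact e.pos)
    (fun a ha => by
      obtain ⟨b, c, d, h, r⟩ := Edge.exists_of_neg θ a ha
      exact ⟨b, _, _, _, .mk r⟩)
    (fun a ha => by
      obtain ⟨b, c, d, h, r⟩ := Edge.exists_of_pos θ a ha
      exact ⟨b, _, _, _, .mk r⟩)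
    (fun r r' => by
      cases r with | mk e => cases r' with | mk e' =>
      obtain ⟨rfl, h⟩ := e.unique e'
      obtain ⟨rfl, rfl⟩ := e.lab
      obtain ⟨rfl, rfl⟩ := e'.lab
      cases h
      exact ⟨rfl, HEq.rfl⟩)
    (fun r r' => by
      cases r with | mk e => cases r' with | mk e' => exact e.unique' e')

theorem Edge.mapLabel {F : C ⥤ D} {θ : Linking X} {a b : X.Var} {c d : C} {h : c ⟶ d}
    (e : θ.Edge a b h) : (θ.mapLabel F).Edge a b (F.map h) := ofRel_Edge.2 (.mk e)

theorem Edge.of_mapLabel {F : C ⥤ D} {θ : Linking X} {a b : X.Var} {c d : D} {h : c ⟶ d}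
    (e : (θ.mapLabel F).Edge a b h) : MapLabelRel F θ a b h := ofRel_Edge.1 e

theorem mapPath (F : C ⥤ D) {S : Sys C} {S' : Sys D} {f : S.V → S'.V}
    (hl : ∀ a, S'.lab (f a) = F.obj (S.lab a))
    (hs : ∀ {a b c d} {h : c ⟶ d}, S.step a b h → S'.Path (f a) (f b) (F.map h))
    {a b : S.V} {c d : C} {h : c ⟶ d} (p : S.Path a b h) : S'.Path (f a) (f b) (F.map h) := by
  induction p with
  | refl a => rw [F.map_id]; exact Sys.Path.refl' (hl a)
  | cons s p ih => rw [F.map_comp]; exact (hs s).trans ih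

/-- the image of a labelled graph under a functor -/
def mapHom (F : C ⥤ D) (ξ : X ⟶ Y) : X.mapLabel F ⟶ Y.mapLabel F :=
  map (X := (X.hom Y).mapLabel F) (mapLabel (X := X.hom Y) F ξ)
    ⟨Equiv.refl _, by rintro (a | a) <;> rfl, by rintro (a | a) <;> rfl⟩

theorem mapHom_Edge {F : C ⥤ D} {ξ : X ⟶ Y} {a b : (X.hom Y).Var} {c d : D} {h : c ⟶ d} :
    Edge (X := (X.mapLabel F).hom (Y.mapLabel F)) (mapHom F ξ) a b h ↔
      MapLabelRel (X := X.hom Y) F ξ a b h := by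
  unfold mapHom
  rw [map_Edge]
  exact ⟨Edge.of_mapLabel, fun e => ofRel_Edge.2 e⟩

theorem mapHom_sits {F : C ⥤ D} {ξ : X ⟶ Y} {S : Sys D}
    {k : ((X.mapLabel F).hom (Y.mapLabel F)).Var → S.V}
    (hl : ∀ a, S.lab (k a) = F.obj ((X.hom Y).label a))
    (hs : ∀ {a b c d} {h : c ⟶ d}, Edge (X := X.hom Y) ξ a b h → S.Path (k a) (k b) (F.map h)) :
    Sits (X := (X.mapLabel F).hom (Y.mapLabel F)) (mapHom F ξ) S k := by
  refine .of_edge (by rintro (a | a); exacts [hl (.inl a), hl (.inr a)]) fun e => ?_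
  have r := mapHom_Edge.1 e
  cases r with | mk e' => exact hs e'

theorem id_Edge {X : SignedSet C} {a b : (X.hom X).Var} {c d : C} {h : c ⟶ d} :
    Edge (X := X.hom X) (𝟙 X) a b h ↔ IdRel X a b h := by
  change (Linking.id X).Edge a b h ↔ _
  unfold Linking.id
  exact ofRel_Edge

theorem mapHom_id (F : C ⥤ D) : mapHom F (𝟙 X) = 𝟙 (X.mapLabel F) := by
  refine (eq_of_sits_sys (θ := Linking.id (X.mapLabel F)) ?_)
  refine mapHom_sits (by rintro (a | a) <;> rfl) fun e => ?_
  refine Sys.Path.of_step (S := sys (Linking.id (X.mapLabel F))) (id_Edge.2 ?_)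
  have r := id_Edge.1 e
  cases r with
  | pos h => rw [F.map_id]; exact .pos (X := X.mapLabel F) h
  | neg h => rw [F.map_id]; exact .neg (X := X.mapLabel F) h

theorem mapHom_comp (F : C ⥤ D) (ξ : X ⟶ Y) (η : Y ⟶ Z) :
    mapHom F (ξ ≫ η) = mapHom F ξ ≫ mapHom F η := by
  refine eq_of_sits (X := (X.mapLabel F).hom (Z.mapLabel F)) (S := compSys (mapHom F ξ)
    (mapHom F η)) (i := embO _ _ _) ?_ comp_sits_compSys embO_inj fun a ha =>
      compSys_terminal a ha
  refine mapHom_sits (by rintro (a | a) <;> rfl) fun {a b _ _ h} e => ?_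
  have p := comp_sits_compSys.path e
  refine mapPath F (S := compSys ξ η) (S' := compSys (mapHom F ξ) (mapHom F η)) (f := id)
    (by rintro (a | a | a) <;> rfl) (fun s => ?_) p
  refine Sys.Path.of_step (S := compSys (mapHom F ξ) (mapHom F η)) ?_
  obtain ⟨a', b', rfl, rfl, e⟩ | ⟨a', b', rfl, rfl, e⟩ := compStep_cases s
  · exact .left (mapHom_Edge.2 (.mk e))
  · exact .right (mapHom_Edge.2 (.mk e))

end Linking

/-! ### Underlying unlabelled graphs -/

abbrev SignedSet.forget (X : SignedSet C) : SignedSet (Discrete PUnit.{1}) :=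
  X.mapLabel (Functor.star C)

def SIso.forget {X Y : SignedSet C} (e : SIso X Y) : SIso X.forget Y.forget :=
  e.mapLabel _

namespace Linking
variable {X Y Z X' Y' Z' : SignedSet C}

def forget (θ : Linking X) : Linking X.forget := θ.mapLabel (Functor.star C)

theorem Edge.cast {X : SignedSet (Discrete PUnit.{1})} {θ : Linking X} {a b : X.Var}
    {c d c' d' : Discrete PUnit.{1}} {h : c ⟶ d} (e : θ.Edge a b h) (h' : c' ⟶ d') :
    θ.Edge a b h' := by
  obtain rfl : c = c' := Subsingleton.elim _ _
  obtain rfl : d = d' := Subsingleton.elim _ _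
  obtain rfl : h = h' := Subsingleton.elim _ _
  exact e

theorem forget_Edge {θ : Linking X} {a b : X.Var} {c' d' : Discrete PUnit.{1}} {h' : c' ⟶ d'} :
    θ.forget.Edge a b h' ↔ ∃ c d, ∃ h : c ⟶ d, θ.Edge a b h := by
  constructor
  · intro e
    have r := Edge.of_mapLabel e
    cases r with | mk e' => exact ⟨_, _, _, e'⟩
  · rintro ⟨c, d, h, e⟩
    exact (Edge.mapLabel (F := Functor.star C) e).cast _

theorem eq_of_edge {X : SignedSet (Discrete PUnit.{1})} {θ θ' : Linking X}
    (H : ∀ {a b c d} {h : c ⟶ d}, θ.Edge a b h → ∃ c d, ∃ h : c ⟶ d, θ'.Edge a b h) :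
    θ = θ' := by
  refine ext_of_le fun a b h e => ?_
  obtain ⟨c, d, h', e'⟩ := H (.mk e)
  exact edge_iff _ |>.1 (e'.cast _)

theorem forget_map (θ : Linking X) (e : SIso X Y) :
    (θ.map e).forget = θ.forget.map e.forget := by
  refine eq_of_edge fun r => ?_
  obtain ⟨c, d, h, r⟩ := forget_Edge.1 r
  exact ⟨_, _, 𝟙 ⟨⟨⟩⟩, map_Edge.2 (forget_Edge.2 ⟨_, _, _, map_Edge.1 r⟩)⟩

theorem sum_Edge {θ : Linking X} {θ' : Linking Y} {a b : (X.tensor Y).Var} {c d : C} {h : c ⟶ d} :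
    (sum θ θ').Edge a b h ↔ SumRel θ θ' a b h := by
  unfold sum
  exact ofRel_Edge

theorem forget_sum (θ : Linking X) (θ' : Linking Y) :
    (sum θ θ').forget = sum θ.forget θ'.forget := by
  refine eq_of_edge fun r => ?_
  obtain ⟨c, d, h, r⟩ := forget_Edge.1 r
  refine ⟨Discrete.mk PUnit.unit.{1}, _, 𝟙 (Discrete.mk PUnit.unit.{1}), sum_Edge.2 ?_⟩
  have r' := sum_Edge.1 r
  cases r' with
  | inl r => exact .inl (forget_Edge.2 ⟨_, _, _, r⟩)
  | inr r => exact .inr (forget_Edge.2 ⟨_, _, _, r⟩)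

/-- underlying graph of a labelled graph -/
def forgetHom (ξ : X ⟶ Y) : X.forget ⟶ Y.forget := forget (X := X.hom Y) ξ

theorem forgetHom_id : forgetHom (𝟙 X) = 𝟙 X.forget := by
  refine eq_of_edge (X := X.forget.hom X.forget) fun r => ?_
  obtain ⟨c, d, h, r⟩ := (forget_Edge (X := X.hom X)).1 r
  refine ⟨Discrete.mk PUnit.unit.{1}, _, 𝟙 (Discrete.mk PUnit.unit.{1}), id_Edge.2 ?_⟩
  have r' := id_Edge.1 r
  cases r' with
  | pos h => exact .pos (X := X.forget) h
  | neg h => exact .neg (X := X.forget) h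

theorem forgetHom_comp (ξ : X ⟶ Y) (η : Y ⟶ Z) :
    forgetHom (ξ ≫ η) = forgetHom ξ ≫ forgetHom η := by
  have h : ∀ {X Y : SignedSet C} (ξ : X ⟶ Y), forgetHom ξ = mapHom (Functor.star C) ξ := by
    intro X Y ξ
    refine eq_of_edge (X := X.forget.hom Y.forget) fun r => ?_
    exact ⟨_, _, _, mapHom_Edge.2 (Edge.of_mapLabel (X := X.hom Y) r)⟩
  simp only [h, mapHom_comp]

theorem forgetHom_homMap (ξ : X ⟶ Y) (η : X' ⟶ Y') :
    forgetHom (homMap ξ η) = homMap (forgetHom ξ) (forgetHom η) := by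
  unfold forgetHom homMap
  erw [forget_map, forget_sum]
  rfl

theorem forgetHom_conj (e : SIso X X') (f : SIso Y Y') (ξ : X ⟶ Y) :
    forgetHom (conj e f ξ) = conj e.forget f.forget (forgetHom ξ) := by
  unfold forgetHom conj
  erw [forget_map]
  rfl

theorem forgetHom_ofSIso (e : SIso X Y) : forgetHom (ofSIso e) = ofSIso e.forget := by
  unfold ofSIso
  rw [forgetHom_conj, forgetHom_id]
  rfl

theorem forgetHom_curry (ξ : X.tensor Y ⟶ Z) :
    forgetHom (curry ξ) =
      curry (X := X.forget) (Y := Y.forget) (Z := Z.forget) (forgetHom ξ) := by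
  unfold forgetHom curry
  erw [forget_map]
  rfl

theorem forgetHom_uncurry (ξ : X ⟶ Y.hom Z) :
    forgetHom (uncurry ξ) =
      uncurry (X := X.forget) (Y := Y.forget) (Z := Z.forget) (forgetHom ξ) := by
  unfold forgetHom uncurry
  erw [forget_map]
  rfl

end Linking
end

/-! ### Labelled shapes -/

/-- Labelled shapes `|T|(A₁, …, Aₖ)` -/
structure LShape (C : Type u) where
  shape : Shape
  label : shape.Var → C

namespace LShape
variable {C : Type u} [Category.{v} C]

abbrev signed (α : LShape C) : SignedSet C where
  Var := α.shape.Var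
  fin := α.shape.finite_var
  sign := α.shape.sign
  label := α.label

def unit (C : Type u) : LShape C := ⟨.unit, Empty.elim⟩
def of (c : C) : LShape C := ⟨.one, fun _ => c⟩
def tensor (α β : LShape C) : LShape C := ⟨.tensor α.shape β.shape, Sum.elim α.label β.label⟩
def hom (α β : LShape C) : LShape C := ⟨.hom α.shape β.shape, Sum.elim α.label β.label⟩

/-- A labelled graph is allowable if its underlying graph is. -/
def Allow {α β : LShape C} (ξ : α.signed ⟶ β.signed) : Prop :=
  Allowable (T := α.shape) (S := β.shape) (forgetHom ξ)

end LShape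

open SignedSet Linking

section
variable {C : Type u} [Category.{v} C]
namespace Linking
variable {X Y Z W X' Y' Z' : SignedSet C}

def HSits (ξ : X ⟶ Y) (S : Sys C) (i : X.Var → S.V) (j : Y.Var → S.V) : Prop :=
  Sits (X := X.hom Y) ξ S (Sum.elim i j)

theorem hsits_iff {ξ : X ⟶ Y} {S : Sys C} {k : (X.hom Y).Var → S.V} :
    Sits (X := X.hom Y) ξ S k ↔ HSits ξ S (fun a => k (.inl a)) (fun a => k (.inr a)) :=
  ⟨fun H => H.congr (by rintro (a | a) <;> rfl), fun H => H.congr (by rintro (a | a) <;> rfl)⟩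

theorem HSits.left {ξ : X ⟶ Y} {S : Sys C} {i : X.Var → S.V} {j : Y.Var → S.V}
    (H : HSits ξ S i j) (a : X.Var) : S.lab (i a) = X.label a := H.1 (.inl a)

theorem HSits.right {ξ : X ⟶ Y} {S : Sys C} {i : X.Var → S.V} {j : Y.Var → S.V}
    (H : HSits ξ S i j) (a : Y.Var) : S.lab (j a) = Y.label a := H.1 (.inr a)

theorem HSits.comp {ξ : X ⟶ Y} {η : Y ⟶ Z} {S : Sys C} {i : X.Var → S.V} {j : Y.Var → S.V}
    {k : Z.Var → S.V} (H : HSits ξ S i j) (H' : HSits η S j k) : HSits (ξ ≫ η) S i k :=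
  Sits.comp H H'

theorem hsits_id {S : Sys C} {i : X.Var → S.V} (H : ∀ a, S.lab (i a) = X.label a) :
    HSits (𝟙 X) S i i := sits_id H

theorem hsits_conj {e : SIso X X'} {f : SIso Y Y'} {ξ : X ⟶ Y} {S : Sys C}
    {i : X'.Var → S.V} {j : Y'.Var → S.V} :
    HSits (conj e f ξ) S i j ↔ HSits ξ S (fun a => i (e.e a)) (fun a => j (f.e a)) :=
  sits_conj

theorem hsits_ofSIso {e : SIso X Y} {S : Sys C} {i : X.Var → S.V} {j : Y.Var → S.V}
    (h : ∀ a, i a = j (e.e a)) (H : ∀ a, S.lab (i a) = X.label a) :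
    HSits (ofSIso e) S i j := sits_ofSIso h H

theorem hsits_tensorMap {ξ : X ⟶ Y} {η : X' ⟶ Y'} {S : Sys C}
    {i : X.Var ⊕ X'.Var → S.V} {j : Y.Var ⊕ Y'.Var → S.V} :
    HSits (tensorMap ξ η) S i j ↔
      HSits ξ S (fun a => i (.inl a)) (fun a => j (.inl a)) ∧
      HSits η S (fun a => i (.inr a)) (fun a => j (.inr a)) := sits_tensorMap

theorem hsits_homMap {ξ : X ⟶ Y} {η : X' ⟶ Y'} {S : Sys C}
    {i : Y.Var ⊕ X'.Var → S.V} {j : X.Var ⊕ Y'.Var → S.V} :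
    HSits (homMap ξ η) S i j ↔
      HSits ξ S (fun a => j (.inl a)) (fun a => i (.inl a)) ∧
      HSits η S (fun a => i (.inr a)) (fun a => j (.inr a)) := sits_homMap

theorem hsits_curry {ξ : X.tensor Y ⟶ Z} {S : Sys C} {i : X.Var → S.V}
    {j : Y.Var ⊕ Z.Var → S.V} :
    HSits (curry ξ) S i j ↔
      HSits ξ S (Sum.elim i fun a => j (.inl a)) (fun a => j (.inr a)) := sits_curry

theorem hsits_uncurry {ξ : X ⟶ Y.hom Z} {S : Sys C} {i : X.Var ⊕ Y.Var → S.V}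
    {j : Z.Var → S.V} :
    HSits (uncurry ξ) S i j ↔
      HSits ξ S (fun a => i (.inl a)) (Sum.elim (fun a => i (.inr a)) j) := sits_uncurry

theorem HSits.congr {ξ : X ⟶ Y} {S : Sys C} {i i' : X.Var → S.V} {j j' : Y.Var → S.V}
    (H : HSits ξ S i j) (h : ∀ a, i a = i' a) (h' : ∀ a, j a = j' a) : HSits ξ S i' j' := by
  obtain rfl : i = i' := funext h
  obtain rfl : j = j' := funext h'
  exact H

abbrev hsys (ξ : X ⟶ Y) : Sys C := sys (X := X.hom Y) ξ

theorem hsits_self (ξ : X ⟶ Y) : HSits ξ (hsys ξ) Sum.inl Sum.inr :=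
  (hsits_iff (ξ := ξ) (S := hsys ξ) (k := id)).1 (sits_self (X := X.hom Y) ξ)

theorem eq_of_hsits {ξ ζ : X ⟶ Y} (H : HSits ζ (hsys ξ) Sum.inl Sum.inr) : ζ = ξ :=
  eq_of_sits_sys (X := X.hom Y) ((hsits_iff (ξ := ζ) (S := hsys ξ) (k := id)).2 H)

/-- Two ends of an identity edge -/
def IdAt (S : Sys C) (s : Bool) (c : C) (p q : S.V) : Prop :=
  S.lab p = c ∧ S.lab q = c ∧ (s = true → S.Path p q (𝟙 c)) ∧ (s = false → S.Path q p (𝟙 c))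

theorem hsits_id_iff {S : Sys C} {i j : X.Var → S.V} :
    HSits (𝟙 X) S i j ↔ ∀ a, IdAt S (X.sign a) (X.label a) (i a) (j a) := by
  constructor
  · intro H a
    exact ⟨H.left a, H.right a,
      fun h => Sits.path (X := X.hom X) H (id_Edge.2 (.pos h)),
      fun h => Sits.path (X := X.hom X) H (id_Edge.2 (.neg h))⟩
  · intro H
    refine Sits.of_edge (X := X.hom X)
      (by rintro (a | a); exacts [(H a).1, (H a).2.1]) fun e => ?_
    have r := id_Edge.1 e
    cases r with
    | pos h => exact (H _).2.2.1 h
    | neg h => exact (H _).2.2.2 h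

theorem hsits_ofSIso_iff {e : SIso X Y} {S : Sys C} {i : X.Var → S.V} {j : Y.Var → S.V} :
    HSits (ofSIso e) S i j ↔ ∀ a, IdAt S (X.sign a) (X.label a) (i a) (j (e.e a)) := by
  unfold ofSIso
  rw [hsits_conj, hsits_id_iff]
  rfl

theorem ofSIso_refl : ofSIso (SIso.refl X) = 𝟙 X := by
  refine eq_of_hsits (hsits_ofSIso_iff.2 ?_)
  exact hsits_id_iff.1 (hsits_self _)

theorem ofSIso_trans (e : SIso X Y) (f : SIso Y Z) :
    ofSIso e ≫ ofSIso f = ofSIso (e.trans f) := by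
  refine eq_of_hsits ?_
  have H := hsits_ofSIso_iff.1 (hsits_self (ofSIso (e.trans f)))
  refine HSits.comp (j := fun b => Sum.inr (f.e b)) (hsits_ofSIso_iff.2 H)
    (hsits_ofSIso (S := hsys (ofSIso (e.trans f))) (i := fun b => Sum.inr (f.e b))
      (fun _ => rfl) fun a => f.label a)

theorem tensorMap_ofSIso (e : SIso X Y) (f : SIso X' Y') :
    tensorMap (ofSIso e) (ofSIso f) = ofSIso (e.tensor f) := by
  refine eq_of_hsits ?_
  have H := hsits_ofSIso_iff.1 (hsits_self (ofSIso (e.tensor f)))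
  rw [hsits_tensorMap, hsits_ofSIso_iff, hsits_ofSIso_iff]
  exact ⟨fun a => H (.inl a), fun a => H (.inr a)⟩

theorem IdAt.symm {S : Sys C} {s : Bool} {c : C} {p q : S.V} (H : IdAt S (!s) c p q) :
    IdAt S s c q p :=
  ⟨H.2.1, H.1, fun h => H.2.2.2 (by simpa using h), fun h => H.2.2.1 (by simpa using h)⟩

theorem conj_comp (e : SIso X X') (f : SIso Y Y') (g : SIso Z Z') (ξ : X ⟶ Y) (η : Y ⟶ Z) :
    conj e g (ξ ≫ η) = conj e f ξ ≫ conj f g η := by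
  refine eq_of_sits (X := X'.hom Z') (S := compSys (conj e f ξ) (conj f g η)) (i := embO _ _ _)
    ?_ comp_sits_compSys embO_inj fun a ha => compSys_terminal a ha
  have h1 := (hsits_iff (ξ := conj e f ξ)).1 (left_sits_compSys (ξ := conj e f ξ)
    (η := conj f g η))
  have h2 := (hsits_iff (ξ := conj f g η)).1 (right_sits_compSys (ξ := conj e f ξ)
    (η := conj f g η))
  refine hsits_iff.2 (hsits_conj.2 ?_)
  exact HSits.comp (hsits_conj.1 h1) (hsits_conj.1 h2)

theorem conj_id (e : SIso X X') : conj e e (𝟙 X) = 𝟙 X' := by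
  refine eq_of_hsits ?_
  have H := hsits_id_iff.1 (hsits_self (𝟙 X'))
  rw [hsits_conj, hsits_id_iff]
  intro a
  have := H (e.e a)
  rwa [e.sign, e.label] at this

theorem conj_eq (e : SIso X X') (f : SIso Y Y') (ξ : X ⟶ Y) :
    conj e f ξ = ofSIso e.symm ≫ ξ ≫ ofSIso f := by
  symm
  refine eq_of_hsits ?_
  have H := hsits_conj.1 (hsits_self (conj e f ξ))
  refine HSits.comp (j := fun a => Sum.inl (e.e a)) (hsits_ofSIso (fun a => ?_) fun _ => rfl)
    (HSits.comp H (hsits_ofSIso (fun _ => rfl) fun a => f.label a))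
  simp [SIso.symm]

/-- Disjoint union of a finite family -/
def sigmaMap {ι : Type} [Finite ι] {X Y : ι → SignedSet C} (ξ : ∀ i, X i ⟶ Y i) :
    SignedSet.sigma X ⟶ SignedSet.sigma Y :=
  Linking.map (Linking.sigma (X := fun i => (X i).hom (Y i)) ξ) (SIso.sigmaHom X Y)

theorem hsits_sigmaMap {ι : Type} [Finite ι] {X Y : ι → SignedSet C} {ξ : ∀ i, X i ⟶ Y i}
    {S : Sys C} {i : (Σ i, (X i).Var) → S.V} {j : (Σ i, (Y i).Var) → S.V} :
    HSits (sigmaMap ξ) S i j ↔ ∀ k, HSits (ξ k) S (fun a => i ⟨k, a⟩) (fun a => j ⟨k, a⟩) := by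
  unfold sigmaMap HSits
  rw [sits_map, sits_sigma]
  refine forall_congr' fun k => ?_
  have : (fun a => (Sum.elim i j ∘ (SIso.sigmaHom X Y).e) ⟨k, a⟩) =
      Sum.elim (fun a => i ⟨k, a⟩) (fun a => j ⟨k, a⟩) := by
    funext a; rcases a with a | a <;> rfl
  rw [this]

end Linking

/-! ### Allowable relabellings -/

def AI {T S : Shape} (e : SIso T.signed S.signed) : Prop :=
  Allowable (ofSIso e) ∧ Allowable (ofSIso e.symm)

namespace AI
variable {T S R T' S' : Shape}

theorem refl (T : Shape) : AI (SIso.refl T.signed) := by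
  have : Allowable (ofSIso (SIso.refl T.signed)) := by rw [ofSIso_refl]; exact .id T
  exact ⟨this, this⟩

theorem symm {e : SIso T.signed S.signed} (h : AI e) : AI e.symm := ⟨h.2, h.1⟩

theorem trans {e : SIso T.signed S.signed} {f : SIso S.signed R.signed} (h : AI e) (h' : AI f) :
    AI (e.trans f) := by
  constructor
  · rw [← ofSIso_trans]; exact .comp h.1 h'.1
  · have : (e.trans f).symm = f.symm.trans e.symm := rfl
    rw [this, ← ofSIso_trans]; exact .comp h'.2 h.2

theorem tensor {e : SIso T.signed S.signed} {f : SIso T'.signed S'.signed} (h : AI e)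
    (h' : AI f) : AI (T := .tensor T T') (S := .tensor S S') (e.tensor f) := by
  constructor
  · have := Allowable.tensor h.1 h'.1
    rwa [tensorMap_ofSIso] at this
  · have := Allowable.tensor h.2 h'.2
    rwa [tensorMap_ofSIso] at this

theorem assoc (T S R : Shape) : AI (T := .tensor (.tensor T S) R) (S := .tensor T (.tensor S R))
    (SIso.assoc T.signed S.signed R.signed) := ⟨.assoc T S R, .assoc_inv T S R⟩

theorem unitor (T : Shape) : AI (S := .tensor T .unit) (SIso.unitor T.signed) :=
  ⟨.unitor T, .unitor_inv T⟩

theorem comm (T S : Shape) : AI (T := .tensor T S) (S := .tensor S T)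
    (SIso.comm T.signed S.signed) :=
  ⟨.comm T S, .comm S T⟩

end AI

/-- `T` is an iterated tensor product -/
inductive TensorOf : ∀ {ι : Type} (x : ι → Shape) (T : Shape), (T.Var → Σ i, (x i).Var) → Prop
  | unit {ι : Type} (x : ι → Shape) (h : ι → False) (f : Shape.unit.Var → Σ i, (x i).Var) :
      TensorOf x .unit f
  | atom {ι : Type} (x : ι → Shape) (i : ι) (h : ∀ j, j = i) : TensorOf x (x i) (fun a => ⟨i, a⟩)
  | tensor {ι κ μ : Type} (ε : ι ⊕ κ ≃ μ) (x : μ → Shape) {T S : Shape}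
      {f : T.Var → Σ i, (x (ε (.inl i))).Var} {g : S.Var → Σ k, (x (ε (.inr k))).Var} :
      TensorOf (fun i => x (ε (.inl i))) T f → TensorOf (fun k => x (ε (.inr k))) S g →
      TensorOf x (.tensor T S)
        (Sum.elim (fun a => ⟨ε (.inl (f a).1), (f a).2⟩) (fun a => ⟨ε (.inr (g a).1), (g a).2⟩))

namespace TensorOf

theorem bijective {ι : Type} {x : ι → Shape} {T : Shape}
    {f : T.Var → Σ i, (x i).Var} (h : TensorOf x T f) :
    Function.Bijective f := by
  induction h with
  | unit x h f => exact ⟨fun a => a.elim, fun a => (h a.1).elim⟩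
  | atom x i h =>
    refine ⟨fun a b e => by simpa using e, fun ⟨j, a⟩ => ?_⟩
    obtain rfl := h j
    exact ⟨a, rfl⟩
  | tensor ε x _ _ ih1 ih2 =>
    constructor
    · rintro (a | a) (b | b) e
      · simp only [Sum.elim_inl, Sigma.mk.injEq, EmbeddingLike.apply_eq_iff_eq,
          Sum.inl.injEq] at e
        exact congrArg _ (ih1.1 (Sigma.ext e.1 e.2))
      · simp at e
      · simp at e
      · simp only [Sum.elim_inr, Sigma.mk.injEq, EmbeddingLike.apply_eq_iff_eq,
          Sum.inr.injEq] at e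
        exact congrArg _ (ih2.1 (Sigma.ext e.1 e.2))
    · rintro ⟨m, a⟩
      obtain ⟨i | k, rfl⟩ := ε.surjective m
      · obtain ⟨b, hb⟩ := ih1.2 ⟨i, a⟩
        exact ⟨.inl b, congrArg (fun p : Σ i, (x (ε (.inl i))).Var =>
          (⟨ε (.inl p.1), p.2⟩ : Σ m, (x m).Var)) hb⟩
      · obtain ⟨b, hb⟩ := ih2.2 ⟨k, a⟩
        exact ⟨.inr b, congrArg (fun p : Σ i, (x (ε (.inr i))).Var =>
          (⟨ε (.inr p.1), p.2⟩ : Σ m, (x m).Var)) hb⟩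

theorem sign {ι : Type} {x : ι → Shape} {T : Shape}
    {f : T.Var → Σ i, (x i).Var} (h : TensorOf x T f) (a : T.Var) :
    (x (f a).1).sign (f a).2 = T.sign a := by
  induction h with
  | unit x h f => exact a.elim
  | atom x i h => rfl
  | tensor ε x _ _ ih1 ih2 => rcases a with a | a; exacts [ih1 a, ih2 a]

theorem finite {ι : Type} {x : ι → Shape} {T : Shape}
    {f : T.Var → Σ i, (x i).Var} (h : TensorOf x T f) : Finite ι := by
  induction h with
  | unit x h f => have : IsEmpty _ := ⟨h⟩; infer_instance
  | atom x i h => have : Subsingleton _ := ⟨fun a b => (h a).trans (h b).symm⟩; infer_instance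
  | tensor ε x _ _ ih1 ih2 => exact Finite.of_equiv _ ε

noncomputable def iso {ι : Type} [Finite ι] {x : ι → Shape} {T : Shape}
    {f : T.Var → Σ i, (x i).Var} (h : TensorOf x T f) :
    SIso T.signed (SignedSet.sigma fun i => (x i).signed) :=
  ⟨Equiv.ofBijective f h.bijective, h.sign, fun _ => rfl⟩

theorem exists_unit {ι : Type} {x : ι → Shape} {T : Shape}
    {f : T.Var → Σ i, (x i).Var} (h : TensorOf x T f)
    (hι : ι → False) : ∃ e : SIso T.signed Shape.unit.signed, AI e := by
  induction h with
  | unit x h f => exact ⟨_, .refl _⟩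
  | atom x i h => exact (hι i).elim
  | tensor ε x _ _ ih1 ih2 =>
    obtain ⟨e1, h1⟩ := ih1 fun i => hι (ε (.inl i))
    obtain ⟨e2, h2⟩ := ih2 fun i => hι (ε (.inr i))
    exact ⟨_, (h1.tensor h2).trans (AI.unitor .unit).symm⟩

noncomputable def inlEquiv {ι κ μ : Type} (ε : ι ⊕ κ ≃ μ) (i : ι) :
    {j : ι // j ≠ i} ⊕ κ ≃ {m : μ // m ≠ ε (.inl i)} :=
  Equiv.ofBijective (Sum.elim (fun j => ⟨ε (.inl j.1), by simpa using j.2⟩)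
    (fun k => ⟨ε (.inr k), by simp⟩)) (by
    constructor
    · rintro (⟨a, _⟩ | a) (⟨b, _⟩ | b) h <;> simp_all
    · rintro ⟨m, hm⟩
      obtain ⟨j | k, rfl⟩ := ε.surjective m
      · exact ⟨.inl ⟨j, by simpa using hm⟩, rfl⟩
      · exact ⟨.inr k, rfl⟩)

noncomputable def inrEquiv {ι κ μ : Type} (ε : ι ⊕ κ ≃ μ) (i : κ) :
    {j : κ // j ≠ i} ⊕ ι ≃ {m : μ // m ≠ ε (.inr i)} :=
  Equiv.ofBijective (Sum.elim (fun j => ⟨ε (.inr j.1), by simpa using j.2⟩)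
    (fun k => ⟨ε (.inl k), by simp⟩)) (by
    constructor
    · rintro (⟨a, _⟩ | a) (⟨b, _⟩ | b) h <;> simp_all
    · rintro ⟨m, hm⟩
      obtain ⟨j | k, rfl⟩ := ε.surjective m
      · exact ⟨.inr j, rfl⟩
      · exact ⟨.inl ⟨k, by simpa using hm⟩, rfl⟩)

theorem extract {ι : Type} {x : ι → Shape} {T : Shape}
    {f : T.Var → Σ i, (x i).Var} (h : TensorOf x T f) (i : ι) :
    ∃ (R : Shape) (g : R.Var → Σ j : {j // j ≠ i}, (x j.1).Var),
      TensorOf (fun j : {j // j ≠ i} => x j.1) R g ∧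
      ∃ e : SIso T.signed ((x i).tensor R).signed, AI e ∧
        ∀ a, f a = Sum.elim (fun b : (x i).Var => (⟨i, b⟩ : Σ i, (x i).Var))
          (fun r : R.Var => ⟨(g r).1.1, (g r).2⟩) (e.e a) := by
  induction h with
  | unit x h f => exact (h i).elim
  | atom x i' h =>
    obtain rfl := h i
    exact ⟨.unit, Empty.elim, .unit _ (fun j => j.2 (h _)) _, _, .unitor _, fun a => rfl⟩
  | @tensor ι κ μ ε x T S f g h1 h2 ih1 ih2 =>
    obtain ⟨i | i, rfl⟩ := ε.surjective i
    · obtain ⟨R, g, h, e, he, H⟩ := ih1 i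
      refine ⟨_, _, .tensor (inlEquiv ε i) (fun j => x j.1) h h2, _,
        (he.tensor (AI.refl _)).trans (AI.assoc _ _ _), ?_⟩
      rintro (a | a)
      · have := H a
        refine (congrArg (fun p : Σ i, (x (ε (.inl i))).Var =>
          (⟨ε (.inl p.1), p.2⟩ : Σ m, (x m).Var)) this).trans ?_
        change _ = Sum.elim _ _ (Equiv.sumAssoc _ _ _ (Sum.inl (e.e a)))
        generalize e.e a = b
        rcases b with b | b <;> rfl
      · rfl
    · obtain ⟨R, g, h, e, he, H⟩ := ih2 i
      refine ⟨_, _, .tensor (inrEquiv ε i) (fun j => x j.1) h h1, _,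
        (AI.comm _ _).trans ((he.tensor (AI.refl _)).trans (AI.assoc _ _ _)), ?_⟩
      rintro (a | a)
      · rfl
      · have := H a
        refine (congrArg (fun p : Σ i, (x (ε (.inr i))).Var =>
          (⟨ε (.inr p.1), p.2⟩ : Σ m, (x m).Var)) this).trans ?_
        change _ = Sum.elim _ _ (Equiv.sumAssoc _ _ _ (Sum.inl (e.e a)))
        generalize e.e a = b
        rcases b with b | b <;> rfl

theorem allowable_aux (n : ℕ) : ∀ {ι : Type} {x : ι → Shape} {T S : Shape}
    {f : T.Var → Σ i, (x i).Var} {g : S.Var → Σ i, (x i).Var} (_ : TensorOf x T f)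
    (_ : TensorOf x S g) (e : SIso T.signed S.signed) (_ : ∀ a, g (e.e a) = f a)
    (_ : Nat.card ι = n), AI e := by
  induction n with
  | zero =>
    intro ι x T S f g h h' e H hn
    have := h.finite
    have hι : ι → False := fun i => (Finite.card_eq_zero_iff.1 hn).false i
    obtain ⟨e1, h1⟩ := h.exists_unit hι
    obtain ⟨e2, h2⟩ := h'.exists_unit hι
    have : e = e1.trans e2.symm := SIso.ext fun a => (hι (f a).1).elim
    rw [this]
    exact h1.trans h2.symm
  | succ n ih =>
    intro ι x T S f g h h' e H hn
    have := h.finite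
    have : Nonempty ι := by
      by_contra hne
      rw [not_nonempty_iff] at hne
      simp at hn
    obtain ⟨i⟩ := this
    obtain ⟨R, p, hR, e1, h1, H1⟩ := h.extract i
    obtain ⟨R', p', hR', e2, h2, H2⟩ := h'.extract i
    have hr : AI (hR.iso.trans hR'.iso.symm) := by
      refine ih hR hR' _ (fun a => ?_) ?_
      · exact hR'.iso.e.apply_symm_apply (p a)
      · have := Fintype.ofFinite ι
        classical
        have : Fintype.card {j // j ≠ i} = Fintype.card ι - 1 := by simp
        rw [Nat.card_eq_fintype_card] at hn ⊢
        omega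
    have : e = e1.trans (((SIso.refl (x i).signed).tensor (hR.iso.trans hR'.iso.symm)).trans e2.symm) := by
      refine SIso.ext fun a => h'.bijective.1 ?_
      rw [H]
      change _ = g (e2.e.symm (Equiv.sumCongr (Equiv.refl _) (hR.iso.trans hR'.iso.symm).e (e1.e a)))
      rw [H2, H1]
      refine Eq.trans ?_ (congrArg (Sum.elim (fun b : (x i).Var => (⟨i, b⟩ : Σ i, (x i).Var))
          (fun r : R'.Var => ⟨(p' r).1.1, (p' r).2⟩)) (e2.e.apply_symm_apply _).symm)
      generalize e1.e a = b
      rcases b with b | b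
      · rfl
      · have h3 : p' ((hR.iso.trans hR'.iso.symm).e b) = p b :=
          hR'.iso.e.apply_symm_apply (p b)
        exact (congrArg (fun q : Σ j : {j // j ≠ i}, (x j.1).Var =>
          (⟨q.1.1, q.2⟩ : Σ i, (x i).Var)) h3).symm
    rw [this]
    exact h1.trans (((AI.refl _).tensor hr).trans h2.symm)

theorem ai {ι : Type} {x : ι → Shape} {T S : Shape}
    {f : T.Var → Σ i, (x i).Var} {g : S.Var → Σ i, (x i).Var} (h : TensorOf x T f)
    (h' : TensorOf x S g) (e : SIso T.signed S.signed) (H : ∀ a, g (e.e a) = f a) : AI e :=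
  allowable_aux _ h h' e H rfl

theorem exists_sigma {ι : Type} {x y : ι → Shape} {T : Shape} {f : T.Var → Σ i, (x i).Var}
    (h : TensorOf x T f) (ξ : ∀ i, (x i).signed ⟶ (y i).signed) (hξ : ∀ i, Allowable (ξ i)) :
    ∃ (S : Shape) (g : S.Var → Σ i, (y i).Var), TensorOf y S g ∧
      ∃ ζ : T.signed ⟶ S.signed, Allowable ζ ∧ ∀ (Z : Sys (Discrete PUnit.{1}))
        (i : (Σ i, (x i).Var) → Z.V) (j : (Σ i, (y i).Var) → Z.V),
        (∀ k, HSits (ξ k) Z (fun a => i ⟨k, a⟩) (fun a => j ⟨k, a⟩)) →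
        HSits ζ Z (fun a => i (f a)) (fun a => j (g a)) := by
  induction h with
  | unit x h f =>
    refine ⟨.unit, Empty.elim, .unit _ h _, _, .id _, fun Z i j H => ?_⟩
    exact hsits_id_iff.2 fun a => a.elim
  | atom x i h =>
    exact ⟨_, _, .atom y i h, _, hξ i, fun Z i' j H => H i⟩
  | @tensor ι κ μ ε x T S f g h1 h2 ih1 ih2 =>
    obtain ⟨T', f', h1', ζ, hζ, H⟩ := ih1 (y := fun i => y (ε (.inl i))) (fun i => ξ _)
      (fun i => hξ _)
    obtain ⟨S', g', h2', ζ', hζ', H'⟩ := ih2 (y := fun i => y (ε (.inr i))) (fun i => ξ _)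
      (fun i => hξ _)
    refine ⟨_, _, .tensor ε y h1' h2', _, hζ.tensor hζ', fun Z i j K => ?_⟩
    refine hsits_tensorMap.2 ⟨?_, ?_⟩
    · exact H Z (fun a => i ⟨ε (.inl a.1), a.2⟩) (fun a => j ⟨ε (.inl a.1), a.2⟩) fun k => K _
    · exact H' Z (fun a => i ⟨ε (.inr a.1), a.2⟩) (fun a => j ⟨ε (.inr a.1), a.2⟩) fun k => K _

theorem sigmaMap_allowable {ι : Type} [Finite ι] {x y : ι → Shape} {T S : Shape}
    {f : T.Var → Σ i, (x i).Var} {g : S.Var → Σ i, (y i).Var}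
    (h : TensorOf x T f) (h' : TensorOf y S g) (ξ : ∀ i, (x i).signed ⟶ (y i).signed)
    (hξ : ∀ i, Allowable (ξ i)) : Allowable (conj h.iso.symm h'.iso.symm (sigmaMap ξ)) := by
  obtain ⟨S', g', h2, ζ, hζ, H⟩ := h.exists_sigma ξ hξ
  have hai : AI (h2.iso.trans h'.iso.symm) :=
    h2.ai h' _ fun a => h'.iso.e.apply_symm_apply (g' a)
  have : conj h.iso.symm h'.iso.symm (sigmaMap ξ) = ζ ≫ ofSIso (h2.iso.trans h'.iso.symm) := by
    symm
    refine eq_of_hsits ?_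
    have K := hsits_sigmaMap.1 (hsits_conj.1 (hsits_self (conj h.iso.symm h'.iso.symm
      (sigmaMap ξ))))
    have K' := H (hsys (conj h.iso.symm h'.iso.symm (sigmaMap ξ)))
      (fun a => Sum.inl (h.iso.e.symm a)) (fun a => Sum.inr (h'.iso.e.symm a)) K
    refine HSits.comp (j := fun a => Sum.inr (h'.iso.e.symm (g' a)))
      (K'.congr (fun a => congrArg Sum.inl (h.iso.e.symm_apply_apply a)) fun _ => rfl) ?_
    exact hsits_ofSIso (fun _ => rfl) fun _ => rfl
  rw [this]
  exact hζ.comp hai.1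

end TensorOf
end
open SignedSet Linking

namespace Shape

/-- Substitution of shapes for the variables of a shape -/
def subst : (T : Shape) → (T.Var → Shape) → Shape
  | unit, _ => unit
  | one, f => f ()
  | tensor T S, f => tensor (T.subst fun a => f (.inl a)) (S.subst fun a => f (.inr a))
  | hom T S, f => hom (T.subst fun a => f (.inl a)) (S.subst fun a => f (.inr a))

/-- The variable of `T.subst f` which is the variable `p` of the shape substituted for `a` -/
def glue : (T : Shape) → (f : T.Var → Shape) → (a : T.Var) → (f a).Var → (T.subst f).Var
  | unit, _, a, _ => a.elim
  | one, _, (), p => p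
  | tensor T _, f, .inl a, p => Sum.inl (T.glue (fun a => f (.inl a)) a p)
  | tensor _ S, f, .inr a, p => Sum.inr (S.glue (fun a => f (.inr a)) a p)
  | hom T _, f, .inl a, p => Sum.inl (T.glue (fun a => f (.inl a)) a p)
  | hom _ S, f, .inr a, p => Sum.inr (S.glue (fun a => f (.inr a)) a p)

def unglue : (T : Shape) → (f : T.Var → Shape) → (T.subst f).Var → Σ a, (f a).Var
  | unit, _, v => v.elim
  | one, _, p => ⟨(), p⟩
  | tensor T _, f, .inl v => let r := T.unglue (fun a => f (.inl a)) v; ⟨.inl r.1, r.2⟩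
  | tensor _ S, f, .inr v => let r := S.unglue (fun a => f (.inr a)) v; ⟨.inr r.1, r.2⟩
  | hom T _, f, .inl v => let r := T.unglue (fun a => f (.inl a)) v; ⟨.inl r.1, r.2⟩
  | hom _ S, f, .inr v => let r := S.unglue (fun a => f (.inr a)) v; ⟨.inr r.1, r.2⟩

theorem unglue_glue : (T : Shape) → (f : T.Var → Shape) → (a : T.Var) → (p : (f a).Var) →
    T.unglue f (T.glue f a p) = ⟨a, p⟩
  | unit, _, a, _ => a.elim
  | one, _, (), p => rfl
  | tensor T _, f, .inl a, p => congrArg (fun r : Σ a, (f (.inl a)).Var =>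
      (⟨.inl r.1, r.2⟩ : Σ a, (f a).Var)) (unglue_glue T (fun a => f (.inl a)) a p)
  | tensor _ S, f, .inr a, p => congrArg (fun r : Σ a, (f (.inr a)).Var =>
      (⟨.inr r.1, r.2⟩ : Σ a, (f a).Var)) (unglue_glue S (fun a => f (.inr a)) a p)
  | hom T _, f, .inl a, p => congrArg (fun r : Σ a, (f (.inl a)).Var =>
      (⟨.inl r.1, r.2⟩ : Σ a, (f a).Var)) (unglue_glue T (fun a => f (.inl a)) a p)
  | hom _ S, f, .inr a, p => congrArg (fun r : Σ a, (f (.inr a)).Var =>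
      (⟨.inr r.1, r.2⟩ : Σ a, (f a).Var)) (unglue_glue S (fun a => f (.inr a)) a p)

theorem glue_unglue : (T : Shape) → (f : T.Var → Shape) → (v : (T.subst f).Var) →
    T.glue f (T.unglue f v).1 (T.unglue f v).2 = v
  | unit, _, a => a.elim
  | one, _, p => rfl
  | tensor T _, f, .inl v => congrArg Sum.inl (glue_unglue T _ v)
  | tensor _ S, f, .inr v => congrArg Sum.inr (glue_unglue S _ v)
  | hom T _, f, .inl v => congrArg Sum.inl (glue_unglue T _ v)
  | hom _ S, f, .inr v => congrArg Sum.inr (glue_unglue S _ v)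

theorem sign_glue : (T : Shape) → (f : T.Var → Shape) → (a : T.Var) → (p : (f a).Var) →
    (T.subst f).sign (T.glue f a p) = (T.sign a == (f a).sign p)
  | unit, _, a, _ => a.elim
  | one, f, (), p => by simp [glue, sign, subst]
  | tensor T _, f, .inl a, p => sign_glue T (fun a => f (.inl a)) a p
  | tensor _ S, f, .inr a, p => sign_glue S (fun a => f (.inr a)) a p
  | hom T _, f, .inl a, p => by
    refine (congrArg (! ·) (sign_glue T (fun a => f (.inl a)) a p)).trans ?_
    change _ = ((! T.sign a) == _)
    cases T.sign a <;> cases (f (.inl a)).sign p <;> rfl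
  | hom _ S, f, .inr a, p => sign_glue S (fun a => f (.inr a)) a p

def glueEquiv (T : Shape) (f : T.Var → Shape) : (Σ a, (f a).Var) ≃ (T.subst f).Var :=
  ⟨fun p => T.glue f p.1 p.2, T.unglue f, fun p => T.unglue_glue f p.1 p.2, T.glue_unglue f⟩

end Shape

/-! ### Allowability of substituted graphs -/

abbrev Pt : Type := Discrete PUnit.{1}

theorem lab_pt {S : Sys Pt} {a : S.V} {c : Pt} : S.lab a = c := Subsingleton.elim _ _

theorem IdAt.rfl_pt {S : Sys Pt} {s : Bool} {c : Pt} {p : S.V} : IdAt S s c p p :=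
  ⟨lab_pt, lab_pt, fun _ => Sys.Path.refl' lab_pt, fun _ => Sys.Path.refl' lab_pt⟩

theorem exists_subst_map : (T : Shape) → (f g : T.Var → Shape) →
    (ξ : ∀ a, T.sign a = true → ((f a).signed ⟶ (g a).signed)) →
    (η : ∀ a, T.sign a = false → ((g a).signed ⟶ (f a).signed)) →
    (∀ a h, Allowable (ξ a h)) → (∀ a h, Allowable (η a h)) →
    ∃ ζ : (T.subst f).signed ⟶ (T.subst g).signed, Allowable ζ ∧
      ∀ (Z : Sys Pt) (i : (T.subst f).Var → Z.V) (j : (T.subst g).Var → Z.V),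
        (∀ a h, HSits (ξ a h) Z (fun p => i (T.glue f a p)) (fun p => j (T.glue g a p))) →
        (∀ a h, HSits (η a h) Z (fun p => j (T.glue g a p)) (fun p => i (T.glue f a p))) →
        HSits ζ Z i j
  | .unit, f, g, ξ, η, hξ, hη => ⟨𝟙 _, .id .unit, fun Z i j _ _ =>
      hsits_id_iff.2 fun a => a.elim⟩
  | .one, f, g, ξ, η, hξ, hη => ⟨ξ () rfl, hξ () rfl, fun Z i j h _ => h () rfl⟩
  | .tensor T S, f, g, ξ, η, hξ, hη => by
    obtain ⟨ζ, h1, h2⟩ := exists_subst_map T (fun a => f (.inl a)) (fun a => g (.inl a))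
      (fun a h => ξ (.inl a) h) (fun a h => η (.inl a) h) (fun a h => hξ (.inl a) h)
      (fun a h => hη (.inl a) h)
    obtain ⟨ζ', h1', h2'⟩ := exists_subst_map S (fun a => f (.inr a)) (fun a => g (.inr a))
      (fun a h => ξ (.inr a) h) (fun a h => η (.inr a) h) (fun a h => hξ (.inr a) h)
      (fun a h => hη (.inr a) h)
    exact ⟨_, .tensor h1 h1', fun Z i j H H' => hsits_tensorMap.2
      ⟨h2 Z _ _ (fun a h => H (.inl a) h) (fun a h => H' (.inl a) h),
       h2' Z _ _ (fun a h => H (.inr a) h) (fun a h => H' (.inr a) h)⟩⟩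
  | .hom T S, f, g, ξ, η, hξ, hη => by
    obtain ⟨ζ, h1, h2⟩ := exists_subst_map T (fun a => g (.inl a)) (fun a => f (.inl a))
      (fun a h => η (.inl a) (by simp [Shape.sign, h])) (fun a h => ξ (.inl a)
        (by simp [Shape.sign, h])) (fun a h => hη (.inl a) _)
      (fun a h => hξ (.inl a) _)
    obtain ⟨ζ', h1', h2'⟩ := exists_subst_map S (fun a => f (.inr a)) (fun a => g (.inr a))
      (fun a h => ξ (.inr a) h) (fun a h => η (.inr a) h) (fun a h => hξ (.inr a) h)
      (fun a h => hη (.inr a) h)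
    exact ⟨_, .hom h1 h1', fun Z i j H H' => hsits_homMap.2
      ⟨h2 Z _ _ (fun a h => H' (.inl a) _) (fun a h => H (.inl a) _),
       h2' Z _ _ (fun a h => H (.inr a) h) (fun a h => H' (.inr a) h)⟩⟩

/-- two points are joined in `ξ` -/
def Joined {T S : Shape} (ξ : T.signed ⟶ S.signed) (a b : T.Var ⊕ S.Var) : Prop :=
  ∃ (c d : Pt) (h : c ⟶ d), Edge (X := T.signed.hom S.signed) ξ a b h

abbrev glueS {T S : Shape} (k : T.Var ⊕ S.Var → Shape) {V : Type}
    (i : (T.subst fun a => k (.inl a)).Var → V) (j : (S.subst fun a => k (.inr a)).Var → V) :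
    (a : T.Var ⊕ S.Var) → (k a).Var → V
  | .inl a, p => i (T.glue _ a p)
  | .inr a, p => j (S.glue _ a p)

/-- the points of substituted shapes are joined by identity paths along the edges of `ξ` -/
def Strict {T S : Shape} (ξ : T.signed ⟶ S.signed) (k : T.Var ⊕ S.Var → Shape) (Z : Sys Pt)
    (i : (T.subst fun a => k (.inl a)).Var → Z.V)
    (j : (S.subst fun a => k (.inr a)).Var → Z.V) : Prop :=
  ∀ a b, Joined ξ a b → ∀ (e : k a = k b) (p : (k a).Var),
    IdAt Z ((k a).sign p) ⟨⟨⟩⟩ (glueS k i j a p) (glueS k i j b (e ▸ p))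

def SubstOK {T S : Shape} (ξ : T.signed ⟶ S.signed) : Prop :=
  ∀ k : T.Var ⊕ S.Var → Shape, (∀ a b, Joined ξ a b → k a = k b) →
    ∃ ζ : (T.subst fun a => k (.inl a)).signed ⟶ (S.subst fun a => k (.inr a)).signed,
      Allowable ζ ∧ ∀ Z i j, Strict ξ k Z i j → HSits ζ Z i j

theorem cast_cast {x y z : Shape} (e : x = y) (e' : y = z) (p : x.Var) :
    e' ▸ (e ▸ p : y.Var) = ((e.trans e') ▸ p : z.Var) := by subst e e'; rfl

namespace SubstComp
variable {T S R : Shape} (ξ : T.signed ⟶ S.signed) (η : S.signed ⟶ R.signed)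

abbrev Step (a b : T.Var ⊕ S.Var ⊕ R.Var) : Prop :=
  ∃ (c d : Pt) (h : c ⟶ d), CompStep (X := T.signed) (Y := S.signed) (Z := R.signed) ξ η a b h

abbrev Reach := Relation.ReflTransGen (Step ξ η)

abbrev out : T.Var ⊕ R.Var → T.Var ⊕ S.Var ⊕ R.Var := embO T.signed S.signed R.signed

abbrev osign : T.Var ⊕ R.Var → Bool := (T.signed.hom R.signed).sign

variable {ξ η}

theorem Step.det {a b b'} (h : Step ξ η a b) (h' : Step ξ η a b') : b = b' := by
  obtain ⟨_, _, _, h⟩ := h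
  obtain ⟨_, _, _, h'⟩ := h'
  exact (h.det h').1

theorem terminal {b : T.Var ⊕ R.Var} (hb : osign b = true) (v) : ¬ Step ξ η (out b) v :=
  fun ⟨_, _, _, h⟩ => compSys_terminal (ξ := ξ) (η := η) b hb _ _ _ _ h

theorem initial {b : T.Var ⊕ R.Var} (hb : osign b = false) (v) : ¬ Step ξ η v (out b) :=
  fun ⟨_, _, _, h⟩ => compSys_initial (ξ := ξ) (η := η) b hb _ h

theorem reach_unique {v} {b b' : T.Var ⊕ R.Var} (h : Reach ξ η v (out b))
    (h' : Reach ξ η v (out b')) (hb : osign b = true) (hb' : osign b' = true) : b = b' := by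
  induction h using Relation.ReflTransGen.head_induction_on with
  | refl =>
    rcases h'.cases_head with h | ⟨c, h, _⟩
    · exact embO_inj h
    · exact (terminal hb _ h).elim
  | head s _ ih =>
    rcases h'.cases_head with h | ⟨c, h, h2⟩
    · rw [h] at s
      exact (terminal hb' _ s).elim
    · obtain rfl := Step.det s h
      exact ih h2

variable (ξ η)

open Classical in
noncomputable def tgt (v : T.Var ⊕ S.Var ⊕ R.Var) : Option (T.Var ⊕ R.Var) :=
  if h : ∃ b, osign b = true ∧ Reach ξ η v (out b) then some h.choose else none

variable {ξ η}

theorem tgt_iff {v} {b : T.Var ⊕ R.Var} :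
    tgt ξ η v = some b ↔ osign b = true ∧ Reach ξ η v (out b) := by
  classical
  unfold tgt
  constructor
  · intro h
    split at h
    · rename_i h'
      obtain rfl := Option.some.inj h
      exact h'.choose_spec
    · exact (Option.some_ne_none _ h.symm).elim
  · intro h
    have h' : ∃ b, osign b = true ∧ Reach ξ η v (out b) := ⟨b, h⟩
    rw [dif_pos h']
    exact congrArg _ (reach_unique h'.choose_spec.2 h.2 h'.choose_spec.1 h.1)

theorem tgt_step {v v'} (s : Step ξ η v v') : tgt ξ η v = tgt ξ η v' := by
  refine Option.ext fun b => ?_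
  rw [tgt_iff, tgt_iff]
  refine and_congr_right fun hb => ⟨fun h => ?_, fun h => .head s h⟩
  rcases h.cases_head with h | ⟨c, h, h2⟩
  · rw [h] at s
    exact (terminal hb _ s).elim
  · obtain rfl := Step.det s h
    exact h2

theorem tgt_pos {b : T.Var ⊕ R.Var} (hb : osign b = true) : tgt ξ η (out b) = some b :=
  tgt_iff.2 ⟨hb, .refl⟩

theorem tgt_neg {a : T.Var ⊕ R.Var} (ha : osign a = false) :
    ∃ b, tgt ξ η (out a) = some b ∧ Joined (ξ ≫ η) a b := by
  obtain ⟨b, h, e⟩ := (ξ ≫ η).exists_of_neg a ha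
  exact ⟨b, tgt_iff.2 ⟨e.2.1, reach_of_path e.2.2⟩, _, _, h, .mk e⟩

theorem joined_of_tgt {a b : T.Var ⊕ R.Var} (ha : osign a = false)
    (h : tgt ξ η (out a) = some b) : Joined (ξ ≫ η) a b := by
  obtain ⟨b', h', j⟩ := tgt_neg (ξ := ξ) (η := η) ha
  rw [h] at h'
  obtain rfl := Option.some.inj h'
  exact j

variable (k : T.Var ⊕ R.Var → Shape)

def oshape : Option (T.Var ⊕ R.Var) → Shape
  | none => .unit
  | some b => k b

variable (ξ η)

noncomputable def K : T.Var ⊕ S.Var ⊕ R.Var → Shape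
  | .inl a => k (.inl a)
  | .inr (.inl y) => oshape k (tgt ξ η (.inr (.inl y)))
  | .inr (.inr a) => k (.inr a)

variable {ξ η k}

theorem K_out (b) : K ξ η k (out b) = k b := by rcases b with b | b <;> rfl

theorem K_eq (hk : ∀ a b, Joined (ξ ≫ η) a b → k a = k b) (v) :
    K ξ η k v = oshape k (tgt ξ η v) := by
  have ho : ∀ b, K ξ η k (out b) = oshape k (tgt ξ η (out b)) := by
    intro b
    rw [K_out]
    cases hs : osign b
    · obtain ⟨b', h, j⟩ := tgt_neg (ξ := ξ) (η := η) hs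
      rw [h]
      exact hk _ _ j
    · rw [tgt_pos hs]; rfl
  rcases v with a | y | a
  · exact ho (.inl a)
  · rfl
  · exact ho (.inr a)

variable {Z : Sys Pt} (i : (T.subst fun a => k (.inl a)).Var → Z.V)
    (j : (R.subst fun a => k (.inr a)).Var → Z.V)

def oglue : (o : Option (T.Var ⊕ R.Var)) → (oshape k o).Var → Z.V
  | none, p => p.elim
  | some b, p => glueS k i j b p

noncomputable def G : (v : T.Var ⊕ S.Var ⊕ R.Var) → (K ξ η k v).Var → Z.V
  | .inl a, p => glueS k i j (.inl a) p
  | .inr (.inl _), p => oglue i j _ p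
  | .inr (.inr a), p => glueS k i j (.inr a) p

variable {i j}

theorem G_out (b) (p : (K ξ η k (out b)).Var) :
    G i j (out b) p = glueS k i j b (K_out (ξ := ξ) (η := η) (k := k) b ▸ p) := by
  rcases b with b | b <;> rfl

theorem oglue_some {o} {b : T.Var ⊕ R.Var} (h : o = some b) (e : oshape k o = k b)
    (p : (oshape k o).Var) : oglue i j o p = glueS k i j b (e ▸ p) := by
  subst h; rfl

theorem G_tgt {v b} (h : tgt ξ η v = some b) (hv : ∀ a, v = out a → osign a = true)
    (e : K ξ η k v = k b) (p : (K ξ η k v).Var) : G i j v p = glueS k i j b (e ▸ p) := by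
  have ho : ∀ a, v = out a → G i j v p = glueS k i j b (e ▸ p) := by
    rintro a rfl
    rw [tgt_pos (hv a rfl)] at h
    obtain rfl := Option.some.inj h
    exact G_out _ p
  rcases v with a | y | a
  · exact ho (.inl a) rfl
  · exact oglue_some h e p
  · exact ho (.inr a) rfl

theorem idAt_tgt (H : Strict (ξ ≫ η) k Z i j) {v b} (h : tgt ξ η v = some b)
    (e : K ξ η k v = k b) (p : (K ξ η k v).Var) :
    IdAt Z ((K ξ η k v).sign p) ⟨⟨⟩⟩ (G i j v p) (glueS k i j b (e ▸ p)) := by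
  by_cases hv : ∃ a, v = out a ∧ osign a = false
  · obtain ⟨a, rfl, ha⟩ := hv
    have hj := joined_of_tgt ha h
    have ha' : K ξ η k (out a) = k a := K_out a
    have := H a b hj (ha'.symm.trans e) (ha' ▸ p)
    rw [G_out, ← cast_cast ha' (ha'.symm.trans e) p]
    have key : ∀ {x y : Shape} (e : x = y) (p : x.Var), x.sign p = y.sign (e ▸ p) := by
      intro x y e p; subst e; rfl
    rw [key ha' p]
    exact this
  · rw [G_tgt h (fun a ha => by
      by_contra hc
      exact hv ⟨a, ha, by simpa using hc⟩) e]
    exact IdAt.rfl_pt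

theorem idAt_step (hk : ∀ a b, Joined (ξ ≫ η) a b → k a = k b)
    (H : Strict (ξ ≫ η) k Z i j) {v v'} (s : Step ξ η v v')
    (e : K ξ η k v = K ξ η k v') (p : (K ξ η k v).Var) :
    IdAt Z ((K ξ η k v).sign p) ⟨⟨⟩⟩ (G i j v p) (G i j v' (e ▸ p)) := by
  cases h : tgt ξ η v' with
  | none =>
    have : K ξ η k v = .unit := by rw [e, K_eq hk, h]; rfl
    exact (this ▸ p : Shape.unit.Var).elim
  | some b =>
    have h' : K ξ η k v' = k b := by rw [K_eq hk, h]; rfl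
    rw [G_tgt h (fun a ha => by
      by_contra hc
      rw [ha] at s
      exact initial (by simpa using hc) _ s) h', cast_cast]
    exact idAt_tgt H ((tgt_step s).trans h) _ p

end SubstComp

theorem SubstOK.comp {T S R : Shape} {ξ : T.signed ⟶ S.signed} {η : S.signed ⟶ R.signed}
    (h1 : SubstOK ξ) (h2 : SubstOK η) : SubstOK (ξ ≫ η) := by
  intro k hk
  have hK : ∀ v v', SubstComp.Step ξ η v v' → SubstComp.K ξ η k v = SubstComp.K ξ η k v' :=
    fun v v' s => by rw [SubstComp.K_eq hk, SubstComp.K_eq hk, SubstComp.tgt_step s]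
  have sl : ∀ a b, Joined ξ a b → SubstComp.Step ξ η (embL T.signed S.signed R.signed a)
      (embL T.signed S.signed R.signed b) :=
    fun a b ⟨c, d, h, e⟩ => ⟨c, d, h, .left e⟩
  have sr : ∀ a b, Joined η a b → SubstComp.Step ξ η (embR T.signed S.signed R.signed a)
      (embR T.signed S.signed R.signed b) :=
    fun a b ⟨c, d, h, e⟩ => ⟨c, d, h, .right e⟩
  let k1 : T.Var ⊕ S.Var → Shape := fun a => SubstComp.K ξ η k (embL T.signed S.signed R.signed a)
  let k2 : S.Var ⊕ R.Var → Shape := fun a => SubstComp.K ξ η k (embR T.signed S.signed R.signed a)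
  obtain ⟨ζ1, a1, H1⟩ := h1 k1 fun a b j => hK _ _ (sl a b j)
  obtain ⟨ζ2, a2, H2⟩ := h2 k2 fun a b j => hK _ _ (sr a b j)
  refine ⟨ζ1 ≫ ζ2, .comp a1 a2, fun Z i j H => ?_⟩
  let l : (S.subst fun a => k1 (.inr a)).Var → Z.V := fun v =>
    SubstComp.G (ξ := ξ) (η := η) i j (.inr (.inl (S.unglue _ v).1)) (S.unglue _ v).2
  have hl : ∀ a p, l (S.glue _ a p) = SubstComp.G (ξ := ξ) (η := η) i j (.inr (.inl a)) p := by
    intro a p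
    have h := S.unglue_glue (fun a => k1 (.inr a)) a p
    exact congrArg (fun r : Σ a, (k1 (.inr a)).Var =>
      SubstComp.G (ξ := ξ) (η := η) i j (.inr (.inl r.1)) r.2) h
  have g1 : ∀ a (p : (k1 a).Var), glueS k1 i l a p = SubstComp.G (ξ := ξ) (η := η) i j
      (embL T.signed S.signed R.signed a) p := by
    rintro (a | a) p
    · rfl
    · exact hl a p
  have g2 : ∀ a (p : (k2 a).Var), glueS k2 l j a p = SubstComp.G (ξ := ξ) (η := η) i j
      (embR T.signed S.signed R.signed a) p := by
    rintro (a | a) p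
    · exact hl a p
    · rfl
  refine HSits.comp (j := l) (H1 Z i l ?_) (H2 Z l j ?_)
  · intro a b hj e p
    rw [g1, g1]
    exact SubstComp.idAt_step hk H (sl a b hj) e p
  · intro a b hj e p
    rw [g2, g2]
    exact SubstComp.idAt_step hk H (sr a b hj) e p

theorem Linking.IdAt.congr {S : Sys Pt} {s s' : Bool} {c c' : Pt} {p q q' : S.V} (H : IdAt S s c p q)
    (h : s = s') (h' : q = q') : IdAt S s' c' p q' := by
  subst h h'
  obtain rfl : c = c' := Subsingleton.elim _ _
  exact H

theorem glue_cases {T : Shape} {f : T.Var → Shape} {P : (T.subst f).Var → Prop}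
    (h : ∀ a p, P (T.glue f a p)) (v) : P v := by
  rw [← T.glue_unglue f v]; exact h _ _

theorem Strict.idAt {T S : Shape} {ξ : T.signed ⟶ S.signed} {k : T.Var ⊕ S.Var → Shape}
    {Z : Sys Pt} {i j} (H : Strict ξ k Z i j) {a b : T.Var ⊕ S.Var} (s : Bool)
    (h1 : s = true → Joined ξ a b) (h2 : s = false → Joined ξ b a) (e : k a = k b)
    (p : (k a).Var) :
    IdAt Z (s == (k a).sign p) ⟨⟨⟩⟩ (glueS k i j a p) (glueS k i j b (e ▸ p)) := by
  cases s with
  | true => simpa using H a b (h1 rfl) e p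
  | false =>
    have := H b a (h2 rfl) e.symm (e ▸ p)
    rw [cast_cast] at this
    have key : ∀ {x y : Shape} (e : x = y) (p : x.Var), y.sign (e ▸ p) = x.sign p := by
      intro x y e p; subst e; rfl
    rw [key e p] at this
    refine IdAt.symm ?_
    simpa using this

section
variable {T S T' S' R : Shape}

theorem joined_id (a : T.Var) :
    (T.sign a = true → Joined (𝟙 T.signed) (.inl a) (.inr a)) ∧
    (T.sign a = false → Joined (𝟙 T.signed) (.inr a) (.inl a)) :=
  ⟨fun h => ⟨_, _, _, id_Edge.2 (.pos (X := T.signed) h)⟩,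
    fun h => ⟨_, _, _, id_Edge.2 (.neg (X := T.signed) h)⟩⟩

theorem joined_ofSIso (e : SIso T.signed S.signed) (a : T.Var) :
    (T.sign a = true → Joined (ofSIso e) (.inl a) (.inr (e.e a))) ∧
    (T.sign a = false → Joined (ofSIso e) (.inr (e.e a)) (.inl a)) := by
  have h1 : ((SIso.refl T.signed).hom e).e.symm (.inl a) = .inl a := rfl
  have h2 : ((SIso.refl T.signed).hom e).e.symm (.inr (e.e a)) = .inr a :=
    congrArg Sum.inr (e.e.symm_apply_apply a)
  refine ⟨fun h => ?_, fun h => ?_⟩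
  · obtain ⟨c, d, f, r⟩ := (joined_id a).1 h
    refine ⟨c, d, f, map_Edge.2 ?_⟩
    rw [h1, h2]; exact r
  · obtain ⟨c, d, f, r⟩ := (joined_id a).2 h
    refine ⟨c, d, f, map_Edge.2 ?_⟩
    rw [h1, h2]; exact r

theorem Joined.tensor_left {ξ : T.signed ⟶ S.signed} (η : T'.signed ⟶ S'.signed) {a b}
    (h : Joined ξ a b) : Joined (T := .tensor T T') (S := .tensor S S') (tensorMap ξ η)
      (Sum.map Sum.inl Sum.inl a) (Sum.map Sum.inl Sum.inl b) := by
  obtain ⟨c, d, f, r⟩ := h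
  refine ⟨c, d, f, map_Edge.2 (sum_Edge.2 ?_)⟩
  rcases a with a | a <;> rcases b with b | b <;> exact .inl r

theorem Joined.tensor_right (ξ : T.signed ⟶ S.signed) {η : T'.signed ⟶ S'.signed} {a b}
    (h : Joined η a b) : Joined (T := .tensor T T') (S := .tensor S S') (tensorMap ξ η)
      (Sum.map Sum.inr Sum.inr a) (Sum.map Sum.inr Sum.inr b) := by
  obtain ⟨c, d, f, r⟩ := h
  refine ⟨c, d, f, map_Edge.2 (sum_Edge.2 ?_)⟩
  rcases a with a | a <;> rcases b with b | b <;> exact .inr r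

theorem Joined.hom_left {ξ : T.signed ⟶ S.signed} (η : T'.signed ⟶ S'.signed) {a b}
    (h : Joined ξ a b) : Joined (T := .hom S T') (S := .hom T S') (homMap ξ η)
      (Sum.elim (fun a => .inr (.inl a)) (fun a => .inl (.inl a)) a)
      (Sum.elim (fun a => .inr (.inl a)) (fun a => .inl (.inl a)) b) := by
  obtain ⟨c, d, f, r⟩ := h
  refine ⟨c, d, f, map_Edge.2 (sum_Edge.2 ?_)⟩
  rcases a with a | a <;> rcases b with b | b <;> exact .inl r

theorem Joined.hom_right (ξ : T.signed ⟶ S.signed) {η : T'.signed ⟶ S'.signed} {a b}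
    (h : Joined η a b) : Joined (T := .hom S T') (S := .hom T S') (homMap ξ η)
      (Sum.map Sum.inr Sum.inr a) (Sum.map Sum.inr Sum.inr b) := by
  obtain ⟨c, d, f, r⟩ := h
  refine ⟨c, d, f, map_Edge.2 (sum_Edge.2 ?_)⟩
  rcases a with a | a <;> rcases b with b | b <;> exact .inr r

theorem SubstOK.ofSIso (e : SIso T.signed S.signed)
    (hE : ∀ f : T.Var → Shape, ∃ E : SIso (T.subst f).signed
      (S.subst fun b => f (e.e.symm b)).signed, Allowable (Linking.ofSIso E) ∧ ∀ a p,
        E.e (T.glue f a p) = S.glue _ (e.e a)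
          (congrArg f (e.e.symm_apply_apply a).symm ▸ p : (f (e.e.symm (e.e a))).Var)) :
    SubstOK (Linking.ofSIso e) := by
  intro k hk
  obtain ⟨f, rfl⟩ : ∃ f, k = Sum.elim f fun b => f (e.e.symm b) := by
    refine ⟨fun a => k (.inl a), funext ?_⟩
    rintro (a | b)
    · rfl
    · obtain ⟨a, rfl⟩ := e.e.surjective b
      change k _ = k (.inl (e.e.symm (e.e a)))
      rw [e.e.symm_apply_apply]
      cases hs : T.sign a
      · exact hk _ _ ((joined_ofSIso e a).2 hs)
      · exact (hk _ _ ((joined_ofSIso e a).1 hs)).symm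
  obtain ⟨E, hE, H⟩ := hE f
  refine ⟨Linking.ofSIso E, hE, fun Z i j K => hsits_ofSIso_iff.2 (glue_cases fun a p => ?_)⟩
  have := K.idAt (T.sign a) (joined_ofSIso e a).1 (joined_ofSIso e a).2
    (congrArg f (e.e.symm_apply_apply a).symm) p
  exact this.congr (T.sign_glue f a p).symm (congrArg j (H a p)).symm

theorem SubstOK.id (T : Shape) : SubstOK (𝟙 T.signed) := by
  rw [← ofSIso_refl]
  exact .ofSIso _ fun f => ⟨SIso.refl (T.subst f).signed,
    (AI.refl (T.subst f)).1, fun a p => rfl⟩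

theorem SubstOK.tensor {ξ : T.signed ⟶ S.signed} {η : T'.signed ⟶ S'.signed}
    (h : SubstOK ξ) (h' : SubstOK η) :
    SubstOK (T := .tensor T T') (S := .tensor S S') (tensorMap ξ η) := by
  intro k hk
  obtain ⟨ζ, a, H⟩ := h (fun a => k (Sum.map Sum.inl Sum.inl a))
    fun a b j => hk _ _ (j.tensor_left η)
  obtain ⟨ζ', a', H'⟩ := h' (fun a => k (Sum.map Sum.inr Sum.inr a))
    fun a b j => hk _ _ (j.tensor_right ξ)
  refine ⟨_, a.tensor a', fun Z i j K => hsits_tensorMap.2 ⟨H Z _ _ ?_, H' Z _ _ ?_⟩⟩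
  · intro a b hj e p
    have := K _ _ (hj.tensor_left η) e p
    rcases a with a | a <;> rcases b with b | b <;> exact this
  · intro a b hj e p
    have := K _ _ (hj.tensor_right ξ) e p
    rcases a with a | a <;> rcases b with b | b <;> exact this

theorem SubstOK.hom {ξ : T.signed ⟶ S.signed} {η : T'.signed ⟶ S'.signed}
    (h : SubstOK ξ) (h' : SubstOK η) :
    SubstOK (T := .hom S T') (S := .hom T S') (homMap ξ η) := by
  intro k hk
  obtain ⟨ζ, a, H⟩ := h
    (fun a => k (Sum.elim (fun a => .inr (.inl a)) (fun a => .inl (.inl a)) a))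
    fun a b j => hk _ _ (j.hom_left η)
  obtain ⟨ζ', a', H'⟩ := h' (fun a => k (Sum.map Sum.inr Sum.inr a))
    fun a b j => hk _ _ (j.hom_right ξ)
  refine ⟨_, a.hom a', fun Z i j K => hsits_homMap.2 ⟨H Z _ _ ?_, H' Z _ _ ?_⟩⟩
  · intro a b hj e p
    have := K _ _ (hj.hom_left η) e p
    rcases a with a | a <;> rcases b with b | b <;> exact this
  · intro a b hj e p
    have := K _ _ (hj.hom_right ξ) e p
    rcases a with a | a <;> rcases b with b | b <;> exact this

theorem joined_curry {ξ : (Shape.tensor T S).signed ⟶ R.signed} {a b}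
    (h : Joined ξ a b) : Joined (S := .hom S R) (curry (X := T.signed) (Y := S.signed) ξ)
      (Equiv.sumAssoc _ _ _ a) (Equiv.sumAssoc _ _ _ b) := by
  obtain ⟨c, d, f, r⟩ := h
  refine ⟨c, d, f, map_Edge.2 ?_⟩
  rcases a with (a | a) | a <;> rcases b with (b | b) | b <;> exact r

theorem joined_uncurry {ξ : T.signed ⟶ (Shape.hom S R).signed} {a b}
    (h : Joined ξ a b) : Joined (T := .tensor T S) (uncurry (X := T.signed) (Y := S.signed) ξ)
      ((Equiv.sumAssoc _ _ _).symm a) ((Equiv.sumAssoc _ _ _).symm b) := by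
  obtain ⟨c, d, f, r⟩ := h
  refine ⟨c, d, f, map_Edge.2 ?_⟩
  rcases a with a | (a | a) <;> rcases b with b | (b | b) <;> exact r

theorem SubstOK.curry {ξ : (Shape.tensor T S).signed ⟶ R.signed} (h : SubstOK ξ)
    (hc : ∀ {T S R : Shape} {ξ : (Shape.tensor T S).signed ⟶ R.signed}, Allowable ξ →
      Allowable (S := .hom S R) (Linking.curry (X := T.signed) (Y := S.signed) ξ)) :
    SubstOK (S := .hom S R) (Linking.curry (X := T.signed) (Y := S.signed) ξ) := by
  intro k hk
  obtain ⟨ζ, a, H⟩ := h (fun a => k (Equiv.sumAssoc _ _ _ a))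
    fun a b j => hk _ _ (joined_curry j)
  refine ⟨_, hc (T := T.subst _) (S := S.subst _) (R := R.subst _) a,
    fun Z i j K => hsits_curry.2 (H Z _ _ ?_)⟩
  intro a b hj e p
  have := K _ _ (joined_curry hj) e p
  rcases a with (a | a) | a <;> rcases b with (b | b) | b <;> exact this

theorem SubstOK.uncurry {ξ : T.signed ⟶ (Shape.hom S R).signed} (h : SubstOK ξ)
    (hc : ∀ {T S R : Shape} {ξ : T.signed ⟶ (Shape.hom S R).signed}, Allowable ξ →
      Allowable (T := .tensor T S) (Linking.uncurry (X := T.signed) (Y := S.signed) ξ)) :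
    SubstOK (T := .tensor T S) (Linking.uncurry (X := T.signed) (Y := S.signed) ξ) := by
  intro k hk
  obtain ⟨ζ, a, H⟩ := h (fun a => k ((Equiv.sumAssoc _ _ _).symm a))
    fun a b j => hk _ _ (joined_uncurry j)
  refine ⟨_, hc (T := T.subst _) (S := S.subst _) (R := R.subst _) a,
    fun Z i j K => hsits_uncurry.2 (H Z _ _ ?_)⟩
  intro a b hj e p
  have := K _ _ (joined_uncurry hj) e p
  rcases a with a | (a | a) <;> rcases b with b | (b | b) <;> exact this

theorem curry_eq {X Y Z : SignedSet Pt} (ξ : X.tensor Y ⟶ Z) :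
    Linking.curry ξ = coev X Y ≫ homMap (𝟙 Y) ξ := by
  symm
  refine eq_of_hsits ?_
  have H := hsits_curry.1 (hsits_self (Linking.curry ξ))
  refine HSits.comp (j := Sum.elim (fun a => Sum.inr (Sum.inl a)) (Sum.elim Sum.inl
    fun a => Sum.inr (Sum.inl a)))
    (hsits_curry.2 ?_) (hsits_homMap.2 ⟨hsits_id fun a => rfl, H⟩)
  exact (hsits_id (X := X.tensor Y) (S := hsys (Linking.curry ξ)) (i := Sum.elim Sum.inl fun a => Sum.inr (Sum.inl a))
    (by rintro (a | a) <;> rfl))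

theorem uncurry_eq {X Y Z : SignedSet Pt} (ξ : X ⟶ Y.hom Z) :
    Linking.uncurry ξ = tensorMap ξ (𝟙 Y) ≫ ev Y Z := by
  symm
  refine eq_of_hsits ?_
  have H := hsits_uncurry.1 (hsits_self (Linking.uncurry ξ))
  refine HSits.comp (j := Sum.elim (Sum.elim (fun a => Sum.inl (Sum.inr a)) Sum.inr)
    fun a => Sum.inl (Sum.inr a)) (hsits_tensorMap.2 ⟨H, hsits_id fun a => rfl⟩)
    (hsits_uncurry.2 ?_)
  exact (hsits_id (X := Y.hom Z) (S := hsys (Linking.uncurry ξ)) (i := Sum.elim (fun a => Sum.inl (Sum.inr a)) Sum.inr)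
    (by rintro (a | a) <;> rfl))

theorem Allowable.curry {ξ : (Shape.tensor T S).signed ⟶ R.signed} (h : Allowable ξ) :
    Allowable (S := .hom S R) (Linking.curry (X := T.signed) (Y := S.signed) ξ) := by
  have h2 := Allowable.comp (.coev T S) (.hom (T := S) (.id S) h)
  exact (congrArg (fun ζ => Allowable (T := T) (S := .hom S R) ζ)
    (curry_eq (X := T.signed) (Y := S.signed) ξ)).mpr h2

theorem Allowable.uncurry {ξ : T.signed ⟶ (Shape.hom S R).signed} (h : Allowable ξ) :
    Allowable (T := .tensor T S) (Linking.uncurry (X := T.signed) (Y := S.signed) ξ) := by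
  have h2 := Allowable.comp (S := .tensor (.hom S R) S)
    (.tensor (S := .hom S R) h (.id S)) (.ev S R)
  exact (congrArg (fun ζ => Allowable (T := .tensor T S) (S := R) ζ)
    (uncurry_eq (Y := S.signed) (Z := R.signed) ξ)).mpr h2

theorem Allowable.substOK {ξ : T.signed ⟶ S.signed} (h : Allowable ξ) : SubstOK ξ := by
  induction h with
  | id T => exact .id T
  | comp _ _ h h' => exact h.comp h'
  | tensor _ _ h h' => exact h.tensor h'
  | hom _ _ h h' => exact h.hom h'
  | assoc T S R =>
    refine .ofSIso _ fun f => ⟨SIso.assoc (Shape.subst T _).signed (Shape.subst S _).signed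
      (Shape.subst R _).signed, .assoc _ _ _, ?_⟩
    rintro ((a | a) | a) p <;> rfl
  | assoc_inv T S R =>
    refine .ofSIso (T := .tensor T (.tensor S R)) (S := .tensor (.tensor T S) R)
      (SIso.assoc T.signed S.signed R.signed).symm fun f =>
      ⟨(SIso.assoc (Shape.subst T _).signed (Shape.subst S _).signed
      (Shape.subst R _).signed).symm, .assoc_inv _ _ _, ?_⟩
    rintro (a | (a | a)) p <;> rfl
  | unitor T =>
    exact .ofSIso (S := .tensor T .unit) _ fun f => ⟨SIso.unitor (Shape.subst T _).signed,
      .unitor _, fun a p => rfl⟩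
  | unitor_inv T =>
    refine .ofSIso (T := .tensor T .unit) (SIso.unitor T.signed).symm fun f =>
      ⟨(SIso.unitor (Shape.subst T _).signed).symm, .unitor_inv _, ?_⟩
    rintro (a | a) p
    · rfl
    · exact a.elim
  | comm T S =>
    refine .ofSIso (T := .tensor T S) _ fun f => ⟨SIso.comm (Shape.subst T _).signed
      (Shape.subst S _).signed, .comm _ _, ?_⟩
    rintro (a | a) p <;> rfl
  | coev T S => exact SubstOK.curry (.id (.tensor T S)) Allowable.curry
  | ev T S => exact SubstOK.uncurry (.id (.hom T S)) Allowable.uncurry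

end
open SignedSet Linking

section
variable {C : Type u} [Category.{v} C] {D : Type u'} [Category.{v'} D]
  {E : Type u''} [Category.{v''} E]

namespace LShape
variable {α β γ α' β' : LShape C}

theorem Allow.id (α : LShape C) : Allow (𝟙 α.signed) := by
  unfold Allow; rw [forgetHom_id]; exact .id α.shape

theorem Allow.comp {ξ : α.signed ⟶ β.signed} {η : β.signed ⟶ γ.signed} (h : Allow ξ)
    (h' : Allow η) : Allow (ξ ≫ η) := by
  unfold Allow; rw [forgetHom_comp]
  exact Allowable.comp (T := α.shape) (S := β.shape) (R := γ.shape) h h'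

theorem Allow.hom {ξ : α.signed ⟶ β.signed} {η : α'.signed ⟶ β'.signed} (h : Allow ξ)
    (h' : Allow η) : Allow (α := β.hom α') (β := α.hom β') (homMap ξ η) := by
  unfold Allow
  have := Allowable.hom h h'
  exact (congrArg (fun ζ => Allowable (T := .hom β.shape α'.shape)
    (S := .hom α.shape β'.shape) ζ) (forgetHom_homMap ξ η)).mpr this

theorem Allow.curry {ξ : (α.tensor β).signed ⟶ γ.signed} (h : Allow ξ) :
    Allow (β := β.hom γ) (Linking.curry (X := α.signed) (Y := β.signed) ξ) := by
  unfold Allow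
  have := Allowable.curry (T := α.shape) (S := β.shape) (R := γ.shape) h
  exact (congrArg (fun ζ => Allowable (T := α.shape)
    (S := .hom β.shape γ.shape) ζ) (forgetHom_curry (X := α.signed) (Y := β.signed) ξ)).mpr this

theorem Allow.uncurry {ξ : α.signed ⟶ (β.hom γ).signed} (h : Allow ξ) :
    Allow (α := α.tensor β) (Linking.uncurry (X := α.signed) (Y := β.signed) ξ) := by
  unfold Allow
  have := Allowable.uncurry (T := α.shape) (S := β.shape) (R := γ.shape) h
  exact (congrArg (fun ζ => Allowable (T := .tensor α.shape β.shape)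
    (S := γ.shape) ζ) (forgetHom_uncurry (Y := β.signed) (Z := γ.signed) ξ)).mpr this

theorem Allow.ofAI {e : SIso α.signed β.signed} (h : AI (T := α.shape) (S := β.shape) e.forget) :
    Allow (ofSIso e) := by
  unfold Allow
  exact (congrArg (fun ζ => Allowable (T := α.shape)
    (S := β.shape) ζ) (forgetHom_ofSIso e)).mpr h.1

/-- The category of labelled shapes and allowable labelled graphs -/
instance : Category (LShape C) where
  Hom α β := {ξ : α.signed ⟶ β.signed // Allow ξ}
  id α := ⟨𝟙 α.signed, .id α⟩
  comp ξ η := ⟨ξ.1 ≫ η.1, ξ.2.comp η.2⟩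
  id_comp ξ := Subtype.ext (Category.id_comp ξ.1)
  comp_id ξ := Subtype.ext (Category.comp_id ξ.1)
  assoc ξ η ζ := Subtype.ext (Category.assoc ξ.1 η.1 ζ.1)

end LShape

/-! ### Labels that are themselves labelled shapes -/

/-- Replacing each variable by the variables of its label -/
abbrev SignedSet.flat (X : SignedSet (LShape D)) : SignedSet D where
  Var := Σ a, (X.label a).shape.Var
  fin := by
    have := X.fin; have := fun a => (X.label a).shape.finite_var; infer_instance
  sign := fun p => X.sign p.1 == (X.label p.1).shape.sign p.2
  label := fun p => (X.label p.1).label p.2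

namespace Linking
variable {X Y Z : SignedSet (LShape D)}

abbrev flatPt (X : SignedSet (LShape D)) (a b : X.Var) :
    (X.label a).shape.Var ⊕ (X.label b).shape.Var → X.flat.Var :=
  Sum.elim (fun p => ⟨a, p⟩) (fun p => ⟨b, p⟩)

inductive FlatRel (θ : Linking X) : X.flat.Var → X.flat.Var → ∀ {c d : D}, (c ⟶ d) → Prop
  | mk {a b : X.Var} {h : X.label a ⟶ X.label b} {p q : (X.label a).shape.Var ⊕
      (X.label b).shape.Var} {c d : D} {g : c ⟶ d} : θ.edge a b h →
      Edge (X := (X.label a).signed.hom (X.label b).signed) h.1 p q g →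
      FlatRel θ (flatPt X a b p) (flatPt X a b q) g

theorem FlatRel.cases' {θ : Linking X} {v w : X.flat.Var} {c d : D} {g : c ⟶ d}
    (r : FlatRel θ v w g) : ∃ (a b : X.Var) (h : X.label a ⟶ X.label b) (p q : _),
      θ.edge a b h ∧ v = flatPt X a b p ∧ w = flatPt X a b q ∧
      Edge (X := (X.label a).signed.hom (X.label b).signed) h.1 p q g := by
  cases r with | mk e r => exact ⟨_, _, _, _, _, e, rfl, rfl, r⟩

theorem flatPt_sign {θ : Linking X} {a b : X.Var} {h : X.label a ⟶ X.label b}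
    (e : θ.edge a b h) (p) : X.flat.sign (flatPt X a b p) =
      ((X.label a).signed.hom (X.label b).signed).sign p := by
  rcases p with p | p
  · simp [θ.sign_src e]
  · simp [θ.sign_tgt e]

theorem flatPt_label {a b : X.Var} (p) : X.flat.label (flatPt X a b p) =
      ((X.label a).signed.hom (X.label b).signed).label p := by
  rcases p with p | p <;> rfl

theorem flatPt_inj {θ : Linking X} {a b a' b' : X.Var} {h : X.label a ⟶ X.label b}
    {h' : X.label a' ⟶ X.label b'} (e : θ.edge a b h) (e' : θ.edge a' b' h') {p p'}
    (H : flatPt X a b p = flatPt X a' b' p') : a = a' ∧ b = b' ∧ HEq h h' ∧ HEq p p' := by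
  rcases p with p | p <;> rcases p' with p' | p' <;>
    simp only [Sum.elim_inl, Sum.elim_inr, Sigma.mk.injEq] at H
  · obtain ⟨rfl, hp⟩ := H
    obtain ⟨rfl, hh⟩ := θ.unique_of_neg e e'
    cases hp
    exact ⟨rfl, rfl, hh, HEq.rfl⟩
  · have h1 := θ.sign_src e
    rw [H.1, θ.sign_tgt e'] at h1
    exact absurd h1 (by simp)
  · have h1 := θ.sign_tgt e
    rw [H.1, θ.sign_src e'] at h1
    exact absurd h1 (by simp)
  · obtain ⟨rfl, hp⟩ := H
    obtain rfl := θ.unique_of_pos e e'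
    obtain ⟨_, hh⟩ := θ.unique_of_neg e e'
    cases hp
    exact ⟨rfl, rfl, hh, HEq.rfl⟩

/-- Each edge is replaced by the edges of its label. -/
def flat (θ : Linking X) : Linking X.flat :=
  ofRel (FlatRel θ)
    (fun r => by
      obtain ⟨a, b, h, p, q, e, rfl, rfl, s⟩ := r.cases'
      exact ⟨s.lab.1.trans (flatPt_label p).symm, s.lab.2.trans (flatPt_label q).symm⟩)
    (fun r => by
      obtain ⟨a, b, h, p, q, e, rfl, rfl, s⟩ := r.cases'
      exact (flatPt_sign e p).trans s.neg)
    (fun r => by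
      obtain ⟨a, b, h, p, q, e, rfl, rfl, s⟩ := r.cases'
      exact (flatPt_sign e q).trans s.pos)
    (fun v hv => by
      obtain ⟨x, v⟩ := v
      cases hs : X.sign x
      · obtain ⟨b, h, e⟩ := θ.exists_of_neg x hs
        obtain ⟨q, c, d, g, r⟩ := Edge.exists_of_neg
          (X := (X.label x).signed.hom (X.label b).signed) h.1 (.inl v) (by simp_all)
        exact ⟨_, _, _, _, .mk e r⟩
      · obtain ⟨b, h, e⟩ := θ.exists_of_pos x hs
        obtain ⟨q, c, d, g, r⟩ := Edge.exists_of_neg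
          (X := (X.label b).signed.hom (X.label x).signed) h.1 (.inr v) (by simp_all)
        exact ⟨_, _, _, _, .mk e r⟩)
    (fun v hv => by
      obtain ⟨x, v⟩ := v
      cases hs : X.sign x
      · obtain ⟨b, h, e⟩ := θ.exists_of_neg x hs
        obtain ⟨q, c, d, g, r⟩ := Edge.exists_of_pos
          (X := (X.label x).signed.hom (X.label b).signed) h.1 (.inl v) (by simp_all)
        exact ⟨_, _, _, _, .mk e r⟩
      · obtain ⟨b, h, e⟩ := θ.exists_of_pos x hs
        obtain ⟨q, c, d, g, r⟩ := Edge.exists_of_pos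
          (X := (X.label b).signed.hom (X.label x).signed) h.1 (.inr v) (by simp_all)
        exact ⟨_, _, _, _, .mk e r⟩)
    (fun r r' => by
      obtain ⟨a, b, h, p, q, e, rfl, rfl, s⟩ := r.cases'
      obtain ⟨a', b', h', p', q', e', hv, rfl, s'⟩ := r'.cases'
      obtain ⟨rfl, rfl, hh, hp⟩ := flatPt_inj e e' hv
      cases hh
      cases hp
      obtain ⟨rfl, hh⟩ := s.unique s'
      exact ⟨rfl, hh⟩)
    (fun r r' => by
      obtain ⟨a, b, h, p, q, e, rfl, rfl, s⟩ := r.cases'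
      obtain ⟨a', b', h', p', q', e', rfl, hv, s'⟩ := r'.cases'
      obtain ⟨rfl, rfl, hh, hp⟩ := flatPt_inj e e' hv
      cases hh
      cases hp
      obtain rfl := s.unique' s'
      rfl)

theorem sits_flat {θ : Linking X} {S : Sys D} {k : X.flat.Var → S.V} :
    (flat θ).Sits S k ↔ (∀ a p, S.lab (k ⟨a, p⟩) = (X.label a).label p) ∧
      ∀ a b h, θ.edge a b h → HSits h.1 S (fun p => k ⟨a, p⟩) (fun p => k ⟨b, p⟩) := by
  constructor
  · intro H
    refine ⟨fun a p => H.1 ⟨a, p⟩, fun a b h e => ?_⟩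
    refine Sits.of_edge (X := (X.label a).signed.hom (X.label b).signed)
      (by rintro (p | p); exacts [H.1 ⟨a, p⟩, H.1 ⟨b, p⟩]) fun {p q _ _ _} r => ?_
    have := H.path (ofRel_Edge.2 (.mk e r))
    rcases p with p | p <;> rcases q with q | q <;> exact this
  · rintro ⟨h1, h2⟩
    refine .of_edge (fun a => h1 a.1 a.2) fun r => ?_
    obtain ⟨a, b, h, p, q, e, rfl, rfl, s⟩ := (ofRel_Edge.1 r).cases'
    have := Sits.path (X := (X.label a).signed.hom (X.label b).signed) (h2 a b h e) s
    rcases p with p | p <;> rcases q with q | q <;> exact this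

def flatHomIso (X Y : SignedSet (LShape D)) : SIso (X.hom Y).flat (X.flat.hom Y.flat) :=
  ⟨⟨fun p => match p with
      | ⟨.inl a, p⟩ => .inl ⟨a, p⟩
      | ⟨.inr a, p⟩ => .inr ⟨a, p⟩,
    fun v => match v with
      | .inl p => ⟨.inl p.1, p.2⟩
      | .inr p => ⟨.inr p.1, p.2⟩,
    by rintro ⟨a | a, p⟩ <;> rfl, by rintro (⟨a, p⟩ | ⟨a, p⟩) <;> rfl⟩,
    by
      rintro ⟨a | a, p⟩
      · change (! (X.sign a == (X.label a).shape.sign p)) = ((! X.sign a) ==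
          (X.label a).shape.sign p)
        cases X.sign a <;> cases (X.label a).shape.sign p <;> rfl
      · rfl,
    by rintro ⟨a | a, p⟩ <;> rfl⟩

def flatHom (ξ : X ⟶ Y) : X.flat ⟶ Y.flat :=
  map (X := (X.hom Y).flat) (flat (X := X.hom Y) ξ) (flatHomIso X Y)

/-- The points of the label of a variable -/
abbrev flatVal {V : Type} (i : X.flat.Var → V) (j : Y.flat.Var → V) :
    (a : (X.hom Y).Var) → ((X.hom Y).label a).shape.Var → V
  | .inl a, p => i ⟨a, p⟩
  | .inr a, p => j ⟨a, p⟩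

theorem hsits_flatHom {ξ : X ⟶ Y} {S : Sys D} {i : X.flat.Var → S.V} {j : Y.flat.Var → S.V} :
    HSits (flatHom ξ) S i j ↔
      (∀ a p, S.lab (flatVal i j a p) = ((X.hom Y).label a).label p) ∧
      ∀ a b h, ξ.edge a b h → HSits h.1 S (flatVal i j a) (flatVal i j b) := by
  unfold flatHom HSits
  rw [sits_map, sits_flat]
  have : ∀ a p, (Sum.elim i j ∘ (flatHomIso X Y).e) ⟨a, p⟩ = flatVal i j a p := by
    rintro (a | a) p <;> rfl
  simp only [this]
  rfl

/-- Edges labelled by graphs compose to paths labelled by graphs. -/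
theorem hsits_path {S₀ : Sys (LShape D)} {S : Sys D} (k : ∀ v, (S₀.lab v).shape.Var → S.V)
    (hk : ∀ v p, S.lab (k v p) = (S₀.lab v).label p)
    (hs : ∀ v w (h : S₀.lab v ⟶ S₀.lab w), S₀.step v w h → HSits h.1 S (k v) (k w))
    {v w : S₀.V} {c d : LShape D} {h : c ⟶ d} (p : S₀.Path v w h) :
    ∀ (i : c.shape.Var → S.V) (j : d.shape.Var → S.V), HEq i (k v) → HEq j (k w) →
      HSits h.1 S i j := by
  induction p with
  | refl a =>
    rintro i j hi hj
    cases hi; cases hj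
    exact hsits_id (hk a)
  | cons s p ih =>
    rintro i j hi hj
    obtain ⟨rfl, rfl⟩ := S₀.step_lab s
    obtain ⟨-, rfl⟩ := Sys.Path.lab p
    cases hi; cases hj
    exact (hs _ _ _ s).comp (ih _ _ HEq.rfl HEq.rfl)

theorem flatHom_id : flatHom (𝟙 X) = 𝟙 X.flat := by
  refine eq_of_hsits (hsits_flatHom.2 ⟨?_, fun a b h e => ?_⟩)
  · rintro (a | a) p <;> rfl
  · have hr := hsits_id_iff.1 (hsits_self (𝟙 X.flat))
    have r := id_Edge.1 (edge_iff _ |>.2 e)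
    have key : ∀ {a b} {c d : LShape D} {h : c ⟶ d}, IdRel X a b h →
        ∀ i j, HEq i (flatVal (X := X) (Y := X) (V := (X.flat.hom X.flat).Var) Sum.inl Sum.inr a) →
          HEq j (flatVal (X := X) (Y := X) (V := (X.flat.hom X.flat).Var) Sum.inl Sum.inr b) →
          HSits h.1 (hsys (𝟙 X.flat)) i j := by
      intro a b c d h r i j hi hj
      cases r with
      | @pos a hs =>
        cases hi; cases hj
        refine hsits_id_iff.2 fun p => ?_
        have := hr ⟨a, p⟩
        change IdAt _ (X.sign a == _) _ _ _ at this
        rw [hs] at this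
        simpa using this
      | @neg a hs =>
        cases hi; cases hj
        refine hsits_id_iff.2 fun p => ?_
        have := hr ⟨a, p⟩
        change IdAt _ (X.sign a == _) _ _ _ at this
        rw [hs] at this
        refine IdAt.symm ?_
        simpa using this
    exact key r _ _ HEq.rfl HEq.rfl

theorem flatHom_comp (ξ : X ⟶ Y) (η : Y ⟶ Z) : flatHom (ξ ≫ η) = flatHom ξ ≫ flatHom η := by
  let S := compSys (flatHom ξ) (flatHom η)
  refine eq_of_sits (X := X.flat.hom Z.flat) (S := S) (i := embO _ _ _) ?_ comp_sits_compSys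
    embO_inj fun a ha => compSys_terminal a ha
  have h1 := hsits_flatHom.1 ((hsits_iff (ξ := flatHom ξ)).1
    (left_sits_compSys (ξ := flatHom ξ) (η := flatHom η)))
  have h2 := hsits_flatHom.1 ((hsits_iff (ξ := flatHom η)).1
    (right_sits_compSys (ξ := flatHom ξ) (η := flatHom η)))
  refine hsits_iff.2 (hsits_flatHom.2 ⟨by rintro (a | a) p <;> rfl, fun a b h e => ?_⟩)
  have p := (comp_sits_compSys (ξ := ξ) (η := η)).2 a b h e
  let k : ∀ v : (compSys ξ η).V, ((compSys ξ η).lab v).shape.Var → S.V := fun v => match v with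
    | .inl a => fun p => .inl ⟨a, p⟩
    | .inr (.inl a) => fun p => .inr (.inl ⟨a, p⟩)
    | .inr (.inr a) => fun p => .inr (.inr ⟨a, p⟩)
  refine hsits_path (S₀ := compSys ξ η) (S := S) k (by rintro (a | a | a) p <;> rfl) ?_ p _ _ ?_ ?_
  · intro v w h s
    obtain ⟨a', b', rfl, rfl, e⟩ | ⟨a', b', rfl, rfl, e⟩ := compStep_cases s
    · rcases a' with a' | a' <;> rcases b' with b' | b' <;>
        first
        | exact h1.2 (.inl a') (.inl b') h ((edge_iff (X := X.hom Y) ξ).1 e)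
        | exact h1.2 (.inl a') (.inr b') h ((edge_iff (X := X.hom Y) ξ).1 e)
        | exact h1.2 (.inr a') (.inl b') h ((edge_iff (X := X.hom Y) ξ).1 e)
        | exact h1.2 (.inr a') (.inr b') h ((edge_iff (X := X.hom Y) ξ).1 e)
    · rcases a' with a' | a' <;> rcases b' with b' | b' <;>
        first
        | exact h2.2 (.inl a') (.inl b') h ((edge_iff (X := Y.hom Z) η).1 e)
        | exact h2.2 (.inl a') (.inr b') h ((edge_iff (X := Y.hom Z) η).1 e)
        | exact h2.2 (.inr a') (.inl b') h ((edge_iff (X := Y.hom Z) η).1 e)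
        | exact h2.2 (.inr a') (.inr b') h ((edge_iff (X := Y.hom Z) η).1 e)
  · rcases a with a | a <;> exact HEq.rfl
  · rcases b with b | b <;> exact HEq.rfl

end Linking

/-! ### Systems without labels -/

def Sys.forget (S : Sys C) : Sys Pt where
  V := S.V
  lab _ := ⟨⟨⟩⟩
  step a b _ _ _ := ∃ (c d : C) (h : c ⟶ d), S.step a b h
  step_lab _ := ⟨Subsingleton.elim _ _, Subsingleton.elim _ _⟩
  det {a b b' c d c' d' h h'} s s' := by
    obtain ⟨_, _, _, s⟩ := s
    obtain ⟨_, _, _, s'⟩ := s'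
    refine ⟨(S.det s s').1, ?_⟩
    obtain rfl : c = c' := Subsingleton.elim _ _
    obtain rfl : d = d' := Subsingleton.elim _ _
    exact heq_of_eq (Subsingleton.elim _ _)

namespace Linking
variable {X Y Z : SignedSet C}

theorem path_cast {S : Sys Pt} {a b : S.V} {c d c' d' : Pt} {h : c ⟶ d} (p : S.Path a b h)
    (h' : c' ⟶ d') : S.Path a b h' := by
  obtain rfl : c = c' := Subsingleton.elim _ _
  obtain rfl : d = d' := Subsingleton.elim _ _
  obtain rfl : h = h' := Subsingleton.elim _ _
  exact p

theorem path_forget {S : Sys C} {a b : S.V} {c d : C} {h : c ⟶ d} (p : S.Path a b h)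
    {c' d' : Pt} (h' : c' ⟶ d') : S.forget.Path a b h' := by
  refine path_cast (h := (Functor.star C).map h) ?_ h'
  refine mapPath (Functor.star C) (S := S) (S' := S.forget) (f := id) (fun a => lab_pt)
    (fun s => Sys.Path.of_step (S := S.forget) ⟨_, _, _, s⟩) p

theorem HSits.forget {ξ : X ⟶ Y} {S : Sys C} {i j} (H : HSits ξ S i j) :
    HSits (forgetHom ξ) S.forget i j := by
  refine Sits.of_edge (X := X.forget.hom Y.forget) (fun a => lab_pt) fun r => ?_
  obtain ⟨c, d, h, r⟩ := (forget_Edge (X := X.hom Y)).1 r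
  exact path_forget (Sits.path H r) _

theorem forgetHom_eq {ξ : X ⟶ Y} {ζ : X.forget ⟶ Y.forget}
    (H : HSits ζ (hsys ξ).forget Sum.inl Sum.inr) : ζ = forgetHom ξ := by
  refine eq_of_sits (X := X.forget.hom Y.forget) (S := (hsys ξ).forget) H
    (HSits.forget (hsits_self ξ)) ?_ ?_
  · rintro (a | a) (b | b) h <;> exact h
  · rintro (a | a) ha b c d h ⟨_, _, _, s⟩
    · have h1 : (! X.sign a) = true := ha
      have h2 : (! X.sign a) = false := Edge.neg (X := X.hom Y) s
      exact Bool.noConfusion (h1.symm.trans h2)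
    · have h1 : Y.sign a = true := ha
      have h2 : Y.sign a = false := Edge.neg (X := X.hom Y) s
      exact Bool.noConfusion (h1.symm.trans h2)

end Linking

namespace LShape

/-- Substitution of its labels into a labelled shape -/
def bind (α : LShape (LShape D)) : LShape D where
  shape := α.shape.subst fun a => (α.label a).shape
  label := fun v => let p := α.shape.unglue _ v; (α.label p.1).label p.2

def bindIso (α : LShape (LShape D)) : SIso α.signed.flat α.bind.signed :=
  ⟨α.shape.glueEquiv _, fun p => α.shape.sign_glue (fun a => (α.label a).shape) p.1 p.2,
    fun p => congrArg (fun q : Σ a, (α.label a).shape.Var => (α.label q.1).label q.2)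
      (α.shape.unglue_glue (fun a => (α.label a).shape) p.1 p.2)⟩

theorem allow_flat {α β : LShape (LShape D)} {ξ : α.signed ⟶ β.signed} (hξ : Allow ξ) :
    Allow (α := α.bind) (β := β.bind) (conj α.bindIso β.bindIso (flatHom ξ)) := by
  classical
  let lab := (α.signed.hom β.signed).label
  have hsrc : ∀ a : (α.signed.hom β.signed).Var, ∃ s,
      ((α.signed.hom β.signed).sign a = false → s = a) ∧
      ((α.signed.hom β.signed).sign a = true → ∃ h, ξ.edge s a h) := by
    intro a
    cases hs : (α.signed.hom β.signed).sign a
    · exact ⟨a, fun _ => rfl, fun h => Bool.noConfusion h⟩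
    · obtain ⟨b, h, e⟩ := ξ.exists_of_pos a hs
      exact ⟨b, fun h => Bool.noConfusion h, fun _ => ⟨h, e⟩⟩
  choose s hs1 hs2 using hsrc
  have hj : ∀ a b, Joined (T := α.shape) (S := β.shape) (forgetHom ξ) a b → s a = s b := by
    rintro a b ⟨_, _, _, e⟩
    obtain ⟨c, d, h, e⟩ := (forget_Edge (X := α.signed.hom β.signed)).1 e
    obtain ⟨h', e'⟩ := hs2 b e.pos
    rw [hs1 a e.neg]
    exact e.unique' (.mk e')
  let k : α.shape.Var ⊕ β.shape.Var → Shape := fun a => (lab (s a)).shape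
  obtain ⟨ζ, aζ, Hζ⟩ := Allowable.substOK (T := α.shape) (S := β.shape) hξ k
    fun a b j => congrArg (fun a => (lab a).shape) (hj a b j)
  have e1 : ∀ a, (α.signed.hom β.signed).sign a = false → s a = a := hs1
  choose h2 hh2 using hs2
  obtain ⟨A, aA, HA⟩ := exists_subst_map α.shape (fun a => (α.label a).shape)
    (fun a => k (.inl a))
    (fun a h => forgetHom (eqToHom (congrArg lab (e1 (.inl a) (by simp [h])).symm) :
      lab (.inl a) ⟶ lab (s (.inl a))).1)
    (fun a h => forgetHom (h2 (.inl a) (by simp [h])).1)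
    (fun a h => (eqToHom (congrArg lab (e1 (.inl a) (by simp [h])).symm) :
      lab (.inl a) ⟶ lab (s (.inl a))).2)
    (fun a h => (h2 (.inl a) (by simp [h])).2)
  obtain ⟨B, aB, HB⟩ := exists_subst_map β.shape (fun a => k (.inr a))
    (fun a => (β.label a).shape)
    (fun a h => forgetHom (h2 (.inr a) h).1)
    (fun a h => forgetHom (eqToHom (congrArg lab (e1 (.inr a) h).symm) :
      lab (.inr a) ⟶ lab (s (.inr a))).1)
    (fun a h => (h2 (.inr a) h).2)
    (fun a h => (eqToHom (congrArg lab (e1 (.inr a) h).symm) :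
      lab (.inr a) ⟶ lab (s (.inr a))).2)
  have key : A ≫ ζ ≫ B = forgetHom (X := α.bind.signed) (Y := β.bind.signed)
      (conj α.bindIso β.bindIso (flatHom ξ)) := by
    refine forgetHom_eq (X := α.bind.signed) (Y := β.bind.signed)
      (ξ := conj α.bindIso β.bindIso (flatHom ξ)) ?_
    let S := hsys (X := α.bind.signed) (Y := β.bind.signed)
      (conj α.bindIso β.bindIso (flatHom ξ))
    have H := hsits_flatHom.1 (hsits_conj.1 (hsits_self (conj α.bindIso β.bindIso (flatHom ξ))))
    let G : ∀ a, (lab a).shape.Var → S.V := fun a p =>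
      flatVal (X := α.signed) (Y := β.signed) (fun a => (Sum.inl (α.bindIso.e a) : S.V))
        (fun a => Sum.inr (β.bindIso.e a)) a p
    have Heq : ∀ a b (h : a = b), HSits (forgetHom (eqToHom (congrArg lab h) :
        lab a ⟶ lab b).1) S.forget (G a) (G b) := by
      rintro a _ rfl
      refine HSits.forget (hsits_id (H.1 a))
    have He : ∀ a h, HSits (forgetHom (h2 a h).1) S.forget (G (s a)) (G a) :=
      fun a h => HSits.forget (H.2 _ _ _ (hh2 a h))
    let i' : (α.shape.subst fun a => k (.inl a)).Var → S.V := fun v =>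
      G (s (.inl (α.shape.unglue _ v).1)) (α.shape.unglue _ v).2
    let j' : (β.shape.subst fun a => k (.inr a)).Var → S.V := fun v =>
      G (s (.inr (β.shape.unglue _ v).1)) (β.shape.unglue _ v).2
    have hi' : ∀ a p, i' (α.shape.glue _ a p) = G (s (.inl a)) p := fun a p =>
      congrArg (fun r : Σ a, (k (.inl a)).Var => G (s (.inl r.1)) r.2)
        (α.shape.unglue_glue (fun a => k (.inl a)) a p)
    have hj' : ∀ a p, j' (β.shape.glue _ a p) = G (s (.inr a)) p := fun a p =>
      congrArg (fun r : Σ a, (k (.inr a)).Var => G (s (.inr r.1)) r.2)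
        (β.shape.unglue_glue (fun a => k (.inr a)) a p)
    refine HSits.comp (S := S.forget) (j := i') (HA _ _ _ ?_ ?_)
      (HSits.comp (S := S.forget) (j := j') (Hζ _ _ _ ?_) (HB _ _ _ ?_ ?_))
    · intro a h
      exact (Heq (.inl a) _ (e1 (.inl a) (by simp [h])).symm).congr (fun _ => rfl)
        fun p => (hi' a p).symm
    · intro a h
      exact (He (.inl a) (by simp [h])).congr (fun p => (hi' a p).symm) fun _ => rfl
    · intro a b j e p
      have hg : ∀ a (p : (k a).Var), glueS k i' j' a p = G (s a) p := by
        rintro (a | a) p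
        exacts [hi' a p, hj' a p]
      have hst := hj a b j
      have : ∀ (x y) (h : x = y) (e : (lab x).shape = (lab y).shape) (p : (lab x).shape.Var),
          G x p = G y (e ▸ p) := by
        rintro x _ rfl e p; rfl
      exact IdAt.congr (IdAt.rfl_pt (S := S.forget) (s := (k a).sign p) (c := ⟨⟨⟩⟩)) rfl
        ((hg a p).trans ((this _ _ hst e p).trans (hg b _).symm))
    · intro a h
      exact (He (.inr a) h).congr (fun p => (hj' a p).symm) fun _ => rfl
    · intro a h
      exact (Heq (.inr a) _ (e1 (.inr a) h).symm).congr (fun _ => rfl)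
        fun p => (hj' a p).symm
  unfold Allow
  exact (congrArg (fun ζ => Allowable (T := α.bind.shape) (S := β.bind.shape) ζ) key).mp
    (.comp aA (.comp aζ aB))

/-- Substitution of labelled shapes for the labels of labelled shapes, and of labelled graphs for
the labels of the edges of labelled graphs -/
def flatten (D : Type u') [Category.{v'} D] : LShape (LShape D) ⥤ LShape D where
  obj := bind
  map {α β} ξ := ⟨conj α.bindIso β.bindIso (flatHom ξ.1), allow_flat ξ.2⟩
  map_id α := Subtype.ext
    ((congrArg (conj α.bindIso α.bindIso) flatHom_id).trans (conj_id α.bindIso))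
  map_comp {α β γ} ξ η := Subtype.ext
    ((congrArg (conj α.bindIso γ.bindIso) (flatHom_comp ξ.1 η.1)).trans
      (conj_comp α.bindIso β.bindIso γ.bindIso _ _))

theorem allow_map (F : C ⥤ D) {α β : LShape C} {ξ : α.signed ⟶ β.signed} (hξ : Allow ξ) :
    Allow (α := ⟨α.shape, fun a => F.obj (α.label a)⟩) (β := ⟨β.shape, fun a => F.obj (β.label a)⟩)
      (mapHom F ξ) := by
  unfold Allow
  have : forgetHom (mapHom F ξ) = forgetHom ξ := by
    refine eq_of_edge (X := α.shape.signed.hom β.shape.signed) fun r => ?_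
    obtain ⟨c, d, h, r⟩ := (forget_Edge (X := (α.signed.mapLabel F).hom (β.signed.mapLabel F))).1 r
    have r' := mapHom_Edge.1 r
    obtain ⟨r''⟩ := r'
    exact ⟨_, _, 𝟙 (Discrete.mk PUnit.unit.{1}), forget_Edge.2 ⟨_, _, _, r''⟩⟩
  exact (congrArg (fun ζ => Allowable (T := α.shape) (S := β.shape) ζ) this).mpr hξ

/-- Change of labels along a functor -/
def relabel (F : C ⥤ D) : LShape C ⥤ LShape D where
  obj α := ⟨α.shape, fun a => F.obj (α.label a)⟩
  map ξ := ⟨mapHom F ξ.1, allow_map F ξ.2⟩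
  map_id α := Subtype.ext (mapHom_id F)
  map_comp ξ η := Subtype.ext (mapHom_comp F ξ.1 η.1)

/-- For a functor `F : C ⥤ A D`, the functor `A F : A C ⥤ A D` which substitutes the images
under `F` for the labels of shapes and graphs -/
def Amap (F : C ⥤ LShape D) : LShape C ⥤ LShape D := relabel F ⋙ flatten D

end LShape
end

/-- The index of an entry of a concatenation of lists, as a pair of indices -/
def split {n : ℕ} (m : Fin n → ℕ) : Fin (∑ i, m i) ≃ Σ i, Fin (m i) := finSigmaFinEquiv.symm

/-- Concatenation of a list of lists -/
abbrev concat {A : Type*} {n : ℕ} {m : Fin n → ℕ} (z : ∀ i, Fin (m i) → A) :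
    Fin (∑ i, m i) → A :=
  fun k => z (split m k).1 (split m k).2

/-- A list of length `n`, as a list of one list -/
def sumOne (n : ℕ) : Fin (∑ _ : Fin 1, n) ≃ Fin n :=
  (split fun _ : Fin 1 => n).trans
    ⟨fun p => p.2, fun k => ⟨0, k⟩, fun ⟨i, k⟩ => by obtain rfl := Subsingleton.elim i 0; rfl,
      fun _ => rfl⟩

/-- A list of length `n`, as a list of lists of length one -/
def sumOnes (n : ℕ) : Fin (∑ _ : Fin n, 1) ≃ Fin n :=
  (split fun _ : Fin n => 1).trans
    ⟨fun p => p.1, fun k => ⟨k, 0⟩, fun ⟨i, k⟩ => by obtain rfl := Subsingleton.elim k 0; rfl,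
      fun _ => rfl⟩

/-- The two ways of concatenating a list of lists of lists -/
def sumAssoc {n : ℕ} (m : Fin n → ℕ) (l : ∀ i, Fin (m i) → ℕ) :
    Fin (∑ p : Fin (∑ i, m i), concat l p) ≃ Fin (∑ i, ∑ j, l i j) :=
  (split (concat l)).trans <|
    (Equiv.sigmaCongrLeft (β := fun q : Σ i, Fin (m i) => Fin (l q.1 q.2)) (split m)).trans <|
    (Equiv.sigmaAssoc fun i j => Fin (l i j)).trans <|
    (Equiv.sigmaCongrRight fun i => (split (l i)).symm).trans
    (split fun i => ∑ j, l i j).symm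

/-- The sum of a family of permutations -/
def sumPerm {n : ℕ} {m m' : Fin n → ℕ} (σ : ∀ i, Fin (m' i) ≃ Fin (m i)) :
    Fin (∑ i, m' i) ≃ Fin (∑ i, m i) :=
  (split m').trans ((Equiv.sigmaCongrRight σ).trans (split m).symm)

/-- The permutation of blocks induced by a permutation -/
def blockPerm {n n' : ℕ} (σ : Fin n' ≃ Fin n) (m : Fin n → ℕ) :
    Fin (∑ i, m (σ i)) ≃ Fin (∑ i, m i) :=
  (split fun i => m (σ i)).trans
    ((Equiv.sigmaCongrLeft (β := fun i => Fin (m i)) σ).trans (split m).symm)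

section
variable {n n' : ℕ}

@[simp] theorem split_sumOne_symm (k) : split (fun _ : Fin 1 => n) ((sumOne n).symm k) = ⟨0, k⟩ :=
  (split (fun _ : Fin 1 => n)).apply_symm_apply _

theorem sumOne_of_split {k i j} (h : split (fun _ : Fin 1 => n) k = ⟨i, j⟩) : sumOne n k = j :=
  congrArg (fun p : Σ _ : Fin 1, Fin n => p.2) h

theorem sumOnes_of_split {k i j} (h : split (fun _ : Fin n => 1) k = ⟨i, j⟩) : sumOnes n k = i :=
  congrArg (fun p : Σ _ : Fin n, Fin 1 => p.1) h

@[simp] theorem split_sumOnes_symm (k) :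
    split (fun _ : Fin n => 1) ((sumOnes n).symm k) = ⟨k, 0⟩ :=
  (split (fun _ : Fin n => 1)).apply_symm_apply _

@[simp] theorem split_sumPerm {m m' : Fin n → ℕ} (σ : ∀ i, Fin (m' i) ≃ Fin (m i)) (k) :
    split m (sumPerm σ k) = ⟨(split m' k).1, σ _ (split m' k).2⟩ :=
  (split m).apply_symm_apply _

@[simp] theorem split_blockPerm (σ : Fin n' ≃ Fin n) (m : Fin n → ℕ) (k) :
    split m (blockPerm σ m k) = ⟨σ (split _ k).1, (split (fun i => m (σ i)) k).2⟩ :=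
  (split m).apply_symm_apply _

@[simp] theorem split_sumAssoc (m : Fin n → ℕ) (l : ∀ i, Fin (m i) → ℕ) (k) :
    split (fun i => ∑ j, l i j) (sumAssoc m l k) =
      ⟨(split m (split (concat l) k).1).1, (split (l (split m (split (concat l) k).1).1)).symm
        ⟨(split m (split (concat l) k).1).2, (split (concat l) k).2⟩⟩ :=
  (split _).apply_symm_apply _

theorem concat_sumAssoc {A : Type*} {m : Fin n → ℕ} {l : ∀ i, Fin (m i) → ℕ}
    (w : ∀ i j, Fin (l i j) → A) (k : Fin (∑ p : Fin (∑ i, m i), concat l p)) :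
    concat (fun p => w (split m p).1 (split m p).2) k =
      concat (fun i => concat (w i)) (sumAssoc m l k) := by
  refine Eq.trans ?_ (congrArg (fun p : Σ i, Fin (∑ j, l i j) => concat (w p.1) p.2)
    (split_sumAssoc m l k)).symm
  exact (congrArg (fun p : Σ j, Fin (l (split m (split (concat l) k).1).1 j) =>
    w (split m (split (concat l) k).1).1 p.1 p.2) ((split _).apply_symm_apply
      ⟨(split m (split (concat l) k).1).2, (split (concat l) k).2⟩)).symm

theorem concat_sumPerm {A : Type*} {m m' : Fin n → ℕ} (σ : ∀ i, Fin (m' i) ≃ Fin (m i))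
    {z' : ∀ i, Fin (m' i) → A} {z : ∀ i, Fin (m i) → A} (h : ∀ i j, z' i j = z i (σ i j)) (k) :
    concat z' k = concat z (sumPerm σ k) :=
  (h _ _).trans
    (congrArg (fun p : Σ i, Fin (m i) => z p.1 p.2) (split_sumPerm σ k)).symm

theorem concat_blockPerm {A : Type*} (σ : Fin n' ≃ Fin n) {m : Fin n → ℕ}
    (z : ∀ i, Fin (m i) → A) (k) :
    concat (fun i => z (σ i)) k = concat z (blockPerm σ m k) :=
  (congrArg (fun p : Σ i, Fin (m i) => z p.1 p.2) (split_blockPerm σ m k)).symm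

theorem concat_sumOne {A : Type*} (x : Fin n → A) (k) :
    concat (fun _ : Fin 1 => x) k = x (sumOne n k) := rfl

theorem concat_sumOnes {A : Type*} (x : Fin n → A) (k) :
    concat (fun i (_ : Fin 1) => x i) k = x (sumOnes n k) := rfl

end

/-- A symmetric multicategory with category of objects `C`. The action of permutations is given
for bijections `Fin n' ≃ Fin n` (which exist only if `n' = n`) so that it also transports arrows
along equalities of lists of objects. -/
structure SymMulticat (C : Type u) [Category.{v} C] where
  /-- arrows with a given list of sources and a given target -/
  Hom : ∀ {n : ℕ}, (Fin n → C) → C → Type w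
  /-- the unary arrow given by a morphism between objects -/
  ι : ∀ {x y : C}, (x ⟶ y) → Hom (fun _ : Fin 1 => x) y
  comp : ∀ {n : ℕ} {x : Fin n → C} {y : C} {m : Fin n → ℕ} {z : ∀ i, Fin (m i) → C},
    Hom x y → (∀ i, Hom (z i) (x i)) → Hom (concat z) y
  act : ∀ {n n' : ℕ} {x : Fin n → C} {x' : Fin n' → C} {y : C} (σ : Fin n' ≃ Fin n),
    (∀ i, x' i = x (σ i)) → Hom x y → Hom x' y
  act_refl : ∀ {n : ℕ} {x : Fin n → C} {y : C} (f : Hom x y),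
    act (Equiv.refl _) (fun _ => rfl) f = f
  act_act : ∀ {n n' n'' : ℕ} {x : Fin n → C} {x' : Fin n' → C} {x'' : Fin n'' → C} {y : C}
    (σ : Fin n' ≃ Fin n) (τ : Fin n'' ≃ Fin n') (h : ∀ i, x' i = x (σ i))
    (h' : ∀ i, x'' i = x' (τ i)) (f : Hom x y),
    act τ h' (act σ h f) = act (τ.trans σ) (fun i => (h' i).trans (h _)) f
  id_comp : ∀ {n : ℕ} {x : Fin n → C} {y : C} (f : Hom x y),
    comp (ι (𝟙 y)) (fun _ => f) = act (sumOne n) (concat_sumOne x) f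
  comp_id : ∀ {n : ℕ} {x : Fin n → C} {y : C} (f : Hom x y),
    comp f (fun i => ι (𝟙 (x i))) = act (sumOnes n) (concat_sumOnes x) f
  assoc : ∀ {n : ℕ} {x : Fin n → C} {y : C} {m : Fin n → ℕ} {z : ∀ i, Fin (m i) → C}
    {l : ∀ i, Fin (m i) → ℕ} {w : ∀ i j, Fin (l i j) → C} (f : Hom x y)
    (g : ∀ i, Hom (z i) (x i)) (h : ∀ i j, Hom (w i j) (z i j)),
    comp (comp f g) (fun p => h (split m p).1 (split m p).2) =
      act (sumAssoc m l) (concat_sumAssoc w) (comp f fun i => comp (g i) (h i))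
  comp_act : ∀ {n : ℕ} {x : Fin n → C} {y : C} {m m' : Fin n → ℕ} {z : ∀ i, Fin (m i) → C}
    {z' : ∀ i, Fin (m' i) → C} (f : Hom x y) (g : ∀ i, Hom (z i) (x i))
    (σ : ∀ i, Fin (m' i) ≃ Fin (m i)) (h : ∀ i j, z' i j = z i (σ i j)),
    comp f (fun i => act (σ i) (h i) (g i)) = act (sumPerm σ) (concat_sumPerm σ h) (comp f g)
  act_comp : ∀ {n n' : ℕ} {x : Fin n → C} {y : C} {m : Fin n → ℕ} {z : ∀ i, Fin (m i) → C}
    (f : Hom x y) (g : ∀ i, Hom (z i) (x i)) (σ : Fin n' ≃ Fin n),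
    comp (act (x' := fun i => x (σ i)) σ (fun _ => rfl) f) (fun i => g (σ i)) =
      act (blockPerm σ m) (concat_blockPerm σ z) (comp f g)
  ι_comp : ∀ {x y z : C} (f : x ⟶ y) (g : y ⟶ z),
    comp (ι g) (fun _ => ι f) = act (sumOne 1) (concat_sumOne _) (ι (f ≫ g))

namespace SymMulticat
variable {C : Type u} [Category.{v} C] (Q : SymMulticat.{w} C)

/-- `ι(h) ∘ f` -/
def post {n : ℕ} {x : Fin n → C} {y y' : C} (h : y ⟶ y') (f : Q.Hom x y) : Q.Hom x y' :=
  Q.act (sumOne n).symm (by simp [concat]) (Q.comp (Q.ι h) fun _ => f)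

/-- `f ∘ (ι(t₁), …, ι(tₙ))` -/
def pre {n : ℕ} {x x' : Fin n → C} {y : C} (t : ∀ i, x' i ⟶ x i) (f : Q.Hom x y) : Q.Hom x' y :=
  Q.act (sumOnes n).symm (by simp [concat]) (Q.comp f fun i => Q.ι (t i))

variable {Q}

theorem act_congr {n n' : ℕ} {x : Fin n → C} {x' : Fin n' → C} {y : C} {σ σ' : Fin n' ≃ Fin n}
    {h : ∀ i, x' i = x (σ i)} {h' : ∀ i, x' i = x (σ' i)} (f : Q.Hom x y) (e : ∀ i, σ i = σ' i) :
    Q.act σ h f = Q.act σ' h' f := by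
  obtain rfl : σ = σ' := Equiv.ext e
  rfl

theorem act_eq_self {n : ℕ} {x : Fin n → C} {y : C} {σ : Fin n ≃ Fin n}
    {h : ∀ i, x i = x (σ i)} (f : Q.Hom x y) (e : ∀ i, σ i = i) : Q.act σ h f = f :=
  (act_congr (σ' := Equiv.refl _) (h' := fun _ => rfl) f e).trans (Q.act_refl f)

theorem act_inj {n n' : ℕ} {x : Fin n → C} {x' : Fin n' → C} {y : C} {σ σ' : Fin n' ≃ Fin n}
    {h : ∀ i, x' i = x (σ i)} {h' : ∀ i, x' i = x (σ' i)} {f f' : Q.Hom x y}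
    (H : Q.act σ h f = Q.act σ' h' f') (e : ∀ i, σ i = σ' i) : f = f' := by
  obtain rfl : σ = σ' := Equiv.ext e
  have := congrArg (Q.act (x' := x) σ.symm fun i => by simp [h]) H
  rw [Q.act_act, Q.act_act, act_eq_self _ (by simp), act_eq_self _ (by simp)] at this
  exact this

theorem comp_ι {n : ℕ} {x : Fin n → C} {y y' : C} (h : y ⟶ y') (f : Q.Hom x y) :
    Q.comp (Q.ι h) (fun _ => f) = Q.act (sumOne n) (concat_sumOne x) (Q.post h f) := by
  unfold post
  rw [Q.act_act]
  exact (act_eq_self _ (by simp)).symm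

theorem ι_comp' {n : ℕ} {x x' : Fin n → C} {y : C} (t : ∀ i, x' i ⟶ x i) (f : Q.Hom x y) :
    Q.comp f (fun i => Q.ι (t i)) = Q.act (sumOnes n) (concat_sumOnes x') (Q.pre t f) := by
  unfold pre
  rw [Q.act_act]
  exact (act_eq_self _ (by simp)).symm

theorem post_id {n : ℕ} {x : Fin n → C} {y : C} (f : Q.Hom x y) : Q.post (𝟙 y) f = f := by
  unfold post
  rw [Q.id_comp, Q.act_act]
  exact act_eq_self _ (by simp)

theorem pre_id {n : ℕ} {x : Fin n → C} {y : C} (f : Q.Hom x y) :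
    Q.pre (fun i => 𝟙 (x i)) f = f := by
  unfold pre
  rw [Q.comp_id, Q.act_act]
  exact act_eq_self _ (by simp)

theorem post_ι {x y z : C} (f : x ⟶ y) (g : y ⟶ z) : Q.post g (Q.ι f) = Q.ι (f ≫ g) := by
  unfold post
  rw [Q.ι_comp, Q.act_act]
  exact act_eq_self _ (by simp)

theorem act_post {n n' : ℕ} {x : Fin n → C} {x' : Fin n' → C} {y y' : C} (σ : Fin n' ≃ Fin n)
    (hσ : ∀ i, x' i = x (σ i)) (h : y ⟶ y') (f : Q.Hom x y) :
    Q.act σ hσ (Q.post h f) = Q.post h (Q.act σ hσ f) := by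
  unfold post
  rw [Q.comp_act (Q.ι h) (fun _ => f) (fun _ => σ) (fun _ => hσ), Q.act_act, Q.act_act]
  refine act_congr _ fun i => (split _).injective ?_
  simp

theorem act_pre {n n' : ℕ} {x x₁ : Fin n → C} {x₁' : Fin n' → C} {y : C} (σ : Fin n' ≃ Fin n)
    (hσ : ∀ i, x₁' i = x₁ (σ i)) (t : ∀ i, x₁ i ⟶ x i) (f : Q.Hom x y) :
    Q.act σ hσ (Q.pre t f) =
      Q.pre (x := fun i => x (σ i)) (fun i => eqToHom (hσ i) ≫ t (σ i))
        (Q.act σ (fun _ => rfl) f) := by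
  obtain rfl : x₁' = fun i => x₁ (σ i) := funext hσ
  simp only [eqToHom_refl, Category.id_comp]
  unfold pre
  rw [Q.act_comp f (fun i => Q.ι (t i)) σ, Q.act_act, Q.act_act]
  refine act_congr _ fun i => (split _).injective ?_
  simp

theorem post_comp {n : ℕ} {x : Fin n → C} {y y' : C} {m : Fin n → ℕ} {z : ∀ i, Fin (m i) → C}
    (h : y ⟶ y') (f : Q.Hom x y) (g : ∀ i, Q.Hom (z i) (x i)) :
    Q.comp (Q.post h f) g = Q.post h (Q.comp f g) := by
  have h1 := Q.assoc (Q.ι h) (fun _ : Fin 1 => f) (fun _ => g)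
  have h2 := congrArg (fun q => Q.comp q fun p => g (sumOne n p)) (comp_ι h f)
  have h3 := Q.act_comp (Q.post h f) g (sumOne n)
  have h4 := h3.symm.trans (h2.symm.trans h1)
  have h5 := congrArg (Q.act (sumAssoc (fun _ : Fin 1 => n) fun _ => m)
    (concat_sumAssoc fun _ : Fin 1 => z)) (comp_ι h (Q.comp f g))
  have h6 := h4.trans (h5.trans (Q.act_act _ _ _ _ _))
  refine act_inj h6 fun k => (split _).injective ?_
  rw [split_blockPerm]
  have h7 : sumOne (∑ j, m j) (sumAssoc (fun _ : Fin 1 => n) (fun _ => m) k) =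
      (split m).symm ⟨(split (fun _ : Fin 1 => n) (split (concat fun _ : Fin 1 => m) k).1).2,
        (split (concat fun _ : Fin 1 => m) k).2⟩ :=
    sumOne_of_split (n := ∑ j, m j) (split_sumAssoc (fun _ : Fin 1 => n) (fun _ => m) k)
  have h8 : split m (sumOne (∑ j, m j) (sumAssoc (fun _ : Fin 1 => n) (fun _ => m) k)) = _ :=
    (congrArg (split m) h7).trans ((split m).apply_symm_apply _)
  have h9 := congrArg (split m) (Equiv.trans_apply (sumAssoc (fun _ : Fin 1 => n) fun _ => m)
    (sumOne (∑ j, m j)) k)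
  exact h8.symm.trans h9.symm

/-- Any family over the source of a bijection is a reindexing of a family over the target. -/
theorem exists_pull {α β : Type} (e : α ≃ β) {P : β → Sort*} (u : ∀ a, P (e a)) :
    ∃ t : ∀ b, P b, u = fun a => t (e a) := by
  refine ⟨fun b => cast (congrArg P (e.apply_symm_apply b)) (u (e.symm b)), funext fun a => ?_⟩
  refine eq_of_heq (HEq.trans ?_ (cast_heq _ _).symm)
  rw [e.symm_apply_apply]

theorem post_post {n : ℕ} {x : Fin n → C} {y y' y'' : C} (h : y ⟶ y') (h' : y' ⟶ y'')
    (f : Q.Hom x y) : Q.post h' (Q.post h f) = Q.post (h ≫ h') f := by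
  have h1 := post_comp h' (Q.ι h) (fun _ => f)
  rw [post_ι, comp_ι h f, comp_ι (h ≫ h') f, ← act_post] at h1
  exact (act_inj h1 fun _ => rfl).symm

theorem pre_post {n : ℕ} {x x' : Fin n → C} {y y' : C} (t : ∀ i, x' i ⟶ x i) (h : y ⟶ y')
    (f : Q.Hom x y) : Q.pre t (Q.post h f) = Q.post h (Q.pre t f) := by
  have h1 := post_comp h f (fun i => Q.ι (t i))
  rw [ι_comp', ι_comp', ← act_post] at h1
  exact act_inj h1 fun _ => rfl

theorem pre_pre {n : ℕ} {x x' x'' : Fin n → C} {y : C} (t : ∀ i, x' i ⟶ x i)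
    (t' : ∀ i, x'' i ⟶ x' i) (f : Q.Hom x y) :
    Q.pre t' (Q.pre t f) = Q.pre (fun i => t' i ≫ t i) f := by
  have h1 := Q.assoc f (fun i => Q.ι (t i)) (fun i _ => Q.ι (t' i))
  have h2 := congrArg (fun q => Q.comp q fun p => Q.ι (t' (sumOnes n p))) (ι_comp' t f)
  have h3 := Q.act_comp (Q.pre t f) (fun i => Q.ι (t' i)) (sumOnes n)
  have h4 := congrArg (Q.act (blockPerm (sumOnes n) fun _ => 1)
    (concat_blockPerm (sumOnes n) fun i (_ : Fin 1) => x'' i)) (ι_comp' t' (Q.pre t f))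
  have h5 : (Q.comp f fun i => Q.comp (Q.ι (t i)) fun _ => Q.ι (t' i)) = _ :=
    (congrArg (Q.comp f) (funext fun i => Q.ι_comp (t' i) (t i))).trans
    (Q.comp_act f (fun i => Q.ι (t' i ≫ t i)) (fun _ => sumOne 1) fun i => concat_sumOne _)
  have h6 := congrArg (Q.act (sumPerm fun _ : Fin n => sumOne 1)
    (concat_sumPerm _ fun i => concat_sumOne _)) (ι_comp' (fun i => t' i ≫ t i) f)
  have h7 := (Q.act_act _ _ _ _ _).symm.trans (h4.symm.trans (h3.symm.trans (h2.symm.trans (h1.trans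
    ((congrArg _ (h5.trans (h6.trans (Q.act_act _ _ _ _ _)))).trans (Q.act_act _ _ _ _ _))))))
  refine act_inj h7 fun k => ?_
  have e1 := sumOnes_of_split (split_blockPerm (sumOnes n) (fun _ => 1) k)
  have e2 := sumOnes_of_split (split_sumPerm (fun _ : Fin n => sumOne 1)
    (sumAssoc (fun _ : Fin n => 1) (fun _ _ => 1) k))
  refine e1.trans (Eq.trans ?_ e2.symm)
  exact (congrArg Sigma.fst (split_sumAssoc (fun _ : Fin n => 1) (fun _ _ => 1) k)).symm
end SymMulticat
open SignedSet Linking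

section
variable {C : Type u} [Category.{v} C] {D : Type u'} [Category.{v'} D]

/-- The objects of the category of elements of a symmetric multicategory: its arrows -/
structure Elt (Q : SymMulticat.{w} C) where
  arity : ℕ
  src : Fin arity → C
  tgt : C
  arrow : Q.Hom src tgt

namespace Elt
variable {Q : SymMulticat.{w} C}

/-- Morphisms `f ⟶ g` of the category of elements: a bijection between the sources, morphisms from the
sources of `g` to those of `f` and from the target of `f` to the target of `g`, which take the arrow
of `f` to that of `g` -/
@[ext] structure Mor (f g : Elt Q) where
  perm : Fin g.arity ≃ Fin f.arity
  src : ∀ i, g.src i ⟶ f.src (perm i)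
  tgt : f.tgt ⟶ g.tgt
  comm : g.arrow = Q.post tgt (Q.pre src (Q.act perm (fun _ => rfl) f.arrow))

/-- The category of elements of a symmetric multicategory -/
instance : Category (Elt Q) where
  Hom := Mor
  id f := ⟨Equiv.refl _, fun i => 𝟙 _, 𝟙 _, by
    rw [SymMulticat.post_id]
    exact ((congrArg (Q.pre fun i => 𝟙 (f.src i)) (Q.act_refl f.arrow)).trans
      (SymMulticat.pre_id _)).symm⟩
  comp {f g h} m m' := ⟨m'.perm.trans m.perm, fun i => m'.src i ≫ m.src (m'.perm i),
    m.tgt ≫ m'.tgt, by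
      refine m'.comm.trans ?_
      have h1 := congrArg (Q.act m'.perm fun _ => rfl) m.comm
      rw [SymMulticat.act_post, SymMulticat.act_pre] at h1
      simp only [eqToHom_refl, Category.id_comp] at h1
      rw [Q.act_act] at h1
      rw [h1, SymMulticat.pre_post, SymMulticat.post_post, SymMulticat.pre_pre]
      rfl⟩
  id_comp m := Mor.ext rfl (heq_of_eq (funext fun i => Category.comp_id _)) (Category.id_comp _)
  comp_id m := Mor.ext rfl (heq_of_eq (funext fun i => Category.id_comp _)) (Category.comp_id _)
  assoc m m' m'' := Mor.ext rfl (heq_of_eq (funext fun i => (Category.assoc _ _ _).symm))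
    (Category.assoc _ _ _)

end Elt

/-! ### Iterated tensor products -/

namespace LShape

/-- `x₁ ⊗ (x₂ ⊗ (⋯ ⊗ xₙ))`, which is `I` for `n = 0` and `x₁` for `n = 1` -/
def tens : {n : ℕ} → (Fin n → LShape C) → LShape C
  | 0, _ => unit C
  | 1, x => x 0
  | _ + 2, x => (x 0).tensor (tens fun i => x i.succ)

def tensVar : {n : ℕ} → (x : Fin n → LShape C) → (tens x).shape.Var → Σ i, (x i).shape.Var
  | 0, _, a => a.elim
  | 1, _, a => ⟨0, a⟩
  | _ + 2, x, a => Sum.elim (fun a : (x 0).shape.Var => ⟨0, a⟩)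
      (fun a => ⟨(tensVar (fun i => x i.succ) a).1.succ, (tensVar (fun i => x i.succ) a).2⟩) a

def succEquiv (n : ℕ) : Unit ⊕ Fin n ≃ Fin (n + 1) :=
  ⟨Sum.elim (fun _ => 0) Fin.succ, Fin.cases (.inl ()) .inr,
    by rintro (a | a) <;> simp, Fin.cases rfl fun _ => rfl⟩

theorem tensorOf_tens : {n : ℕ} → (x : Fin n → LShape C) →
    TensorOf (fun i => (x i).shape) (tens x).shape (tensVar x)
  | 0, x => .unit _ (fun i => i.elim0) _
  | 1, x => .atom (fun i => (x i).shape) 0 fun j => Subsingleton.elim _ _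
  | n + 2, x => .tensor (succEquiv (n + 1)) (fun i => (x i).shape)
      (.atom (fun _ : Unit => (x 0).shape) () fun j => rfl) (tensorOf_tens fun i => x i.succ)

theorem tensVar_label : {n : ℕ} → (x : Fin n → LShape C) → (a : (tens x).shape.Var) →
    (x (tensVar x a).1).label (tensVar x a).2 = (tens x).label a
  | 0, _, a => a.elim
  | 1, _, a => rfl
  | _ + 2, x, .inl a => rfl
  | _ + 2, x, .inr a => tensVar_label (fun i => x i.succ) a

noncomputable def tensIso {n : ℕ} (x : Fin n → LShape C) :
    SIso (tens x).signed (SignedSet.sigma fun i => (x i).signed) :=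
  ⟨Equiv.ofBijective _ (tensorOf_tens x).bijective, (tensorOf_tens x).sign, tensVar_label x⟩

theorem bind_tens {n : ℕ} (x : Fin n → LShape (LShape D)) :
    (tens x).bind = tens fun i => (x i).bind := by
  induction n using Nat.strong_induction_on with
  | _ n ih =>
    match n, x with
    | 0, x =>
      change LShape.mk _ _ = LShape.mk _ _
      congr 1
      funext a; exact a.elim
    | 1, x => rfl
    | n + 2, x =>
      have h := ih (n + 1) (by omega) fun i => x i.succ
      change _ = LShape.tensor _ _
      rw [← h]
      change LShape.mk _ _ = LShape.mk _ _
      congr 1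
      funext a; rcases a with a | a <;> rfl

theorem bind_hom (α β : LShape (LShape D)) : (α.hom β).bind = α.bind.hom β.bind := by
  change LShape.mk _ _ = LShape.mk _ _
  congr 1
  funext a; rcases a with a | a <;> rfl

/-- `[⊗ₖ xₖ, y]` for objects `xₖ` and `y` -/
def arrow {n : ℕ} (x : Fin n → C) (y : C) : LShape C := (tens fun i => of (x i)).hom (of y)

theorem relabel_tens (F : C ⥤ D) {n : ℕ} (x : Fin n → LShape C) :
    (relabel F).obj (tens x) = tens fun i => (relabel F).obj (x i) := by
  induction n using Nat.strong_induction_on with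
  | _ n ih =>
    match n, x with
    | 0, x =>
      change LShape.mk _ _ = LShape.mk _ _
      congr 1
      funext a; exact a.elim
    | 1, x => rfl
    | n + 2, x =>
      have h := ih (n + 1) (by omega) fun i => x i.succ
      change _ = LShape.tensor _ _
      rw [← h]
      change LShape.mk _ _ = LShape.mk _ _
      congr 1
      funext a; rcases a with a | a <;> rfl

theorem relabel_hom (F : C ⥤ D) (α β : LShape C) :
    (relabel F).obj (α.hom β) = ((relabel F).obj α).hom ((relabel F).obj β) := by
  change LShape.mk _ _ = LShape.mk _ _
  congr 1
  funext a; rcases a with a | a <;> rfl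

/-- `A F` takes `[⊗ₖ xₖ, y]` to `[⊗ₖ F xₖ, F y]`. -/
theorem Amap_arrow (F : C ⥤ LShape D) {n : ℕ} (x : Fin n → C) (y : C) :
    (Amap F).obj (arrow x y) = (tens fun i => F.obj (x i)).hom (F.obj y) := by
  change bind ((relabel F).obj ((tens fun i => of (x i)).hom (of y))) = _
  rw [relabel_hom, bind_hom, relabel_tens, bind_tens]
  rfl

end LShape
end
open SignedSet Linking

namespace TensorOf

theorem reindex_aux {ι κ : Type} {x' : ι → Shape} {T : Shape} {f : T.Var → Σ i, (x' i).Var}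
    (h : TensorOf x' T f) (e : ι ≃ κ) (x : κ → Shape) (hx : x' = fun i => x (e i))
    (f' : T.Var → Σ i, (x i).Var)
    (hf : ∀ a, f' a = ⟨e (f a).1, cast (congrArg Shape.Var (congrFun hx (f a).1)) (f a).2⟩) : TensorOf x T f' := by
  cases h with
  | unit x' h f => exact .unit x (fun k => h (e.symm k)) f'
  | atom x' i h =>
    subst hx
    obtain rfl : f' = fun a => ⟨e i, a⟩ := funext fun a => hf a
    exact .atom x (e i) fun k => by
      rw [← h (e.symm k), e.apply_symm_apply]
  | tensor ε x' h1 h2 =>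
    subst hx
    obtain rfl : f' = _ := funext fun a => hf a
    have := TensorOf.tensor (ε.trans e) x h1 h2
    refine (congrArg (TensorOf _ _) (funext fun a => ?_)).mp this
    rcases a with a | a <;> rfl

theorem reindex {ι κ : Type} {T : Shape} (e : ι ≃ κ) (x : κ → Shape)
    {f : T.Var → Σ i, (x (e i)).Var} (h : TensorOf (fun i => x (e i)) T f) :
    TensorOf x T fun a => ⟨e (f a).1, (f a).2⟩ :=
  h.reindex_aux e x rfl _ fun _ => rfl

theorem nested {ι : Type} {x : ι → Shape} {T : Shape} {f : T.Var → Σ i, (x i).Var}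
    (h : TensorOf x T f) : ∀ {κ : ι → Type} (z : ∀ i, κ i → Shape)
    (g : ∀ i, (x i).Var → Σ k, (z i k).Var) (_ : ∀ i, TensorOf (z i) (x i) (g i)),
    TensorOf (fun p : Σ i, κ i => z p.1 p.2) T
      fun a => ⟨⟨(f a).1, (g _ (f a).2).1⟩, (g _ (f a).2).2⟩ := by
  induction h with
  | unit x h f => intro κ z g hg; exact .unit _ (fun p => h p.1) _
  | @atom ι x i h =>
    intro κ z g hg
    let e : κ i ≃ Σ j, κ j := Equiv.ofBijective (fun k => ⟨i, k⟩)
      ⟨fun a b hab => by simpa using hab, fun ⟨j, k⟩ => by obtain rfl := h j; exact ⟨k, rfl⟩⟩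
    exact TensorOf.reindex e (fun p : Σ i, κ i => z p.1 p.2) (hg i)
  | @tensor ι κ' μ ε x T S f g' h1 h2 ih1 ih2 =>
    intro κ z g hg
    have t1 := ih1 (fun i => z (ε (.inl i))) (fun i => g _) fun i => hg _
    have t2 := ih2 (fun i => z (ε (.inr i))) (fun i => g _) fun i => hg _
    have := TensorOf.tensor ((Equiv.sumSigmaDistrib fun a => κ (ε a)).symm.trans
      (Equiv.sigmaCongrLeft ε)) (fun p : Σ i, κ i => z p.1 p.2) t1 t2
    refine (congrArg (TensorOf _ _) (funext fun a => ?_)).mp this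
    rcases a with a | a <;> rfl

end TensorOf

section
variable {C : Type u} [Category.{v} C]

/-! ### Identities between graphs -/

namespace SIso
variable {X Y : SignedSet C}

def ofEq (h : X = Y) : SIso X Y := h ▸ refl X

theorem ofEq_heq (h : X = Y) (a : X.Var) : HEq ((ofEq h).e a) a := by subst h; rfl

/-- Relabelling of a disjoint union along a bijection of the indices -/
def reindex {ι κ : Type} [Finite ι] [Finite κ] (e : ι ≃ κ) (Y : κ → SignedSet C) :
    SIso (SignedSet.sigma fun i => Y (e i)) (SignedSet.sigma Y) :=
  ⟨Equiv.sigmaCongrLeft (β := fun k => (Y k).Var) e, fun _ => rfl, fun _ => rfl⟩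

def sigmaAssoc {ι : Type} [Finite ι] {κ : ι → Type} [∀ i, Finite (κ i)]
    (X : ∀ i, κ i → SignedSet C) : SIso (SignedSet.sigma fun p : Σ i, κ i => X p.1 p.2)
      (SignedSet.sigma fun i => SignedSet.sigma (X i)) :=
  ⟨Equiv.sigmaAssoc fun i k => (X i k).Var, fun _ => rfl, fun _ => rfl⟩

/-- A disjoint union over a concatenation is a disjoint union of disjoint unions -/
def sigmaSplit {n : ℕ} {m : Fin n → ℕ} (X : ∀ i, Fin (m i) → SignedSet C) :
    SIso (SignedSet.sigma fun k => X (split m k).1 (split m k).2)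
      (SignedSet.sigma fun i => SignedSet.sigma (X i)) :=
  (reindex (split m) fun p : Σ i, Fin (m i) => X p.1 p.2).trans (sigmaAssoc X)

def sigmaOne (X : SignedSet C) : SIso (SignedSet.sigma fun _ : Fin 1 => X) X :=
  ⟨Equiv.uniqueSigma fun _ => X.Var, fun ⟨i, a⟩ => by obtain rfl := Subsingleton.elim i 0; rfl,
    fun ⟨i, a⟩ => by obtain rfl := Subsingleton.elim i 0; rfl⟩

theorem sigmaOne_apply (X : SignedSet C) (i : Fin 1) (a : X.Var) : (sigmaOne X).e ⟨i, a⟩ = a := by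
  obtain rfl := Subsingleton.elim i 0; rfl

end SIso

namespace Linking
variable {X Y Z W X' Y' Z' : SignedSet C}

theorem eq_of_hsits_imp {ξ ζ : X ⟶ Y}
    (H : ∀ (S : Sys C) i j, HSits ξ S i j → HSits ζ S i j) : ζ = ξ :=
  eq_of_hsits (H _ _ _ (hsits_self ξ))

theorem eq_comp {ξ : X ⟶ Y} {η : Y ⟶ Z} {ζ : X ⟶ Z}
    (H : ∀ (S : Sys C) i j k, HSits ξ S i j → HSits η S j k → HSits ζ S i k) : ζ = ξ ≫ η := by
  refine eq_of_sits (X := X.hom Z) (S := compSys ξ η) (i := embO _ _ _) ?_ comp_sits_compSys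
    embO_inj fun a ha => compSys_terminal a ha
  have h := H (compSys ξ η) (fun a => embL X Y Z (.inl a)) (fun a => embL X Y Z (.inr a))
    (fun a => embR X Y Z (.inr a)) (left_sits_compSys.congr fun a => by rcases a with a | a <;> rfl)
    (right_sits_compSys.congr fun a => by rcases a with a | a <;> rfl)
  exact Sits.congr h fun a => by rcases a with a | a <;> rfl

theorem ofSIso_comp (e : SIso X Y) (ξ : Y ⟶ Z) :
    ofSIso e ≫ ξ = conj e.symm (SIso.refl Z) ξ := by
  rw [conj_eq, ofSIso_refl, Category.comp_id]
  rfl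

theorem comp_ofSIso (ξ : X ⟶ Y) (e : SIso Y Z) :
    ξ ≫ ofSIso e = conj (SIso.refl X) e ξ := by
  rw [conj_eq]
  change _ = ofSIso (SIso.refl X) ≫ _
  rw [ofSIso_refl, Category.id_comp]

theorem hsits_ofSIso_comp {e : SIso X Y} {ξ : Y ⟶ Z} {S : Sys C} {i : Y.Var → S.V} {j} :
    HSits (ofSIso e ≫ ξ) S (fun a => i (e.e a)) j ↔ HSits ξ S i j := by
  rw [ofSIso_comp, hsits_conj]
  have : (fun a => i (e.e (e.symm.e a))) = i := funext fun a =>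
    congrArg i (e.e.apply_symm_apply a)
  rw [this]
  rfl

theorem hsits_comp_ofSIso {e : SIso Y Z} {ξ : X ⟶ Y} {S : Sys C} {i} {j : Z.Var → S.V} :
    HSits (ξ ≫ ofSIso e) S i j ↔ HSits ξ S i (fun a => j (e.e a)) := by
  rw [comp_ofSIso, hsits_conj]
  rfl

theorem exists_precomp (e : SIso X Y) {V : Type} (i : X.Var → V) :
    ∃ i' : Y.Var → V, i = fun a => i' (e.e a) :=
  ⟨fun a => i (e.e.symm a), funext fun a => congrArg i (e.e.symm_apply_apply a).symm⟩

section Sigma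
variable {ι κ : Type} [Finite ι] [Finite κ]

theorem sigmaMap_comp {X Y Z : ι → SignedSet C} (ξ : ∀ i, X i ⟶ Y i) (η : ∀ i, Y i ⟶ Z i) :
    sigmaMap (fun i => ξ i ≫ η i) = sigmaMap ξ ≫ sigmaMap η :=
  eq_comp fun S i j k h h' => hsits_sigmaMap.2 fun a =>
    (hsits_sigmaMap.1 h a).comp (hsits_sigmaMap.1 h' a)

theorem sigmaMap_ofSIso {X Y : ι → SignedSet C} (e : ∀ i, SIso (X i) (Y i)) :
    sigmaMap (fun i => ofSIso (e i)) = ofSIso (SIso.sigma e) :=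
  eq_of_hsits_imp fun S i j h => hsits_sigmaMap.2 fun k =>
    hsits_ofSIso_iff.2 fun a => hsits_ofSIso_iff.1 h ⟨k, a⟩

theorem sigmaMap_reindex (e : ι ≃ κ) {X Y : κ → SignedSet C} (ξ : ∀ k, X k ⟶ Y k) :
    sigmaMap (fun i => ξ (e i)) ≫ ofSIso (SIso.reindex e Y) =
      ofSIso (SIso.reindex e X) ≫ sigmaMap ξ := by
  refine eq_of_hsits_imp fun S i j h => hsits_comp_ofSIso.2 (hsits_sigmaMap.2 fun a => ?_)
  obtain ⟨i, rfl⟩ := exists_precomp (SIso.reindex e X) i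
  exact hsits_sigmaMap.1 (hsits_ofSIso_comp.1 h) (e a)

theorem sigmaMap_split {n : ℕ} {m : Fin n → ℕ} {X Y : ∀ i, Fin (m i) → SignedSet C}
    (ξ : ∀ i j, X i j ⟶ Y i j) :
    sigmaMap (fun k => ξ (split m k).1 (split m k).2) ≫ ofSIso (SIso.sigmaSplit Y) =
      ofSIso (SIso.sigmaSplit X) ≫ sigmaMap fun i => sigmaMap (ξ i) := by
  refine eq_of_hsits_imp fun S i j h => hsits_comp_ofSIso.2 (hsits_sigmaMap.2 fun a => ?_)
  obtain ⟨i, rfl⟩ := exists_precomp (SIso.sigmaSplit X) i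
  exact hsits_sigmaMap.1 (hsits_sigmaMap.1 (hsits_ofSIso_comp.1 h) _) _

theorem sigmaMap_one (ξ : X ⟶ Y) :
    sigmaMap (fun _ : Fin 1 => ξ) ≫ ofSIso (SIso.sigmaOne Y) = ofSIso (SIso.sigmaOne X) ≫ ξ := by
  refine eq_of_hsits_imp fun S i j h => hsits_comp_ofSIso.2 (hsits_sigmaMap.2 fun a => ?_)
  obtain ⟨i, rfl⟩ := exists_precomp (SIso.sigmaOne X) i
  refine (hsits_ofSIso_comp.1 h).congr (fun b => ?_) (fun b => ?_)
  · exact congrArg i (SIso.sigmaOne_apply X a b).symm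
  · exact congrArg j (SIso.sigmaOne_apply Y a b).symm

theorem conj_ofSIso (e : SIso X X') (f : SIso Y Y') (g : SIso X Y) :
    conj e f (ofSIso g) = ofSIso (e.symm.trans (g.trans f)) := by
  rw [conj_eq, ofSIso_trans, ofSIso_trans]

theorem conj_conj (e : SIso X X') (e' : SIso X' Z) (f : SIso Y Y') (f' : SIso Y' Z') (ξ : X ⟶ Y) :
    conj e' f' (conj e f ξ) = conj (e.trans e') (f.trans f') ξ :=
  eq_of_hsits_imp fun S i j h => by
    rw [hsits_conj, hsits_conj]
    exact hsits_conj.1 h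

end Sigma

inductive WireRel {c d : C} (t : c ⟶ d) :
    Unit ⊕ Unit → Unit ⊕ Unit → ∀ {c' d' : C}, (c' ⟶ d') → Prop
  | mk : WireRel t (.inl ()) (.inr ()) t

/-- The graph with a single edge -/
def wire {c d : C} (t : c ⟶ d) : SignedSet.single c ⟶ SignedSet.single d :=
  ofRel (X := (SignedSet.single c).hom (SignedSet.single d)) (WireRel t)
    (fun r => by cases r; exact ⟨rfl, rfl⟩) (fun r => by cases r; rfl) (fun r => by cases r; rfl)
    (fun a ha => by
      rcases a with a | a
      · exact ⟨_, _, _, _, .mk⟩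
      · cases ha)
    (fun a ha => by
      rcases a with a | a
      · cases ha
      · exact ⟨_, _, _, _, .mk⟩)
    (fun r r' => by cases r; cases r'; exact ⟨rfl, HEq.rfl⟩)
    (fun r r' => by cases r; cases r'; rfl)

theorem hsits_wire {c d : C} {t : c ⟶ d} {S : Sys C} {i j} :
    HSits (wire t) S i j ↔ S.Path (i ()) (j ()) t := by
  constructor
  · intro h
    exact Sits.path (X := (SignedSet.single c).hom (SignedSet.single d)) h (ofRel_Edge.2 .mk)
  · intro h
    refine Sits.of_edge (X := (SignedSet.single c).hom (SignedSet.single d)) ?_ fun r => ?_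
    · rintro (a | a)
      · exact (Sys.Path.lab h).1.symm
      · exact (Sys.Path.lab h).2.symm
    · cases ofRel_Edge.1 r with
      | mk => exact h

end Linking

/-! ### Allowability of labelled graphs between iterated tensor products -/

namespace LShape

theorem allow_wire {c d : C} (t : c ⟶ d) : Allow (α := of c) (β := of d) (wire t) := by
  unfold Allow
  have : 𝟙 Shape.one.signed = forgetHom (wire t) := by
    refine forgetHom_eq (ξ := wire t) (hsits_id_iff.2 fun a => ⟨lab_pt, lab_pt, fun _ => ?_,
      fun h => by cases h⟩)
    exact path_forget (hsits_wire.1 (hsits_self (wire t))) _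
  exact (congrArg (fun ζ => Allowable (T := .one) (S := .one) ζ) this).mp (.id .one)

variable {ι κ : Type} [Finite ι] [Finite κ] {α β γ : LShape C}

theorem allow_sigma {x y : ι → LShape C} {f g}
    (h : TensorOf (fun i => (x i).shape) α.shape f) (h' : TensorOf (fun i => (y i).shape) β.shape g)
    (eα : SIso α.signed (SignedSet.sigma fun i => (x i).signed))
    (eβ : SIso β.signed (SignedSet.sigma fun i => (y i).signed))
    (hα : ∀ a, eα.e a = f a) (hβ : ∀ a, eβ.e a = g a)
    (ξ : ∀ i, (x i).signed ⟶ (y i).signed) (hξ : ∀ i, Allow (ξ i)) :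
    Allow (α := α) (β := β) (conj eα.symm eβ.symm (sigmaMap ξ)) := by
  have H := TensorOf.sigmaMap_allowable h h' (fun i => forgetHom (ξ i)) hξ
  unfold Allow
  have : conj h.iso.symm h'.iso.symm (sigmaMap fun i => forgetHom (ξ i)) =
      forgetHom (conj eα.symm eβ.symm (sigmaMap ξ)) := by
    refine forgetHom_eq (ξ := conj eα.symm eβ.symm (sigmaMap ξ)) (hsits_conj.2
      (hsits_sigmaMap.2 fun k => ?_))
    have h1 := (hsits_sigmaMap.1 (hsits_conj.1 (hsits_self (conj eα.symm eβ.symm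
      (sigmaMap ξ)))) k).forget
    refine h1.congr (fun a => ?_) (fun a => ?_)
    · refine congrArg Sum.inl ((Equiv.symm_apply_eq _).2 ?_)
      rw [hα]
      exact (h.iso.e.apply_symm_apply _).symm
    · refine congrArg Sum.inr ((Equiv.symm_apply_eq _).2 ?_)
      rw [hβ]
      exact (h'.iso.e.apply_symm_apply _).symm
  exact (congrArg (fun ζ => Allowable (T := α.shape) (S := β.shape) ζ) this).mp H

theorem allow_ofSIso {x : ι → Shape} {f g} (h : TensorOf x α.shape f)
    (h' : TensorOf x β.shape g) (e : SIso α.signed β.signed) (H : ∀ a, g (e.e a) = f a) :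
    Allow (ofSIso e) :=
  .ofAI (h.ai h' e.forget H)

end LShape

/-! ### The frame functor -/

namespace Elt
variable {Q : SymMulticat.{w} C}

/-- The points of the frame of an arrow -/
abbrev fr (f : Elt Q) : SignedSet C :=
  (SignedSet.sigma fun i => SignedSet.single (f.src i)).hom (SignedSet.single f.tgt)

noncomputable def frIso (f : Elt Q) : SIso (LShape.arrow f.src f.tgt).signed f.fr :=
  (LShape.tensIso fun i => LShape.of (f.src i)).hom (SIso.refl (SignedSet.single f.tgt))

/-- the graph of `t₁, …, tₙ` preceded by a permutation -/
def srcMap {f g : Elt Q} (m : f ⟶ g) : SignedSet.sigma (fun i => SignedSet.single (g.src i)) ⟶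
    SignedSet.sigma fun i => SignedSet.single (f.src i) :=
  conj (SIso.refl _) (SIso.reindex m.perm fun i => SignedSet.single (f.src i))
    (sigmaMap fun i => wire (m.src i))

/-- The graph `fr f ⟶ fr g` given by a morphism `f ⟶ g` -/
def frMap {f g : Elt Q} (m : f ⟶ g) : f.fr ⟶ g.fr := homMap (srcMap m) (wire m.tgt)

theorem hsits_frMap {f g : Elt Q} {m : f ⟶ g} {S : Sys C} {i : f.fr.Var → S.V}
    {j : g.fr.Var → S.V} : HSits (frMap m) S i j ↔
      (∀ k, S.Path (j (.inl ⟨k, ()⟩)) (i (.inl ⟨m.perm k, ()⟩)) (m.src k)) ∧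
        S.Path (i (.inr ())) (j (.inr ())) m.tgt := by
  unfold frMap srcMap
  rw [hsits_homMap, hsits_conj, hsits_sigmaMap, hsits_wire]
  refine and_congr_left' (forall_congr' fun k => ?_)
  rw [hsits_wire]
  rfl

theorem frMap_id (f : Elt Q) : frMap (𝟙 f) = 𝟙 f.fr := by
  refine eq_of_hsits_imp fun S i j h => hsits_frMap.2 ?_
  have H := hsits_id_iff.1 h
  exact ⟨fun k => (H (.inl ⟨k, ()⟩)).2.2.2 rfl, (H (.inr ())).2.2.1 rfl⟩

theorem frMap_comp {f g h : Elt Q} (m : f ⟶ g) (m' : g ⟶ h) :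
    frMap (m ≫ m') = frMap m ≫ frMap m' := by
  refine eq_comp fun S i j k h h' => hsits_frMap.2 ?_
  have H := hsits_frMap.1 h
  have H' := hsits_frMap.1 h'
  exact ⟨fun k => (H'.1 k).trans (H.1 _), H.2.trans H'.2⟩

theorem frMap_allow {f g : Elt Q} (m : f ⟶ g) : LShape.Allow (α := .arrow f.src f.tgt)
    (β := .arrow g.src g.tgt) (conj f.frIso.symm g.frIso.symm (frMap m)) := by
  let A := LShape.tens fun i => LShape.of (f.src i)
  let B := LShape.tens fun i => LShape.of (g.src i)
  let A' := LShape.tens fun i => LShape.of (f.src (m.perm i))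
  let eA : SIso A.signed _ := LShape.tensIso fun i => LShape.of (f.src i)
  let eB : SIso B.signed _ := LShape.tensIso fun i => LShape.of (g.src i)
  let eA' : SIso A'.signed _ := LShape.tensIso fun i => LShape.of (f.src (m.perm i))
  have h1 : LShape.Allow (α := B) (β := A') (conj eB.symm eA'.symm
      (sigmaMap fun i => wire (m.src i))) :=
    LShape.allow_sigma (LShape.tensorOf_tens _) (LShape.tensorOf_tens _) eB eA' (fun _ => rfl)
      (fun _ => rfl) _ fun i => LShape.allow_wire _
  let r : SIso A'.signed A.signed :=
    eA'.trans ((SIso.reindex m.perm fun i => SignedSet.single (f.src i)).trans eA.symm)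
  have h2 : LShape.Allow (α := A') (β := A) (ofSIso r) := by
    refine LShape.allow_ofSIso (TensorOf.reindex m.perm (fun i => (LShape.of (f.src i)).shape)
      (LShape.tensorOf_tens fun i => LShape.of (f.src (m.perm i)))) (LShape.tensorOf_tens _)
      r fun a => ?_
    exact eA.e.apply_symm_apply _
  have h3 := LShape.Allow.hom (h1.comp h2) (LShape.allow_wire m.tgt)
  refine (congrArg (fun ζ => LShape.Allow (α := .arrow f.src f.tgt)
    (β := .arrow g.src g.tgt) ζ) ?_).mp h3
  rw [comp_ofSIso, conj_conj]
  refine eq_of_hsits_imp fun S i j h => ?_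
  have H := hsits_homMap.1 (hsits_conj.1 h)
  refine hsits_homMap.2 ⟨hsits_conj.2 ?_, H.2⟩
  have H1 := hsits_conj.1 H.1
  refine H1.congr (fun _ => rfl) fun a => ?_
  change i (Sum.inl (eA.e.symm _)) = i (Sum.inl (eA.e.symm _))
  refine congrArg (fun b => i (Sum.inl (eA.e.symm b))) ?_
  exact congrArg _ (eA'.e.apply_symm_apply a).symm

/-- The frame functor, which takes an arrow `x₁, …, xₙ ⟶ y` to `[x₁ ⊗ ⋯ ⊗ xₙ, y]` -/
noncomputable def frame (Q : SymMulticat.{w} C) : Elt Q ⥤ LShape C where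
  obj f := .arrow f.src f.tgt
  map {f g} m := ⟨conj f.frIso.symm g.frIso.symm (frMap m), frMap_allow m⟩
  map_id f := Subtype.ext ((congrArg _ (frMap_id f)).trans (conj_id _))
  map_comp {f g h} m m' := Subtype.ext ((congrArg _ (frMap_comp m m')).trans
    (conj_comp _ g.frIso.symm _ _ _))

end Elt
end
open SignedSet Linking

section
variable {C : Type u} [Category.{v} C] {Q : SymMulticat.{w} C}

/-! ### Composites of arrows in a configuration -/

/-- Composites in a system of wires: the nodes `n : ν` are arrows `fs n` with inputs
`i n (.inl ⟨a, ()⟩)` and output `i n (.inr ())`, and the leaves are numbered by `Fin l`.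
`Composite S fs i leaf v js q` says that the arrow `q`, whose sources are the labels of the leaves
`js 1, …, js k`, is a composite, with value at the point `v`, of nodes and edges. -/
inductive Composite (S : Sys C) {ν : Type} (fs : ν → Elt Q) (i : ∀ n, (fs n).fr.Var → S.V)
    {l : ℕ} (leaf : Fin l → S.V) :
    S.V → ∀ {k : ℕ}, (Fin k → Fin l) → ∀ {x : Fin k → C} {c : C}, Q.Hom x c → Prop
  | leaf (j : Fin l) {c : C} : S.lab (leaf j) = c →
      Composite S fs i leaf (leaf j) (fun _ : Fin 1 => j) (Q.ι (𝟙 c))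
  | node (n : ν) {m : Fin (fs n).arity → ℕ} {js : ∀ a, Fin (m a) → Fin l}
      {z : ∀ a, Fin (m a) → C} {q : ∀ a, Q.Hom (z a) ((fs n).src a)} :
      (∀ a, Composite S fs i leaf (i n (.inl ⟨a, ()⟩)) (js a) (q a)) →
      Composite S fs i leaf (i n (.inr ())) (concat js) (Q.comp (fs n).arrow q)
  | edge {v w : S.V} {c d : C} {h : c ⟶ d} {k : ℕ} {js : Fin k → Fin l} {x : Fin k → C}
      {q : Q.Hom x c} : S.step v w h → Composite S fs i leaf v js q →
      Composite S fs i leaf w js (Q.post h q)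
  | act {v : S.V} {k k' : ℕ} {js : Fin k → Fin l} {js' : Fin k' → Fin l} {x : Fin k → C}
      {x' : Fin k' → C} {c : C} {q : Q.Hom x c} (σ : Fin k' ≃ Fin k) (hj : ∀ a, js' a = js (σ a))
      (h : ∀ a, x' a = x (σ a)) : Composite S fs i leaf v js q →
      Composite S fs i leaf v js' (Q.act σ h q)

namespace Composite
variable {S S' : Sys C} {ν ν' : Type} {fs : ν → Elt Q} {i : ∀ n, (fs n).fr.Var → S.V}
  {fs' : ν' → Elt Q} {i' : ∀ n, (fs' n).fr.Var → S'.V}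
  {l l' : ℕ} {leaf : Fin l → S.V} {leaf' : Fin l → S'.V}

theorem path {v w : S.V} {c d : C} {h : c ⟶ d} (p : S.Path v w h) {k : ℕ} {js : Fin k → Fin l}
    {x : Fin k → C} {q : Q.Hom x c} (H : Composite S fs i leaf v js q) :
    Composite S fs i leaf w js (Q.post h q) := by
  induction p with
  | refl a => rwa [SymMulticat.post_id]
  | cons s p ih =>
    rw [← SymMulticat.post_post]
    exact ih (.edge s H)

/-- Composites can be moved to another system in which all steps and nodes are available. -/
theorem map (F : S.V → S'.V)
    (hF : ∀ {v w c d} {h : c ⟶ d}, S.step v w h → S'.Path (F v) (F w) h)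
    (hl : ∀ j, F (leaf j) = leaf' j) (hlab : ∀ j, S'.lab (leaf' j) = S.lab (leaf j))
    (hn : ∀ n {m : Fin (fs n).arity → ℕ} (js : ∀ a, Fin (m a) → Fin l)
      {z : ∀ a, Fin (m a) → C} (q : ∀ a, Q.Hom (z a) ((fs n).src a)),
      (∀ a, Composite S' fs' i' leaf' (F (i n (.inl ⟨a, ()⟩))) (js a) (q a)) →
      Composite S' fs' i' leaf' (F (i n (.inr ()))) (concat js) (Q.comp (fs n).arrow q))
    {v : S.V} {k : ℕ} {js : Fin k → Fin l} {x : Fin k → C} {c : C} {q : Q.Hom x c}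
    (H : Composite S fs i leaf v js q) : Composite S' fs' i' leaf' (F v) js q := by
  induction H with
  | leaf j h =>
    rw [hl]
    exact .leaf j ((hlab j).trans h)
  | node n h ih => exact hn n _ _ ih
  | edge s h ih => exact ih.path (hF s)
  | act σ hj h H ih => exact .act σ hj h ih

theorem node' {g : Elt Q} {p : g.fr.Var → S.V} (h : ∃ n, fs n = g ∧ HEq (i n) p)
    {m : Fin g.arity → ℕ} (js : ∀ a, Fin (m a) → Fin l)
    {z : ∀ a, Fin (m a) → C} (q : ∀ a, Q.Hom (z a) (g.src a))
    (H : ∀ a, Composite S fs i leaf (p (.inl ⟨a, ()⟩)) (js a) (q a)) :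
    Composite S fs i leaf (p (.inr ())) (concat js) (Q.comp g.arrow q) := by
  obtain ⟨n, rfl, h⟩ := h
  obtain rfl := eq_of_heq h
  exact .node n H

/-- A family of sources for one input -/
structure Fam (Q : SymMulticat.{w} C) (l : ℕ) (c : C) where
  m : ℕ
  js : Fin m → Fin l
  z : Fin m → C
  q : Q.Hom z c

/-- Substitution of composites in the leaves of a composite -/
theorem subst (F : S.V → S'.V)
    (hF : ∀ {v w c d} {h : c ⟶ d}, S.step v w h → S'.Path (F v) (F w) h)
    {leaf' : Fin l' → S'.V} (hn : ∀ n, ∃ n', fs' n' = fs n ∧ HEq (i' n') fun a => F (i n a))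
    {v : S.V} {k : ℕ} {js : Fin k → Fin l} {x : Fin k → C} {c : C} {q : Q.Hom x c}
    (H : Composite S fs i leaf v js q) : ∀ U : ∀ b, Fam Q l' (x b),
      (∀ b, Composite S' fs' i' leaf' (F (leaf (js b))) (U b).js (U b).q) →
      Composite S' fs' i' leaf' (F v) (concat fun b => (U b).js) (Q.comp q fun b => (U b).q) := by
  induction H with
  | @leaf j c h =>
    intro U hU
    obtain ⟨U0, rfl⟩ : ∃ U0, U = fun _ => U0 :=
      ⟨U 0, funext fun b => by obtain rfl := Subsingleton.elim b 0; rfl⟩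
    have := SymMulticat.id_comp Q U0.q
    exact (congrArg (fun r => Composite S' fs' i' leaf' (F (leaf j))
      (concat fun _ : Fin 1 => U0.js) r) this).mpr (.act (sumOne U0.m) (concat_sumOne U0.js) (concat_sumOne U0.z) (hU 0))
  | @node n m js z q h ih =>
    intro U hU
    obtain ⟨U, rfl⟩ := SymMulticat.exists_pull (split m)
      (P := fun s : Σ a, Fin (m a) => Fam Q l' (z s.1 s.2)) U
    have h1 := node' (leaf := leaf') (hn n) (fun a => concat fun b => (U ⟨a, b⟩).js)
      (fun a => Q.comp (q a) fun b => (U ⟨a, b⟩).q) fun a => ih a (fun b => U ⟨a, b⟩) fun b => by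
        obtain ⟨p, hp⟩ := (split m).surjective ⟨a, b⟩
        exact (congrArg (fun s : Σ a, Fin (m a) => Composite S' fs' i' leaf'
          (F (leaf (js s.1 s.2))) (U s).js (U s).q) hp).mp (hU p)
    have h2 := Q.assoc (fs n).arrow q fun a b => (U ⟨a, b⟩).q
    exact (congrArg (fun r => Composite S' fs' i' leaf' (F (i n (.inr ())))
      (concat fun p => (U (split m p)).js) r) h2).mpr
      (.act _ (concat_sumAssoc fun a b => (U ⟨a, b⟩).js) _ h1)
  | edge s h ih =>
    intro U hU
    have := (ih U hU).path (hF s)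
    rwa [← SymMulticat.post_comp] at this
  | @act v k k' js js' x x' c q σ hj h H ih =>
    intro U hU
    obtain rfl : x' = fun a => x (σ a) := funext h
    obtain rfl : js' = fun a => js (σ a) := funext hj
    obtain ⟨U, rfl⟩ := SymMulticat.exists_pull σ (P := fun b => Fam Q l' (x b)) U
    have h1 := ih U fun b => by
      obtain ⟨b, rfl⟩ := σ.surjective b
      exact hU b
    have h2 := Q.act_comp q (fun b => (U b).q) σ
    exact (congrArg (fun r => Composite S' fs' i' leaf' (F v)
      (concat fun b => (U (σ b)).js) r) h2).mpr
      (.act _ (concat_blockPerm σ fun b => (U b).js) _ h1)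

end Composite
end
open SignedSet Linking

section
variable {C : Type u} [Category.{v} C] {Q : SymMulticat.{w} C}

namespace Linking
variable {X Y Z : SignedSet C} {ξ : X ⟶ Y} {η : Y ⟶ Z}

theorem path_visible {u w : (X.hom Z).Var} {c d : C} {h : c ⟶ d} (hw : (X.hom Z).sign w = true)
    (p : (compSys ξ η).Path (embO X Y Z u) (embO X Y Z w) h) : (hsys (ξ ≫ η)).Path u w h := by
  have tw := compSys_terminal (ξ := ξ) (η := η) w hw
  obtain ⟨hc, hd⟩ := Sys.Path.lab p
  cases hu : (X.hom Z).sign u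
  · have : (Linking.comp ξ η).Edge u w h := ofRel_Edge.2 ⟨hu, hw, p⟩
    exact Sys.Path.of_step (S := hsys (ξ ≫ η)) this
  · have r : (compSys ξ η).Path (embO X Y Z u) (embO X Y Z u) (𝟙 c) := Sys.Path.refl' hc.symm
    obtain ⟨h1, h2⟩ := Sys.Path.unique r p (compSys_terminal _ hu) tw
    obtain rfl := embO_inj h1
    obtain rfl : c = d := hc.trans hd.symm
    cases h2
    exact Sys.Path.refl' (S := hsys (ξ ≫ η)) (hc.trans (compLab_embO u)).symm

end Linking

namespace Composite
variable {X Y Z : SignedSet C} {ξ : X ⟶ Y} {η : Y ⟶ Z} {ν : Type} {fs : ν → Elt Q}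
  {p : ∀ n, (fs n).fr.Var → X.Var} {l : ℕ} {leaf : Fin l → (X.hom Z).Var}

theorem visible_aux (hs : ∀ n a, X.sign (p n a) = (fs n).fr.sign a)
    (hp : ∀ n a, X.label (p n a) = (fs n).fr.label a)
    {v : (compSys ξ η).V} {k : ℕ} {js : Fin k → Fin l} {x : Fin k → C} {c : C} {q : Q.Hom x c}
    (H : Composite (compSys ξ η) fs (fun n a => Sum.inl (p n a)) (fun j => embO X Y Z (leaf j))
      v js q) :
    ∃ (u : (X.hom Z).Var) (c' : C) (q' : Q.Hom x c') (h : c' ⟶ c),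
      (compSys ξ η).Path (embO X Y Z u) v h ∧ q = Q.post h q' ∧
      Composite (hsys (ξ ≫ η)) fs (fun n a => Sum.inl (p n a)) leaf u js q' := by
  induction H with
  | @leaf j c h =>
    exact ⟨leaf j, c, _, 𝟙 c, Sys.Path.refl' h, (SymMulticat.post_id _).symm,
      .leaf j ((compLab_embO (leaf j)).symm.trans h)⟩
  | @node n m js z q h ih =>
    refine ⟨.inl (p n (.inr ())), _, _, 𝟙 _, Sys.Path.refl' (hp n (.inr ())),
      (SymMulticat.post_id _).symm, .node n fun a => ?_⟩
    obtain ⟨u, c', q', h, r, hq, H⟩ := ih a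
    rw [hq]
    refine H.path (path_visible ?_ r)
    change (!X.sign (p n (.inl ⟨a, ()⟩))) = true
    rw [hs]
    rfl
  | edge s h ih =>
    obtain ⟨u, c', q', h', r, rfl, H⟩ := ih
    exact ⟨u, c', q', _, r.trans (Sys.Path.of_step s), SymMulticat.post_post _ _ _, H⟩
  | act σ hj h H ih =>
    obtain ⟨u, c', q', h', r, rfl, H'⟩ := ih
    exact ⟨u, c', _, h', r, SymMulticat.act_post _ _ _ _, .act σ hj h H'⟩

theorem visible (hs : ∀ n a, X.sign (p n a) = (fs n).fr.sign a)
    (hp : ∀ n a, X.label (p n a) = (fs n).fr.label a)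
    {w : (X.hom Z).Var} (hw : (X.hom Z).sign w = true)
    {k : ℕ} {js : Fin k → Fin l} {x : Fin k → C} {c : C} {q : Q.Hom x c}
    (H : Composite (compSys ξ η) fs (fun n a => Sum.inl (p n a)) (fun j => embO X Y Z (leaf j))
      (embO X Y Z w) js q) :
    Composite (hsys (ξ ≫ η)) fs (fun n a => Sum.inl (p n a)) leaf w js q := by
  obtain ⟨u, c', q', h, r, rfl, H'⟩ := visible_aux hs hp H
  exact H'.path (path_visible hw r)

end Composite

/-! ### Configurations -/

/-- Composing the arrows `fs n` in the configuration `ζ` gives `f`. -/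
def ComposesAt {X : SignedSet C} {ν : Type} (fs : ν → Elt Q) (p : ∀ n, (fs n).fr.Var → X.Var)
    (f : Elt Q) (ζ : X ⟶ f.fr) : Prop :=
  Composite (hsys ζ) fs (fun n a => .inl (p n a)) (fun j : Fin f.arity => .inr (.inl ⟨j, ()⟩))
    (.inr (.inr ())) id f.arrow

/-- Composing the arrows `fs n` in the configuration `ζ` gives `f`. -/
def Composes {ν : Type} [Finite ν] {fs : ν → Elt Q} {f : Elt Q}
    (ζ : SignedSet.sigma (fun n => (fs n).fr) ⟶ f.fr) : Prop :=
  ComposesAt (X := SignedSet.sigma fun n => (fs n).fr) fs (fun n a => ⟨n, a⟩) f ζ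

namespace ComposesAt
variable {X Y : SignedSet C} {ν ν' : Type} {fs : ν → Elt Q} {p : ∀ n, (fs n).fr.Var → X.Var}
  {f : Elt Q} {ζ : X ⟶ f.fr}

theorem sits (H : ComposesAt fs p f ζ) {S : Sys C} {i : X.Var → S.V} {j : f.fr.Var → S.V}
    (h : HSits ζ S i j) : Composite S fs (fun n a => i (p n a)) (fun k => j (.inl ⟨k, ()⟩))
      (j (.inr ())) id f.arrow :=
  Composite.map (S := hsys ζ) (S' := S)
    (leaf := fun k => .inr (.inl ⟨k, ()⟩)) (leaf' := fun k => j (.inl ⟨k, ()⟩)) (Sum.elim i j)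
    (fun s => Sits.path (X := X.hom f.fr) h s) (fun _ => rfl) (fun k => h.right (.inl ⟨k, ()⟩))
    (fun n _ js _ q h => .node n h) H

theorem reindex (H : ComposesAt fs p f ζ) {fs' : ν' → Elt Q} (e : SIso Y X)
    {p' : ∀ n, (fs' n).fr.Var → Y.Var}
    (hn : ∀ n, ∃ n', ∃ h : fs' n' = fs n, ∀ a, e.e (p' n' a) = p n (cast (by rw [h]) a)) :
    ComposesAt fs' p' f (ofSIso e ≫ ζ) := by
  obtain ⟨i, hi⟩ : ∃ i : X.Var → (hsys (ofSIso e ≫ ζ)).V, (Sum.inl : Y.Var → _) =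
    fun a => i (e.e a) := exists_precomp e _
  have h := hsits_self (ofSIso e ≫ ζ)
  rw [hi] at h
  have h1 := H.sits (hsits_ofSIso_comp.1 h)
  unfold ComposesAt
  refine Composite.map (S := hsys (ofSIso e ≫ ζ)) (S' := hsys (ofSIso e ≫ ζ)) _root_.id
    (fun s => Sys.Path.of_step s) (fun _ => rfl) (fun _ => rfl)
    (fun n _ js _ q h => Composite.node' ?_ js q h) h1
  obtain ⟨n', h', hn⟩ := hn n
  refine ⟨n', h', ?_⟩
  have : ∀ (g : Elt Q) (h' : fs' n' = g) (r : g.fr.Var → X.Var),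
      (∀ a, e.e (p' n' a) = r (cast (by rw [h']) a)) →
      HEq (fun a => (Sum.inl (p' n' a) : (hsys (ofSIso e ≫ ζ)).V)) fun a => i (r a) := by
    rintro g rfl r h
    refine heq_of_eq (funext fun a => ?_)
    exact (congrFun hi _).trans (congrArg i (h a))
  exact this _ h' _ hn

end ComposesAt

end
open SignedSet Linking

section
variable {C : Type u} [Category.{v} C] {Q : SymMulticat.{w} C}

namespace SIso

theorem reindex_symm {ι κ : Type} [Finite ι] [Finite κ] (e : ι ≃ κ) (Y : κ → SignedSet C) (k : κ)
    (a : (Y k).Var) : ((reindex e Y).e.symm ⟨k, a⟩).1 = e.symm k ∧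
      HEq ((reindex e Y).e.symm ⟨k, a⟩).2 a := by
  obtain ⟨i, rfl⟩ := e.surjective k
  have : (reindex e Y).e.symm ⟨e i, a⟩ = ⟨i, a⟩ := (Equiv.symm_apply_eq _).2 rfl
  rw [this]
  exact ⟨(e.symm_apply_apply i).symm, HEq.rfl⟩

theorem sigmaSplit_symm {n : ℕ} {m : Fin n → ℕ} (X : ∀ i, Fin (m i) → SignedSet C) (i j)
    (a : (X i j).Var) : ((sigmaSplit X).e.symm ⟨i, ⟨j, a⟩⟩).1 = (split m).symm ⟨i, j⟩ ∧
      HEq ((sigmaSplit X).e.symm ⟨i, ⟨j, a⟩⟩).2 a :=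
  reindex_symm (split m) (fun p : Σ i, Fin (m i) => X p.1 p.2) ⟨i, j⟩ a

end SIso

/-- Configurations of arrows `fs k` with the boundary of `f` -/
abbrev Conf {n : ℕ} (fs : Fin n → Elt Q) (f : Elt Q) : Type (max v _) :=
  SignedSet.sigma (fun k => (fs k).fr) ⟶ f.fr

namespace Conf
variable {n n' n'' : ℕ} {fs : Fin n → Elt Q} {fs' : Fin n' → Elt Q} {fs'' : Fin n'' → Elt Q}
  {f g h : Elt Q}

def actIso (σ : Fin n' ≃ Fin n) (h : ∀ i, fs' i = fs (σ i)) :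
    SIso (SignedSet.sigma fun k => (fs' k).fr) (SignedSet.sigma fun k => (fs k).fr) :=
  (SIso.sigma fun i => SIso.ofEq (congrArg Elt.fr (h i))).trans
    (SIso.reindex σ fun i => (fs i).fr)

theorem actIso_eq {σ : Fin n' ≃ Fin n} {h : ∀ i, fs' i = fs (σ i)} {k : Fin n'}
    {a : (fs' k).fr.Var} {b : Σ k, (fs k).fr.Var} (h1 : b.1 = σ k) (h2 : HEq b.2 a) :
    (actIso σ h).e ⟨k, a⟩ = b := by
  obtain ⟨b1, b2⟩ := b
  obtain rfl : b1 = σ k := h1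
  refine Sigma.ext rfl ?_
  exact (SIso.ofEq_heq (congrArg Elt.fr (h k)) a).trans h2.symm

/-- The configuration of one arrow given by a morphism -/
def one (γ : f ⟶ g) : Conf (fun _ : Fin 1 => f) g := ofSIso (SIso.sigmaOne f.fr) ≫ Elt.frMap γ

/-- Replacing each node of a configuration by a configuration -/
def comp {m : Fin n → ℕ} {gs : ∀ i, Fin (m i) → Elt Q} (ζ : Conf fs f)
    (ξ : ∀ i, Conf (gs i) (fs i)) : Conf (concat gs) f :=
  ofSIso (SIso.sigmaSplit fun i j => (gs i j).fr) ≫ sigmaMap ξ ≫ ζ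

/-- Renumbering the nodes of a configuration -/
def act (σ : Fin n' ≃ Fin n) (h : ∀ i, fs' i = fs (σ i)) (ζ : Conf fs f) : Conf fs' f :=
  ofSIso (actIso σ h) ≫ ζ

theorem act_refl (ζ : Conf fs f) : act (Equiv.refl _) (fun _ => rfl) ζ = ζ := by
  have : actIso (fs' := fs) (fs := fs) (Equiv.refl _) (fun _ => rfl) = SIso.refl _ :=
    SIso.ext fun ⟨k, a⟩ => actIso_eq rfl HEq.rfl
  unfold act
  rw [this, ofSIso_refl, Category.id_comp]

theorem act_act (σ : Fin n' ≃ Fin n) (τ : Fin n'' ≃ Fin n') (h : ∀ i, fs' i = fs (σ i))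
    (h' : ∀ i, fs'' i = fs' (τ i)) (ζ : Conf fs f) :
    act τ h' (act σ h ζ) = act (τ.trans σ) (fun i => (h' i).trans (h _)) ζ := by
  unfold act
  rw [← Category.assoc, ofSIso_trans]
  congr 2
  refine SIso.ext fun ⟨k, a⟩ => (actIso_eq rfl ?_).symm
  exact (SIso.ofEq_heq (congrArg Elt.fr (h _)) _).trans
    (SIso.ofEq_heq (congrArg Elt.fr (h' k)) a)

theorem splitOne (fs : Fin n → Elt Q) : (SIso.sigmaSplit fun (_ : Fin 1) j => (fs j).fr).trans
    (SIso.sigmaOne (SignedSet.sigma fun k => (fs k).fr)) =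
      actIso (sumOne n) (concat_sumOne fs) := by
  refine SIso.ext fun a => ?_
  obtain ⟨k, a⟩ := a
  have h1 := SIso.sigmaOne_apply (SignedSet.sigma fun k => (fs k).fr)
    (split (fun _ : Fin 1 => n) k).1 ⟨(split (fun _ : Fin 1 => n) k).2, a⟩
  have h2 := actIso_eq (h := concat_sumOne fs) (k := k) (a := a)
    (b := ⟨(split (fun _ : Fin 1 => n) k).2, a⟩) rfl HEq.rfl
  exact Eq.trans h1 h2.symm

theorem id_comp (ζ : Conf fs f) :
    comp (one (𝟙 f)) (fun _ => ζ) = act (sumOne n) (concat_sumOne fs) ζ := by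
  unfold comp one act
  rw [Elt.frMap_id, Category.comp_id, sigmaMap_one, ← Category.assoc, ofSIso_trans, splitOne]

theorem comp_id (ζ : Conf fs f) :
    comp ζ (fun i => one (𝟙 (fs i))) = act (sumOnes n) (concat_sumOnes fs) ζ := by
  have : (fun i => one (𝟙 (fs i))) = fun i => ofSIso (SIso.sigmaOne (fs i).fr) :=
    funext fun i => by unfold one; rw [Elt.frMap_id, Category.comp_id]
  unfold comp act
  rw [this, sigmaMap_ofSIso, ← Category.assoc, ofSIso_trans]
  congr 2
  refine SIso.ext fun ⟨k, a⟩ => (actIso_eq rfl ?_).symm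
  exact heq_of_eq (SIso.sigmaOne_apply (fs _).fr _ a)

theorem assoc {m : Fin n → ℕ} {gs : ∀ i, Fin (m i) → Elt Q} {l : ∀ i, Fin (m i) → ℕ}
    {ks : ∀ i j, Fin (l i j) → Elt Q} (ζ : Conf fs f) (ξ : ∀ i, Conf (gs i) (fs i))
    (η : ∀ i j, Conf (ks i j) (gs i j)) :
    comp (comp ζ ξ) (fun p => η (split m p).1 (split m p).2) =
      act (sumAssoc m l) (concat_sumAssoc ks) (comp ζ fun i => comp (ξ i) (η i)) := by
  have h1 := sigmaMap_split η
  have h2 : sigmaMap (fun i => comp (ξ i) (η i)) = ofSIso (SIso.sigma fun i =>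
      SIso.sigmaSplit fun j k => (ks i j k).fr) ≫ sigmaMap (fun i => sigmaMap (η i)) ≫
        sigmaMap ξ := by
    unfold comp
    rw [sigmaMap_comp, sigmaMap_comp, sigmaMap_ofSIso]
  have h3 : (SIso.sigmaSplit (m := concat l)
      fun p k => (ks (split m p).1 (split m p).2 k).fr).trans
        (SIso.sigmaSplit fun i j => SignedSet.sigma fun k => (ks i j k).fr) =
      (actIso (sumAssoc m l) (concat_sumAssoc ks)).trans ((SIso.sigmaSplit
        fun i (k : Fin (∑ j, l i j)) => (concat (ks i) k).fr).trans
        (SIso.sigma fun i => SIso.sigmaSplit fun j k => (ks i j k).fr)) := by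
    refine SIso.ext fun ⟨k, a⟩ => ?_
    refine (Equiv.symm_apply_eq ((SIso.sigmaSplit
        fun i (k : Fin (∑ j, l i j)) => (concat (ks i) k).fr).trans
        (SIso.sigma fun i => SIso.sigmaSplit fun j k => (ks i j k).fr)).e).1 (actIso_eq ?_ ?_).symm
    · refine (SIso.sigmaSplit_symm _ _ _ _).1.trans ?_
      exact congrArg (fun t => (split fun i => ∑ j, l i j).symm ⟨_, t⟩)
        (SIso.sigmaSplit_symm _ _ _ _).1
    · exact (SIso.sigmaSplit_symm _ _ _ _).2.trans (SIso.sigmaSplit_symm _ _ _ _).2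
  calc _ = ofSIso (SIso.sigmaSplit (m := concat l)
      fun p k => (ks (split m p).1 (split m p).2 k).fr) ≫ (sigmaMap (fun p =>
        η (split m p).1 (split m p).2) ≫ ofSIso (SIso.sigmaSplit fun i j => (gs i j).fr)) ≫
          sigmaMap ξ ≫ ζ := by
        simp only [Category.assoc]; rfl
    _ = ofSIso ((actIso (sumAssoc m l) (concat_sumAssoc ks)).trans ((SIso.sigmaSplit
        fun i (k : Fin (∑ j, l i j)) => (concat (ks i) k).fr).trans
        (SIso.sigma fun i => SIso.sigmaSplit fun j k => (ks i j k).fr))) ≫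
          sigmaMap (fun i => sigmaMap (η i)) ≫ sigmaMap ξ ≫ ζ := by
        rw [h1, ← h3, ← ofSIso_trans]; simp only [Category.assoc]
    _ = _ := by
        rw [← ofSIso_trans, ← ofSIso_trans]
        unfold act
        conv_rhs => rw [comp, h2]
        simp only [Category.assoc]

theorem comp_act {m m' : Fin n → ℕ} {gs : ∀ i, Fin (m i) → Elt Q} {gs' : ∀ i, Fin (m' i) → Elt Q}
    (ζ : Conf fs f) (ξ : ∀ i, Conf (gs i) (fs i)) (σ : ∀ i, Fin (m' i) ≃ Fin (m i))
    (h : ∀ i j, gs' i j = gs i (σ i j)) :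
    comp ζ (fun i => act (σ i) (h i) (ξ i)) =
      act (sumPerm σ) (concat_sumPerm σ h) (comp ζ ξ) := by
  unfold comp act
  rw [sigmaMap_comp, sigmaMap_ofSIso]
  simp only [← Category.assoc]
  rw [ofSIso_trans, ofSIso_trans]
  congr 3
  refine SIso.ext fun ⟨k, a⟩ => ?_
  refine (Equiv.symm_apply_eq (SIso.sigmaSplit fun i j => (gs i j).fr).e).1 (actIso_eq ?_ ?_).symm
  · exact (SIso.sigmaSplit_symm _ _ _ _).1
  · exact (SIso.sigmaSplit_symm _ _ _ _).2.trans
      (SIso.ofEq_heq (congrArg Elt.fr (h _ _)) a)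

theorem act_comp {m : Fin n → ℕ} {gs : ∀ i, Fin (m i) → Elt Q}
    (ζ : Conf fs f) (ξ : ∀ i, Conf (gs i) (fs i)) (σ : Fin n' ≃ Fin n) :
    comp (act (fs' := fun i => fs (σ i)) σ (fun _ => rfl) ζ) (fun i => ξ (σ i)) =
      act (blockPerm σ m) (concat_blockPerm σ gs) (comp ζ ξ) := by
  have h1 := sigmaMap_reindex σ ξ
  have h2 : actIso (fs' := fun i => fs (σ i)) σ (fun _ => rfl) =
      SIso.reindex σ fun i => (fs i).fr := SIso.ext fun ⟨k, a⟩ => rfl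
  unfold comp act
  rw [h2, ← Category.assoc (sigmaMap fun i => ξ (σ i)), h1]
  simp only [← Category.assoc]
  rw [ofSIso_trans, ofSIso_trans]
  congr 3
  refine SIso.ext fun ⟨k, a⟩ => ?_
  refine (Equiv.symm_apply_eq (SIso.sigmaSplit fun i j => (gs i j).fr).e).1 (actIso_eq ?_ ?_).symm
  · exact (SIso.sigmaSplit_symm _ _ _ _).1
  · exact (SIso.sigmaSplit_symm _ _ _ _).2

theorem one_comp (γ : f ⟶ g) (δ : g ⟶ h) :
    comp (one δ) (fun _ => one γ) = act (sumOne 1) (concat_sumOne _) (one (γ ≫ δ)) := by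
  have h1 : sigmaMap (fun _ : Fin 1 => one γ) ≫ one δ =
      ofSIso (SIso.sigmaOne (SignedSet.sigma fun _ : Fin 1 => f.fr)) ≫ one γ ≫ Elt.frMap δ := by
    have e : one δ = ofSIso (SIso.sigmaOne g.fr) ≫ Elt.frMap δ := rfl
    rw [e, ← Category.assoc, sigmaMap_one, Category.assoc]
  have h2 : one (γ ≫ δ) = one γ ≫ Elt.frMap δ := by
    unfold one
    rw [Elt.frMap_comp, Category.assoc]
  have h3 := splitOne (fun _ : Fin 1 => f)
  unfold comp act
  rw [h1, h2, ← Category.assoc, ofSIso_trans]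
  exact congrArg (fun e => ofSIso e ≫ one γ ≫ Elt.frMap δ) h3

end Conf
end
open SignedSet Linking

section
variable {C : Type u} [Category.{v} C] {Q : SymMulticat.{w} C}

namespace Conf
variable {n n' n'' : ℕ} {fs : Fin n → Elt Q} {fs' : Fin n' → Elt Q} {fs'' : Fin n'' → Elt Q}
  {f g h : Elt Q}

/-! ### Composites of composite configurations -/

theorem composes_act {σ : Fin n' ≃ Fin n} {h : ∀ i, fs' i = fs (σ i)} {ζ : Conf fs f}
    (hζ : Composes ζ) : Composes (act σ h ζ) :=
  ComposesAt.reindex (X := SignedSet.sigma fun k => (fs k).fr) hζ (actIso σ h) fun k => by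
    obtain ⟨k, rfl⟩ := σ.surjective k
    exact ⟨k, h k, fun a => actIso_eq rfl (cast_heq _ _)⟩

theorem composes_one (γ : f ⟶ g) : Composes (one γ) := by
  obtain ⟨H1, H2⟩ := Elt.hsits_frMap.1 (hsits_self (Elt.frMap γ))
  have h1 : ∀ k, Composite (hsys (Elt.frMap γ)) (fun _ : Unit => f) (fun _ a => Sum.inl a)
      (fun j => Sum.inr (Sum.inl ⟨j, ()⟩)) (Sum.inl (Sum.inl ⟨γ.perm k, ()⟩))
      (fun _ : Fin 1 => k) (Q.ι (γ.src k)) := fun k => by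
    have := Composite.path (fs := fun _ : Unit => f) (i := fun _ a => Sum.inl a)
      (leaf := fun j => Sum.inr (Sum.inl ⟨j, ()⟩)) (H1 k) (.leaf k rfl)
    exact (congrArg (fun q => Composite (hsys (Elt.frMap γ)) (fun _ : Unit => f)
      (fun _ a => Sum.inl a) (fun j => Sum.inr (Sum.inl ⟨j, ()⟩))
      (Sum.inl (Sum.inl ⟨γ.perm k, ()⟩)) (fun _ : Fin 1 => k) q)
      ((SymMulticat.post_ι _ _).trans (congrArg Q.ι (Category.id_comp _)))).mp this
  have h2 : ∀ a, Composite (hsys (Elt.frMap γ)) (fun _ : Unit => f) (fun _ a => Sum.inl a)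
      (fun j => Sum.inr (Sum.inl ⟨j, ()⟩)) (Sum.inl (Sum.inl ⟨a, ()⟩))
      (fun _ : Fin 1 => γ.perm.symm a) (Q.ι (γ.src (γ.perm.symm a) ≫
        eqToHom (congrArg f.src (γ.perm.apply_symm_apply a)))) := fun a => by
    obtain ⟨k, rfl⟩ := γ.perm.surjective a
    have e := γ.perm.symm_apply_apply k
    have : ∀ k', k' = k → ∀ e' : f.src (γ.perm k') = f.src (γ.perm k),
      Composite (hsys (Elt.frMap γ)) (fun _ : Unit => f) (fun _ a => Sum.inl a)
      (fun j => Sum.inr (Sum.inl ⟨j, ()⟩)) (Sum.inl (Sum.inl ⟨γ.perm k, ()⟩))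
      (fun _ : Fin 1 => k') (Q.ι (γ.src k' ≫ eqToHom e')) := by
      rintro k' rfl e'
      rw [eqToHom_refl, Category.comp_id]
      exact h1 _
    exact this _ e _
  have h3 := Composite.node (fs := fun _ : Unit => f) () h2
  rw [SymMulticat.ι_comp'] at h3
  have h4 := Composite.act (js' := fun k => γ.perm.symm k)
    (x' := fun a => g.src (γ.perm.symm a)) (sumOnes _).symm (fun a => by simp [concat])
    (fun a => by simp [concat]) h3
  rw [Q.act_act, SymMulticat.act_eq_self _ (by simp)] at h4
  have h5 := Composite.act (js' := id) (x' := g.src) γ.perm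
    (fun k => (γ.perm.symm_apply_apply k).symm)
    (fun k => congrArg g.src (γ.perm.symm_apply_apply k).symm) h4
  rw [SymMulticat.act_pre] at h5
  have h6 : ∀ k, eqToHom (congrArg g.src (γ.perm.symm_apply_apply k).symm) ≫
      γ.src (γ.perm.symm (γ.perm k)) ≫
        eqToHom (congrArg f.src (γ.perm.apply_symm_apply (γ.perm k))) = γ.src k := by
    intro k
    have : ∀ k', ∀ e : k = k', ∀ e' : f.src (γ.perm k') = f.src (γ.perm k),
        eqToHom (congrArg g.src e) ≫ γ.src k' ≫ eqToHom e' = γ.src k := by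
      rintro k' rfl e'
      simp
    exact this _ (γ.perm.symm_apply_apply k).symm _
  rw [funext h6] at h5
  have h7 := h5.path H2
  rw [← γ.comm] at h7
  exact ComposesAt.reindex (X := f.fr) (fs := fun _ : Unit => f) (p := fun _ a => a) h7
    (SIso.sigmaOne f.fr) fun _ => ⟨0, rfl, fun a => rfl⟩

theorem composesAt_comp {m : Fin n → ℕ} {gs : ∀ i, Fin (m i) → Elt Q} {ζ : Conf fs f}
    {ξ : ∀ i, Conf (gs i) (fs i)} (hζ : Composes ζ) (hξ : ∀ i, Composes (ξ i)) :
    ComposesAt (X := SignedSet.sigma fun i => SignedSet.sigma fun j => (gs i j).fr)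
      (fun s : Σ i, Fin (m i) => gs s.1 s.2) (fun s a => ⟨s.1, ⟨s.2, a⟩⟩) f
      (sigmaMap ξ ≫ ζ) := by
  have l := (hsits_iff (ξ := sigmaMap ξ)).1 (left_sits_compSys (ξ := sigmaMap ξ) (η := ζ))
  have r := (hsits_iff (ξ := ζ)).1 (right_sits_compSys (ξ := sigmaMap ξ) (η := ζ))
  refine Composite.visible (ξ := sigmaMap ξ) (η := ζ) (fun _ _ => rfl) (fun _ _ => rfl)
    (w := .inr (.inr ())) rfl ?_
  refine Composite.map (S := hsys ζ) (S' := compSys (sigmaMap ξ) ζ)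
    (leaf := fun k => .inr (.inl ⟨k, ()⟩)) (Sum.elim (fun a => .inr (.inl a)) fun a => .inr (.inr a))
    (fun s => Sits.path (X := (SignedSet.sigma fun k => (fs k).fr).hom f.fr) r s)
    (fun _ => rfl) (fun _ => rfl) ?_ hζ
  intro i m' js z q H
  exact Composite.subst (S := hsys (ξ i)) (S' := compSys (sigmaMap ξ) ζ)
    (fs := gs i) (i := fun j a => Sum.inl ⟨j, a⟩) (leaf := fun k => .inr (.inl ⟨k, ()⟩))
    (Sum.elim (fun a => .inl ⟨i, a⟩) fun a => .inr (.inl ⟨i, a⟩))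
    (fun s => Sits.path (X := (SignedSet.sigma fun k => (gs i k).fr).hom (fs i).fr)
      (hsits_sigmaMap.1 l i) s)
    (leaf' := fun k => .inr (.inr (.inl ⟨k, ()⟩))) (fun j => ⟨⟨i, j⟩, rfl, HEq.rfl⟩) (hξ i)
    (fun a => ⟨m' a, js a, z a, q a⟩) H

theorem composes_comp {m : Fin n → ℕ} {gs : ∀ i, Fin (m i) → Elt Q} {ζ : Conf fs f}
    {ξ : ∀ i, Conf (gs i) (fs i)} (hζ : Composes ζ) (hξ : ∀ i, Composes (ξ i)) :
    Composes (comp ζ ξ) :=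
  ComposesAt.reindex (composesAt_comp hζ hξ) (SIso.sigmaSplit fun i j => (gs i j).fr) fun s => by
    obtain ⟨k, rfl⟩ := (split m).surjective s
    exact ⟨k, rfl, fun a => rfl⟩

end Conf
end
open SignedSet Linking

section
variable {C : Type u} [Category.{v} C] {Q : SymMulticat.{w} C}

noncomputable def Elt.frameIso (f : Elt Q) : SIso ((Elt.frame Q).obj f).signed f.fr := f.frIso

namespace Conf
variable {n n' n'' : ℕ} {fs : Fin n → Elt Q} {fs' : Fin n' → Elt Q} {fs'' : Fin n'' → Elt Q}
  {f g h : Elt Q}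

/-! ### Allowable configurations -/

/-- The tensor product of the frames -/
noncomputable abbrev frames (fs : Fin n → Elt Q) : LShape C :=
  LShape.tens fun k => (Elt.frame Q).obj (fs k)

noncomputable def confIso (fs : Fin n → Elt Q) :
    SIso (frames fs).signed (SignedSet.sigma fun k => (fs k).fr) :=
  (LShape.tensIso fun k => (Elt.frame Q).obj (fs k)).trans (SIso.sigma fun k => (fs k).frameIso)

/-- A configuration, as a graph between labelled shapes, is allowable. -/
def Allow (ζ : Conf fs f) : Prop :=
  LShape.Allow (α := frames fs) (β := (Elt.frame Q).obj f) (conj (confIso fs).symm f.frameIso.symm ζ)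

theorem allow_act {σ : Fin n' ≃ Fin n} {h : ∀ i, fs' i = fs (σ i)} {ζ : Conf fs f}
    (hζ : Allow ζ) : Allow (act σ h ζ) := by
  obtain rfl : fs' = fun i => fs (σ i) := funext h
  unfold Allow act
  rw [conj_comp _ (confIso fs).symm, conj_ofSIso]
  refine LShape.Allow.comp (β := frames fs) ?_ hζ
  refine LShape.allow_ofSIso (α := frames fun i => fs (σ i)) (β := frames fs)
    (TensorOf.reindex σ (fun k => ((Elt.frame Q).obj (fs k)).shape)
      (LShape.tensorOf_tens fun k => (Elt.frame Q).obj (fs (σ k))))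
    (LShape.tensorOf_tens _) _ fun a => ?_
  refine (SIso.sigma fun k => (fs k).frameIso).e.injective ?_
  refine ((confIso fs).e.apply_symm_apply _).trans ?_
  exact actIso_eq rfl HEq.rfl

theorem allow_one (γ : f ⟶ g) : Allow (one γ) := by
  refine (congrArg (fun ζ => LShape.Allow (α := .arrow f.src f.tgt)
    (β := .arrow g.src g.tgt) ζ) ?_).mp (Elt.frMap_allow γ)
  have e : (confIso fun _ : Fin 1 => f).trans (SIso.sigmaOne f.fr) = f.frameIso :=
    SIso.ext fun a => rfl
  have h1 := conj_eq f.frameIso.symm g.frameIso.symm (Elt.frMap γ)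
  have h2 := conj_eq (confIso fun _ : Fin 1 => f).symm g.frameIso.symm (one γ)
  refine h1.trans (Eq.trans ?_ h2.symm)
  unfold one
  rw [Category.assoc, ← Category.assoc (ofSIso (confIso fun _ : Fin 1 => f).symm.symm)]
  refine congrArg (fun ζ => ζ ≫ Elt.frMap γ ≫ ofSIso g.frameIso.symm) ?_
  refine Eq.trans ?_ (ofSIso_trans (confIso fun _ : Fin 1 => f) (SIso.sigmaOne f.fr)).symm
  exact congrArg ofSIso e.symm

theorem allow_comp {m : Fin n → ℕ} {gs : ∀ i, Fin (m i) → Elt Q} {ζ : Conf fs f}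
    {ξ : ∀ i, Conf (gs i) (fs i)} (hζ : Allow ζ) (hξ : ∀ i, Allow (ξ i)) :
    Allow (comp ζ ξ) := by
  let M : LShape C := LShape.tens fun i => frames (gs i)
  let μ : SIso M.signed (SignedSet.sigma fun i => SignedSet.sigma fun j => (gs i j).fr) :=
    (LShape.tensIso fun i => frames (gs i)).trans (SIso.sigma fun i => confIso (gs i))
  unfold Allow comp
  rw [conj_comp _ μ.symm, conj_comp _ (confIso fs).symm (f.frameIso.symm)]
  refine LShape.Allow.comp (β := M) ?_ (LShape.Allow.comp (β := frames fs) ?_ hζ)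
  · rw [conj_ofSIso]
    refine LShape.allow_ofSIso (α := frames (concat gs)) (β := M)
      (TensorOf.reindex (split m) (fun p : Σ i, Fin (m i) =>
        ((Elt.frame Q).obj (gs p.1 p.2)).shape)
        (LShape.tensorOf_tens fun k => (Elt.frame Q).obj (concat gs k)))
      (TensorOf.nested (LShape.tensorOf_tens fun i => frames (gs i)) _ _
        fun i => LShape.tensorOf_tens fun j => (Elt.frame Q).obj (gs i j)) _ fun a => ?_
    refine (SIso.sigma fun p : Σ i, Fin (m i) => (gs p.1 p.2).frameIso).e.injective ?_
    refine (SIso.sigmaAssoc fun i j => (gs i j).fr).e.injective ?_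
    exact μ.e.apply_symm_apply _
  · have h1 := LShape.allow_sigma (α := M) (β := frames fs)
      (LShape.tensorOf_tens fun i => frames (gs i))
      (LShape.tensorOf_tens fun i => (Elt.frame Q).obj (fs i)) (LShape.tensIso _)
      (LShape.tensIso _) (fun _ => rfl) (fun _ => rfl)
      (fun i => conj (confIso (gs i)).symm (fs i).frameIso.symm (ξ i)) hξ
    refine (congrArg (fun ζ => LShape.Allow (α := M) (β := frames fs) ζ) ?_).mp h1
    refine eq_of_hsits_imp fun S i j h => hsits_conj.2 (hsits_sigmaMap.2 fun k =>
      hsits_conj.2 ?_)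
    exact hsits_sigmaMap.1 (hsits_conj.1 h) k

end Conf
end
open SignedSet Linking

section
variable {C : Type u} [Category.{v} C]

/-- Transport of the structure of a symmetric multicategory along bijections -/
def SymMulticat.transport (M : SymMulticat.{w} C)
    (H : ∀ {n : ℕ}, (Fin n → C) → C → Type w')
    (e : ∀ {n : ℕ} {x : Fin n → C} {y : C}, H x y ≃ M.Hom x y) : SymMulticat.{w'} C where
  Hom := H
  ι f := e.symm (M.ι f)
  comp f g := e.symm (M.comp (e f) fun i => e (g i))
  act σ h f := e.symm (M.act σ h (e f))
  act_refl f := by rw [M.act_refl, e.symm_apply_apply]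
  act_act σ τ h h' f := by rw [e.apply_symm_apply, M.act_act]
  id_comp f := by rw [e.apply_symm_apply, M.id_comp]
  comp_id f := by simp only [e.apply_symm_apply]; rw [M.comp_id]
  assoc f g h := by
    simp only [e.apply_symm_apply]
    exact congrArg e.symm (M.assoc (e f) (fun i => e (g i)) fun i j => e (h i j))
  comp_act f g σ h := by simp only [e.apply_symm_apply]; rw [M.comp_act]
  act_comp f g σ := by
    simp only [e.apply_symm_apply]
    exact congrArg e.symm (M.act_comp (e f) (fun i => e (g i)) σ)
  ι_comp f g := by simp only [e.apply_symm_apply]; rw [M.ι_comp]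

namespace LShape
variable {α β γ : LShape C}

def leftUnit (X : SignedSet C) : SIso X ((SignedSet.unit C).tensor X) :=
  (SIso.unitor X).trans (SIso.comm X (SignedSet.unit C))

theorem leftUnit_ai (α : LShape C) :
    AI (T := α.shape) (S := .tensor .unit α.shape) (leftUnit α.signed).forget := by
  have h := AI.trans (AI.unitor α.shape) (AI.comm α.shape .unit)
  refine (congrArg (fun e => AI (T := α.shape) (S := .tensor .unit α.shape) e) ?_).mp h
  exact SIso.ext fun _ => rfl

theorem Allow.leftUnit (α : LShape C) :
    Allow (β := (unit C).tensor α) (ofSIso (LShape.leftUnit α.signed)) :=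
  .ofAI (β := (LShape.unit C).tensor α) (leftUnit_ai α)

theorem Allow.leftUnit_symm (α : LShape C) :
    Allow (α := (unit C).tensor α) (ofSIso (LShape.leftUnit α.signed).symm) :=
  .ofAI (α := (LShape.unit C).tensor α) (e := (LShape.leftUnit α.signed).symm)
    (leftUnit_ai α).symm

end LShape

namespace Linking
variable {X Y : SignedSet C}

def unname (θ : SignedSet.unit C ⟶ X.hom Y) : X ⟶ Y :=
  ofSIso (LShape.leftUnit X) ≫ uncurry θ

def name (ξ : X ⟶ Y) : SignedSet.unit C ⟶ X.hom Y :=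
  curry (ofSIso (LShape.leftUnit X).symm ≫ ξ)

theorem name_unname (θ : SignedSet.unit C ⟶ X.hom Y) : name (unname θ) = θ := by
  unfold name unname
  rw [← Category.assoc, ofSIso_trans]
  have : (LShape.leftUnit X).symm.trans (LShape.leftUnit X) = SIso.refl _ :=
    SIso.ext fun a => (LShape.leftUnit X).e.apply_symm_apply a
  rw [this, ofSIso_refl, Category.id_comp]
  exact map_map_symm _ _

theorem unname_name (ξ : X ⟶ Y) : unname (name ξ) = ξ := by
  have h : uncurry (name ξ) = ofSIso (LShape.leftUnit X).symm ≫ ξ := map_symm_map _ _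
  unfold unname
  rw [h, ← Category.assoc, ofSIso_trans]
  have : (LShape.leftUnit X).trans (LShape.leftUnit X).symm = SIso.refl _ :=
    SIso.ext fun a => (LShape.leftUnit X).e.symm_apply_apply a
  rw [this, ofSIso_refl, Category.id_comp]

theorem conj_symm_conj {X' Y' : SignedSet C} (e : SIso X X') (f : SIso Y Y') (ξ : X' ⟶ Y') :
    conj e f (conj e.symm f.symm ξ) = ξ :=
  eq_of_hsits_imp fun S i j h => by
    refine hsits_conj.2 (hsits_conj.2 (h.congr (fun a => ?_) (fun a => ?_)))
    · exact congrArg i (e.e.apply_symm_apply a).symm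
    · exact congrArg j (f.e.apply_symm_apply a).symm

theorem conj_conj_symm {X' Y' : SignedSet C} (e : SIso X X') (f : SIso Y Y') (ξ : X ⟶ Y) :
    conj e.symm f.symm (conj e f ξ) = ξ :=
  conj_symm_conj e.symm f.symm ξ

end Linking

namespace LShape
variable {α β γ : LShape C}

/-- Morphisms `I ⟶ [α, β]` correspond to morphisms `α ⟶ β`. -/
def unname : (unit C ⟶ α.hom β) ≃ (α ⟶ β) where
  toFun θ := ⟨Linking.unname θ.1,
    (Allow.leftUnit α).comp (β := (unit C).tensor α) (Allow.uncurry θ.2)⟩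
  invFun ξ := ⟨Linking.name ξ.1,
    Allow.curry (α := unit C) ((Allow.leftUnit_symm α).comp (α := (unit C).tensor α) ξ.2)⟩
  left_inv θ := Subtype.ext (name_unname (X := α.signed) (Y := β.signed) θ.1)
  right_inv ξ := Subtype.ext (unname_name ξ.1)

end LShape

variable (Q : SymMulticat.{w} C)

/-- The symmetric multicategory of allowable configurations whose composite is the target -/
def SymMulticat.conf : SymMulticat.{v} (Elt Q) where
  Hom fs f := {ζ : Conf fs f // ζ.Allow ∧ Composes ζ}
  ι γ := ⟨.one γ, Conf.allow_one γ, Conf.composes_one γ⟩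
  comp ζ ξ := ⟨.comp ζ.1 fun i => (ξ i).1, Conf.allow_comp ζ.2.1 fun i => (ξ i).2.1,
    Conf.composes_comp ζ.2.2 fun i => (ξ i).2.2⟩
  act σ h ζ := ⟨.act σ h ζ.1, Conf.allow_act ζ.2.1, Conf.composes_act ζ.2.2⟩
  act_refl ζ := Subtype.ext (Conf.act_refl ζ.1)
  act_act σ τ h h' ζ := Subtype.ext (Conf.act_act σ τ h h' ζ.1)
  id_comp ζ := Subtype.ext (Conf.id_comp ζ.1)
  comp_id ζ := Subtype.ext (Conf.comp_id ζ.1)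
  assoc ζ ξ η := Subtype.ext (Conf.assoc ζ.1 (fun i => (ξ i).1) fun i j => (η i j).1)
  comp_act ζ ξ σ h := Subtype.ext (Conf.comp_act ζ.1 (fun i => (ξ i).1) σ h)
  act_comp ζ ξ σ := Subtype.ext (Conf.act_comp ζ.1 (fun i => (ξ i).1) σ)
  ι_comp γ δ := Subtype.ext (Conf.one_comp γ δ)

variable {Q}

/-- The configuration given by an allowable graph `I ⟶ [φ f₁ ⊗ ⋯ ⊗ φ fₙ, φ f]`, where `φ` is the
frame functor -/
noncomputable def Conf.ofName {n : ℕ} {fs : Fin n → Elt Q} {f : Elt Q} :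
    (LShape.unit C ⟶ (LShape.Amap (Elt.frame Q)).obj (LShape.arrow fs f)) ≃
      {ζ : Conf fs f // ζ.Allow} :=
  ((Iso.homToEquiv (eqToIso (LShape.Amap_arrow (Elt.frame Q) fs f)).symm).symm).trans <|
    LShape.unname.trans
    ⟨fun ξ => ⟨conj (Conf.confIso fs) f.frameIso ξ.1,
        (congrArg (fun ζ => LShape.Allow (α := Conf.frames fs) (β := (Elt.frame Q).obj f) ζ)
          (conj_conj_symm _ _ ξ.1)).mpr ξ.2⟩,
      fun ζ => ⟨conj (Conf.confIso fs).symm f.frameIso.symm ζ.1, ζ.2⟩,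
      fun ξ => Subtype.ext (conj_conj_symm _ _ ξ.1), fun ζ => Subtype.ext (conj_symm_conj _ _ ζ.1)⟩

/-- The slice multicategory `Q⁺`. Its objects are the arrows of `Q`, and an arrow `f₁, …, fₙ ⟶ f`
is an allowable graph `I ⟶ [φ f₁ ⊗ ⋯ ⊗ φ fₙ, φ f]` such that composing the `fₖ` in this configuration
gives `f`. -/
noncomputable def SymMulticat.slice (Q : SymMulticat.{w} C) : SymMulticat.{v} (Elt Q) :=
  (SymMulticat.conf Q).transport
    (fun {n} fs f => {θ : LShape.unit C ⟶ (LShape.Amap (Elt.frame Q)).obj (LShape.arrow fs f) //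
      Composes (Conf.ofName θ).1})
    (fun {n fs f} => (Equiv.subtypeEquiv Conf.ofName (q := fun ζ => Composes ζ.1)
      fun _ => Iff.rfl).trans (Equiv.subtypeSubtypeEquivSubtypeInter
        (fun ζ : Conf fs f => ζ.Allow) fun ζ => Composes ζ))

end
end KML

/-! Write `φ` for `frame Q` and `φ⁺` for `frame Q.slice`. An arrow `θ` of the slice is sent to the
pair formed by its frame and its underlying graph, and a morphism `m` to the graph `φ⁺ m`. Once this
is a functor into the comma category, it remains to see that it is injective on objects, faithful
and full; the subcategory is the full one on its image. The statement about frame functors then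
holds by construction, because the component of the functor in `A(elt Q)` is `φ⁺` itself.

Functoriality is the equation `θ' = θ ≫ Aφ(φ⁺ m)` for `m : θ ⟶ θ'` (`slice_arrow`). By definition of
a morphism of elements, `θ'` arises from `θ` by permuting the inputs and composing with the unary
arrows of `m.src i` and `m.tgt`. In the slice, composing with the unary arrow of `γ` means composing
configurations with the graph `frMap γ` (`conf_eq`). On the other side, `φ⁺ m` has one edge for each
`m.src i` and one for `m.tgt`, and `Aφ` replaces an edge labelled `γ` by the graph `φ γ`
(`hsits_Amap_frame`). Both sides thus glue the same wires. They are compared by realizing graphs as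
paths in a common system of wires, which determines a composite (`eq_comp`).

Injectivity on objects holds because the labelled shape `[x₁ ⊗ ⋯ ⊗ xₙ, y]` determines the list and
`y` (`arrow_injective`). Faithfulness holds because the permutation and the morphisms of `m` can be
read off from the edges of its graph (`frame_map_injective`).

Fullness is the substantial point: an allowable graph `[x₁ ⊗ ⋯ ⊗ xₙ, y] ⟶ [x'₁ ⊗ ⋯ ⊗ x'ₙ', y']` must
consist of an edge from `y` to `y'` and of edges that match the `x'ₖ` with the `xᵢ`
(`exists_frame_map`). The variances leave only one other possibility, an edge from `y` to some `xₖ`,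
and allowability excludes it (`not_edge`). Given such a matching, the comma triangle and
`slice_arrow` compute the same target arrow, so the matching is a morphism of elements.

To exclude the edge, shapes are evaluated in the residuated commutative monoid on `{-1, 0, 1}` with
unit 0. Every allowable graph is a valid inequality between values as soon as the two ends of each
edge have the same value (`Allowable.valLE`). If `y` were joined to `xₖ`, then the value 1 on these
two variables and 0 on all others would give the source the value 1 and the target the value 0. The
unit must not be the greatest element for this to work: in a Boolean algebra the source could not
exceed the unit. -/

namespace KML
open SignedSet Linking

/-! ### Values of shapes in a residuated commutative monoid with three elements -/

/-- The commutative multiplication on `{-1, 0, 1}` with unit `0` and absorbing element `-1` -/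
def tmul (a b : SignType) : SignType := if a = -1 ∨ b = -1 then -1 else max a b

/-- The residual of `tmul` -/
def thom (a b : SignType) : SignType := -tmul a (-b)

namespace Shape

/-- The value of a shape, given values of its variables -/
def val : (T : Shape) → (T.Var → SignType) → SignType
  | unit, _ => 0
  | one, v => v ()
  | tensor T S, v => tmul (T.val fun a => v (.inl a)) (S.val fun a => v (.inr a))
  | hom T S, v => thom (T.val fun a => v (.inl a)) (S.val fun a => v (.inr a))

end Shape

section
variable {T S R T' S' : Shape}

/-- Values which agree on the two ends of each edge -/
def Balanced (ξ : T.signed ⟶ S.signed) (v : T.Var ⊕ S.Var → SignType) : Prop :=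
  ∀ a b, Joined ξ a b → v a = v b

/-- Validity of the graph in the three-element model. The ends of an edge are treated as two
occurrences of one atom, so variances enter only through `val`, by way of `thom`. -/
def ValLE (ξ : T.signed ⟶ S.signed) : Prop :=
  ∀ v, Balanced ξ v → T.val (fun a => v (.inl a)) ≤ S.val fun a => v (.inr a)

theorem Balanced.of_ofSIso {e : SIso T.signed S.signed} {v : T.Var ⊕ S.Var → SignType}
    (h : Balanced (ofSIso e) v) (a : T.Var) : v (.inl a) = v (.inr (e.e a)) := by
  cases hs : T.sign a
  · exact (h _ _ ((joined_ofSIso e a).2 hs)).symm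
  · exact h _ _ ((joined_ofSIso e a).1 hs)

/-- A balanced valuation on the graph of a relabelling is determined by its values on the target,
which reduces validity to an inequality between two expressions in the same atoms. -/
theorem ValLE.ofSIso {e : SIso T.signed S.signed}
    (h : ∀ v : S.Var → SignType, T.val (fun a => v (e.e a)) ≤ S.val v) : ValLE (ofSIso e) := by
  intro v hv
  have : (fun a => v (.inl a)) = fun a => v (.inr (e.e a)) := funext fun a => hv.of_ofSIso a
  rw [this]
  exact h fun a => v (.inr a)

theorem ValLE.id (T : Shape) : ValLE (𝟙 T.signed) := by
  rw [← ofSIso_refl]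
  exact .ofSIso fun v => le_rfl

/-- Transitivity of the order, once a balanced valuation of the composite has been extended to the
variables of the middle shape so as to be balanced for both factors. -/
theorem ValLE.comp {ξ : T.signed ⟶ S.signed} {η : S.signed ⟶ R.signed} (h : ValLE ξ)
    (h' : ValLE η) : ValLE (ξ ≫ η) := by
  intro v hv
  -- Each point takes the value at the positive outer end of the path through it. Middle variables
  -- on closed loops have no such end; their value 0 is arbitrary, since only constancy along steps
  -- matters.
  let M : T.Var ⊕ S.Var ⊕ R.Var → SignType := fun p => (SubstComp.tgt ξ η p).elim 0 v
  -- A positive outer point is its own end. A negative one is joined in the composite to the end of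
  -- its path, where `v` has the same value by balance.
  have hM : ∀ b, M (SubstComp.out b) = v b := by
    intro b
    cases hs : SubstComp.osign b
    · obtain ⟨b', h, j⟩ := SubstComp.tgt_neg (ξ := ξ) (η := η) hs
      change (SubstComp.tgt ξ η _).elim 0 v = _
      rw [h]
      exact (hv _ _ j).symm
    · change (SubstComp.tgt ξ η _).elim 0 v = _
      rw [SubstComp.tgt_pos hs]; rfl
  have hstep : ∀ {p q}, SubstComp.Step ξ η p q → M p = M q := fun s =>
    congrArg (fun o : Option _ => o.elim 0 v) (SubstComp.tgt_step s)
  have h1 := h (fun a => M (embL T.signed S.signed R.signed a))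
    fun a b ⟨c, d, f, e⟩ => hstep ⟨c, d, f, .left e⟩
  have h2 := h' (fun a => M (embR T.signed S.signed R.signed a))
    fun a b ⟨c, d, f, e⟩ => hstep ⟨c, d, f, .right e⟩
  have e1 : (fun a => v (.inl a)) = fun a => M (.inl a) := funext fun a => (hM (.inl a)).symm
  have e2 : (fun a => v (.inr a)) = fun a => M (.inr (.inr a)) :=
    funext fun a => (hM (.inr a)).symm
  rw [e1, e2]
  exact h1.trans h2

/-- This and the next six facts are the laws of an ordered commutative monoid with residuals, one
for each way of generating allowable graphs. -/
theorem tmul_mono : ∀ {a b c d : SignType}, a ≤ b → c ≤ d → tmul a c ≤ tmul b d := by decide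
theorem thom_mono : ∀ {a b c d : SignType}, b ≤ a → c ≤ d → thom a c ≤ thom b d := by decide
theorem tmul_assoc : ∀ a b c, tmul (tmul a b) c = tmul a (tmul b c) := by decide
theorem tmul_zero : ∀ a, tmul a 0 = a := by decide
theorem tmul_comm : ∀ a b, tmul a b = tmul b a := by decide
-- Unit of the adjunction between `tmul · b` and `thom b`, which interprets the coevaluation graph;
-- the next fact is the counit, for the evaluation graph.
theorem le_thom : ∀ a b, a ≤ thom b (tmul a b) := by decide
theorem thom_tmul_le : ∀ a b, tmul (thom a b) a ≤ b := by decide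

theorem Balanced.id {v : T.Var ⊕ T.Var → SignType} (h : Balanced (𝟙 T.signed) v) (a : T.Var) :
    v (.inl a) = v (.inr a) := by
  cases hs : T.sign a
  · exact (h _ _ ((joined_id a).2 hs)).symm
  · exact h _ _ ((joined_id a).1 hs)

/-- Soundness of the model, by induction on the generation of the graph: closure under `⊗` and `[ ,
]` is monotonicity, the structural isomorphisms are the monoid laws, and (co)evaluation is
residuation. -/
theorem Allowable.valLE {ξ : T.signed ⟶ S.signed} (h : Allowable ξ) : ValLE ξ := by
  induction h with
  | id T => exact .id T
  | comp _ _ h h' => exact h.comp h'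
  | tensor _ _ h h' =>
    intro v hv
    refine tmul_mono (h (fun a => v (Sum.map Sum.inl Sum.inl a)) fun a b j => ?_)
      (h' (fun a => v (Sum.map Sum.inr Sum.inr a)) fun a b j => ?_)
    · exact hv _ _ (j.tensor_left _)
    · exact hv _ _ (j.tensor_right _)
  | hom _ _ h h' =>
    intro v hv
    -- The first argument of `[ , ]` is contravariant: the source of the first graph is found in the
    -- target of `[ξ, η]` and its target in the source.
    refine thom_mono (h (fun a => v (Sum.elim (fun a => .inr (.inl a)) (fun a => .inl (.inl a)) a))
      fun a b j => ?_) (h' (fun a => v (Sum.map Sum.inr Sum.inr a)) fun a b j => ?_)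
    · exact hv _ _ (j.hom_left _)
    · exact hv _ _ (j.hom_right _)
  | assoc T S R =>
    exact .ofSIso (T := .tensor (.tensor T S) R) (S := .tensor T (.tensor S R))
      fun v => (tmul_assoc _ _ _).le
  | assoc_inv T S R =>
    exact .ofSIso (T := .tensor T (.tensor S R)) (S := .tensor (.tensor T S) R)
      fun v => (tmul_assoc _ _ _).ge
  | unitor T => exact .ofSIso (S := .tensor T .unit) fun v => (tmul_zero _).ge
  | unitor_inv T => exact .ofSIso (T := .tensor T .unit) fun v => (tmul_zero _).le
  | comm T S => exact .ofSIso (T := .tensor T S) (S := .tensor S T) fun v => (tmul_comm _ _).le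
  | coev T S =>
    intro v hv
    -- The coevaluation graph is the curried identity of `T ⊗ S`. Its edges are those of the
    -- identity with rebracketed ends, so `v` takes the same values on the two copies of `T` and on
    -- the two copies of `S`.
    have h := Balanced.id (T := .tensor T S) (v := fun a => v (Equiv.sumAssoc _ _ _ a))
      fun a b j => hv _ _ (joined_curry (T := T) (S := S) (R := .tensor T S) j)
    have h1 : (fun a => v (.inl a)) = fun a => v (.inr (.inr (.inl a))) :=
      funext fun a => h (.inl a)
    have h2 : (fun a => v (.inr (.inl a))) = fun a => v (.inr (.inr (.inr a))) :=
      funext fun a => h (.inr a)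
    refine (le_thom _ (S.val fun a => v (.inr (.inl a)))).trans_eq ?_
    change _ = thom (S.val fun a => v (.inr (.inl a))) (tmul (T.val fun a => v (.inr (.inr (.inl a))))
      (S.val fun a => v (.inr (.inr (.inr a)))))
    rw [h1, h2]
  | ev T S =>
    intro v hv
    -- Likewise, the evaluation graph is the uncurried identity of `[T, S]`.
    have h := Balanced.id (T := .hom T S) (v := fun a => v ((Equiv.sumAssoc _ _ _).symm a))
      fun a b j => hv _ _ (joined_uncurry (T := .hom T S) (S := T) (R := S) j)
    have h1 : (fun a => v (.inl (.inl (.inl a)))) = fun a => v (.inl (.inr a)) :=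
      funext fun a => h (.inl a)
    have h2 : (fun a => v (.inl (.inl (.inr a)))) = fun a => v (.inr a) :=
      funext fun a => h (.inr a)
    refine Eq.trans_le ?_ (thom_tmul_le (T.val fun a => v (.inl (.inr a))) _)
    change tmul (thom (T.val fun a => v (.inl (.inl (.inl a))))
      (S.val fun a => v (.inl (.inl (.inr a))))) (T.val fun a => v (.inl (.inr a))) = _
    rw [h1, h2]

end

/-! ### Edges of allowable graphs between frames -/

namespace LShape
variable {C : Type u} [Category.{v} C]

/-- On nonnegative values the multiplication is the maximum, so a tensor product of variables is at
least as large as each of them. Nonnegativity is essential, because -1 is absorbing. -/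
theorem val_tens : {n : ℕ} → (x : Fin n → C) →
    (v : (tens fun i => of (x i)).shape.Var → SignType) → (∀ a, 0 ≤ v a) →
    0 ≤ (tens fun i => of (x i)).shape.val v ∧ ∀ a, v a ≤ (tens fun i => of (x i)).shape.val v
  | 0, _, _, _ => ⟨le_rfl, fun a => a.elim⟩
  | 1, _, _, h => ⟨h (), fun _ => le_rfl⟩
  | n + 2, x, v, h => by
    obtain ⟨h1, h2⟩ := val_tens (fun i : Fin (n + 1) => x i.succ) (fun a => v (.inr a))
      fun a => h (.inr a)
    have H : ∀ a b : SignType, 0 ≤ a → 0 ≤ b → 0 ≤ tmul a b ∧ a ≤ tmul a b ∧ b ≤ tmul a b := by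
      decide
    obtain ⟨h3, h4, h5⟩ := H _ _ (h (.inl ())) h1
    refine ⟨h3, ?_⟩
    rintro (a | a)
    · exact h4
    · exact (h2 a).trans h5

theorem val_tens_zero : {n : ℕ} → (x : Fin n → C) →
    (tens fun i => of (x i)).shape.val (fun _ => 0) = 0
  | 0, _ => rfl
  | 1, _ => rfl
  | n + 2, x => congrArg (tmul 0) (val_tens_zero fun i : Fin (n + 1) => x i.succ)

/-- In an allowable graph `[⊗ₖ xₖ, y] ⟶ [⊗ₖ x'ₖ, y']` no edge joins `y` with an `xₖ`. -/
theorem not_edge {n n' : ℕ} {x : Fin n → C} {y : C} {x' : Fin n' → C} {y' : C}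
    (ξ : arrow x y ⟶ arrow x' y') (a : (tens fun i => of (x i)).shape.Var) {c d : C} {h : c ⟶ d} :
    ¬ Edge (X := (arrow x y).signed.hom (arrow x' y').signed) ξ.1
      (.inl (.inr ())) (.inl (.inl a)) h := by
  classical
  intro e
  -- The value 1 marks the two ends of the supposed edge `e`, and every other variable has the value
  -- of the unit.
  let v : (arrow x y).shape.Var ⊕ (arrow x' y').shape.Var → SignType := fun p =>
    if p = .inl (.inr ()) ∨ p = .inl (.inl a) then 1 else 0
  have hb : Balanced (T := (arrow x y).shape) (S := (arrow x' y').shape) (forgetHom ξ.1) v := by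
    rintro p q ⟨_, _, _, r⟩
    obtain ⟨_, _, _, r⟩ :=
      (forget_Edge (X := (arrow x y).signed.hom (arrow x' y').signed) (θ := ξ.1)).1 r
    -- Since variables are matched perfectly, an edge `r` that meets a marked variable is `e`
    -- itself: sharing the source or the target with `e` forces the other end, while the source of
    -- one cannot be the target of the other, by their signs. Hence both ends of `r` are marked or
    -- neither is.
    by_cases hp : p = .inl (.inr ())
    · subst hp
      obtain ⟨rfl, -⟩ := Edge.unique (X := (arrow x y).signed.hom (arrow x' y').signed) r e
      simp [v]
    · have hq : q ≠ .inl (.inl a) := by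
        rintro rfl
        exact hp (Edge.unique' (X := (arrow x y).signed.hom (arrow x' y').signed) r e)
      have hp' : p ≠ .inl (.inl a) := by
        rintro rfl
        have h1 := Edge.neg (X := (arrow x y).signed.hom (arrow x' y').signed) r
        have h2 := Edge.pos (X := (arrow x y).signed.hom (arrow x' y').signed) e
        exact Bool.noConfusion (h1.symm.trans h2)
      have hq' : q ≠ .inl (.inr ()) := by
        rintro rfl
        have h1 := Edge.pos (X := (arrow x y).signed.hom (arrow x' y').signed) r
        have h2 := Edge.neg (X := (arrow x y).signed.hom (arrow x' y').signed) e
        exact Bool.noConfusion (h1.symm.trans h2)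
      simp [v, hp, hq, hp', hq']
  have H := Allowable.valLE (T := (arrow x y).shape) (S := (arrow x' y').shape) ξ.2 v hb
  -- The tensor product contains a marked variable, so its value is at least 1, and so is that of
  -- the marked `y`. The residual of 1 by 1 is 1, because -1 absorbs in `-tmul 1 (-1)`.
  have h1 : (arrow x y).shape.val (fun p => v (.inl p)) = 1 := by
    have ha := (val_tens x (fun a => v (.inl (.inl a))) fun a => by
      simp only [v]; split <;> decide).2 a
    have : ∀ s t : SignType, 1 ≤ s → t = 1 → thom s t = 1 := by decide
    exact this _ _ (le_trans (by simp [v]) ha) (if_pos (.inl rfl))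
  -- Both marked variables lie in the source, so the target is built from zeros only, and 0 is the
  -- unit.
  have h2 : (arrow x' y').shape.val (fun p => v (.inr p)) = 0 := by
    have : (fun p => v (.inr p)) = fun _ => 0 := funext fun p => by simp [v]
    rw [this]
    exact congrArg (fun s => thom s 0) (val_tens_zero x')
  have h3 : (1 : SignType) ≤ 0 := h1.symm.le.trans (H.trans h2.le)
  exact absurd h3 (by decide)

end LShape

/-! ### The frame functor on morphisms: faithfulness, and lifting of allowable graphs -/

namespace Elt
variable {C : Type u} [Category.{v} C] {Q : SymMulticat.{w} C}

/-- In one and the same graph, the edge that starts at the `k`-th input of `g` ends at the input of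
`f` given by the permutation and carries the `k`-th source morphism; the edge that starts at the
output of `f` carries the target morphism. All data of the morphism can therefore be recovered. -/
theorem frMap_injective {f g : Elt Q} {m m' : f ⟶ g} (h : frMap m = frMap m') : m = m' := by
  obtain ⟨h1, h2⟩ := hsits_frMap.1 (hsits_self (frMap m))
  have h' : HSits (frMap m') (hsys (frMap m)) Sum.inl Sum.inr := by
    rw [← h]; exact hsits_self _
  obtain ⟨h1', h2'⟩ := hsits_frMap.1 h'
  -- Edges start at negative variables. Positive ones therefore end every path, and a path to a
  -- positive point is determined, with its label, by its starting point.
  have term : ∀ b, (f.fr.hom g.fr).sign b = true → (hsys (frMap m)).Terminal b :=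
    fun b hb _ _ _ _ s => Bool.noConfusion (hb.symm.trans s.neg)
  have hs := fun k => Sys.Path.unique (h1 k) (h1' k) (term _ rfl) (term _ rfl)
  have ht := Sys.Path.unique h2 h2' (term _ rfl) (term _ rfl)
  have hp : m.perm = m'.perm := Equiv.ext fun k => by
    have := (hs k).1
    simpa using this
  obtain ⟨p, s, t, c⟩ := m
  obtain ⟨p', s', t', c'⟩ := m'
  obtain rfl : p = p' := hp
  obtain rfl : s = s' := funext fun k => eq_of_heq (hs k).2
  obtain rfl : t = t' := eq_of_heq ht.2
  rfl

theorem frame_map_injective {f g : Elt Q} {m m' : f ⟶ g}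
    (h : (frame Q).map m = (frame Q).map m') : m = m' := by
  have h' : conj f.frIso.symm g.frIso.symm (frMap m) = conj f.frIso.symm g.frIso.symm (frMap m') :=
    congrArg Subtype.val h
  have h2 := congrArg (conj f.frIso g.frIso) h'
  rw [conj_symm_conj, conj_symm_conj] at h2
  exact frMap_injective h2

/-- Every allowable graph between frames is the image of a morphism. -/
theorem exists_frame_map (f g : Elt Q) (ξ : (frame Q).obj f ⟶ (frame Q).obj g) :
    ∃ (q : Q.Hom g.src g.tgt) (m : f ⟶ (⟨g.arity, g.src, g.tgt, q⟩ : Elt Q)),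
      (frame Q).map m = ξ := by
  let η : f.fr ⟶ g.fr := conj f.frIso g.frIso ξ.1
  let E : ∀ (a b : (f.fr.hom g.fr).Var) {c d : C}, (c ⟶ d) → Prop :=
    fun a b _ _ h => Edge (X := f.fr.hom g.fr) η a b h
  -- This is the only place where allowability is needed; the rest follows from the variances and
  -- from uniqueness of mates.
  have hne : ∀ {k : Fin f.arity} {c d : C} {h : c ⟶ d},
      ¬ E (.inl (.inr ())) (.inl (.inl ⟨k, ()⟩)) h := by
    intro k c d h e
    exact LShape.not_edge ξ _ (map_Edge.1 e)
  -- In `[f.fr, g.fr]` the negative variables are the output of `f` and the inputs of `g`; the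
  -- positive ones are the inputs of `f` and the output of `g`. As `hne` excludes the inputs of `f`,
  -- the output of `f` is joined to the output of `g`.
  obtain ⟨b, t, et⟩ := Linking.exists_of_neg (X := f.fr.hom g.fr) η (.inl (.inr ())) rfl
  have et' : E _ _ t := .mk et
  obtain rfl : b = .inr (.inr ()) := by
    rcases b with (⟨k, ⟨⟩⟩ | ⟨⟨⟩⟩) | (⟨k, ⟨⟩⟩ | ⟨⟨⟩⟩)
    · exact (hne et').elim
    · cases et'.pos
    · cases et'.pos
    · rfl
  have hs : ∀ k : Fin g.arity, ∃ (i : Fin f.arity) (s : g.src k ⟶ f.src i),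
      E (.inr (.inl ⟨k, ()⟩)) (.inl (.inl ⟨i, ()⟩)) s := by
    intro k
    obtain ⟨b, s, es⟩ := Linking.exists_of_neg (X := f.fr.hom g.fr) η (.inr (.inl ⟨k, ()⟩)) rfl
    have es' : E _ _ s := .mk es
    rcases b with (⟨i, ⟨⟩⟩ | ⟨⟨⟩⟩) | (⟨i, ⟨⟩⟩ | ⟨⟨⟩⟩)
    · exact ⟨i, s, es'⟩
    · cases es'.pos
    · cases es'.pos
    -- The output of `g` already has the output of `f` as its mate, so no input of `g` is joined to
    -- it.
    · cases es'.unique' et'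
  choose σ s es using hs
  have inj : Function.Injective σ := by
    intro k k' h
    -- The ends `i` and `i'` are kept general so that their equality can be substituted into the
    -- types of the edge labels.
    have : ∀ {i i'} {s : g.src k ⟶ f.src i} {s' : g.src k' ⟶ f.src i'}, i = i' →
        E (.inr (.inl ⟨k, ()⟩)) (.inl (.inl ⟨i, ()⟩)) s →
        E (.inr (.inl ⟨k', ()⟩)) (.inl (.inl ⟨i', ()⟩)) s' → k = k' := by
      rintro i _ s s' rfl e1 e2
      cases e1.unique' e2
      rfl
    exact this h (es k) (es k')
  -- The mate of an input of `f` is negative. It is not the output of `f`, by `hne`, so it is an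
  -- input `k` of `g`, and uniqueness identifies its edge with the one that defines `σ k`.
  have surj : Function.Surjective σ := by
    intro i
    obtain ⟨a, h, ea⟩ := Linking.exists_of_pos (X := f.fr.hom g.fr) η (.inl (.inl ⟨i, ()⟩)) rfl
    have ea' : E _ _ h := .mk ea
    rcases a with (⟨i', ⟨⟩⟩ | ⟨⟨⟩⟩) | (⟨k, ⟨⟩⟩ | ⟨⟨⟩⟩)
    · cases ea'.neg
    · exact (hne ea').elim
    · have := (ea'.unique (es k)).1
      simp only [Sum.inl.injEq, Sigma.mk.injEq] at this
      exact ⟨k, this.1.symm⟩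
    · cases ea'.neg
  let p := Equiv.ofBijective σ ⟨inj, surj⟩
  -- A graph between frames knows nothing of the arrow of `g`. The arrow is therefore replaced by
  -- the one that the matching produces from `f.arrow`, which makes the condition on a morphism hold
  -- by definition.
  let q : Q.Hom g.src g.tgt := Q.post t (Q.pre s (Q.act p (fun _ => rfl) f.arrow))
  let m : f ⟶ (⟨g.arity, g.src, g.tgt, q⟩ : Elt Q) := ⟨p, s, t, rfl⟩
  refine ⟨q, m, Subtype.ext ?_⟩
  have key : frMap m = η := eq_of_hsits (hsits_frMap.2
    ⟨fun k => Sys.Path.of_step (S := hsys η) (es k), Sys.Path.of_step (S := hsys η) et'⟩)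
  have := congrArg (conj f.frIso.symm g.frIso.symm) key
  exact this.trans (conj_conj_symm f.frIso g.frIso ξ.1)

end Elt

section
variable {C : Type u} [Category.{v} C] {D : Type u'} [Category.{v'} D]

/-! ### Transport along equalities of labelled shapes -/

namespace LShape
variable {α α' α'' β β' : LShape C}

/-- The shape `Aφ [f₁ ⊗ ⋯ ⊗ fₙ, f]` equals `[φ f₁ ⊗ ⋯ ⊗ φ fₙ, φ f]` only by a recursive proof. This
bijection makes it possible to follow single variables through such an equality. -/
def castIso (h : α = α') : SIso α.signed α'.signed := h ▸ SIso.refl α.signed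

theorem castIso_trans (h : α = α') (h' : α' = α'') (a : α.shape.Var) :
    (castIso (h.trans h')).e a = (castIso h').e ((castIso h).e a) := by
  subst h h'; rfl

theorem castIso_heq (h : α = α') (a : α.shape.Var) : HEq ((castIso h).e a) a := by
  subst h; rfl

theorem castIso_tensor_inl (h : α = α') (h' : β = β') (H : α.tensor β = α'.tensor β')
    (a : α.shape.Var) : (castIso H).e (.inl a) = .inl ((castIso h).e a) := by
  subst h h'; rfl

theorem castIso_tensor_inr (h : α = α') (h' : β = β') (H : α.tensor β = α'.tensor β')
    (a : β.shape.Var) : (castIso H).e (.inr a) = .inr ((castIso h').e a) := by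
  subst h h'; rfl

theorem castIso_hom_inl (h : α = α') (h' : β = β') (H : α.hom β = α'.hom β')
    (a : α.shape.Var) : (castIso H).e (.inl a) = .inl ((castIso h).e a) := by
  subst h h'; rfl

theorem castIso_hom_inr (h : α = α') (h' : β = β') (H : α.hom β = α'.hom β')
    (a : β.shape.Var) : (castIso H).e (.inr a) = .inr ((castIso h').e a) := by
  subst h h'; rfl

/-- For equalities in which the shapes agree definitionally and only the labellings have to be
compared: such equalities move no variable. -/
theorem castIso_label {T : Shape} {l l' : T.Var → C} (h : LShape.mk T l = LShape.mk T l')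
    (a : T.Var) : (castIso h).e a = a := by
  cases h; rfl

/-- Turns the coercion inside `Conf.ofName` into a graph of a relabelling, to which the criteria for
realization by paths apply. -/
theorem eqToHom_val (h : α = α') : (eqToHom h).1 = ofSIso (castIso h) := by
  subst h; exact ofSIso_refl.symm

theorem Amap_tens (F : C ⥤ LShape D) {n : ℕ} (x : Fin n → C) :
    (Amap F).obj (tens fun i => of (x i)) = tens fun i => F.obj (x i) := by
  change bind ((relabel F).obj _) = _
  rw [relabel_tens, bind_tens]
  rfl

/-- Serves to compare families of points indexed by the variables of two labels which are equal, but
not by definition, such as the label of an edge end and the object found there. -/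
theorem heq_of_apply {c c' : LShape D} (h : c = c') {V : Type} {i : c.shape.Var → V}
    {i' : c'.shape.Var → V} (H : ∀ p p', HEq p p' → i p = i' p') : HEq i i' := by
  subst h
  exact heq_of_eq (funext fun p => H p p HEq.rfl)

/-- The index of a variable of an iterated tensor product of substituted shapes -/
theorem tensVar_castIso (F : C ⥤ LShape D) : {n : ℕ} → (x : Fin n → C) →
    (a : (tens fun i => of (x i)).shape.Var) →
    (p : (F.obj ((tens fun i => of (x i)).label a)).shape.Var) → (k : Fin n) →
    (hk : (tensVar _ a).1 = k) → (p' : (F.obj (x k)).shape.Var) → HEq p p' →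
    tensVar (fun i => F.obj (x i)) ((castIso (Amap_tens F x)).e
      ((tens fun i => of (x i)).shape.glue (fun a => (F.obj ((tens fun i => of (x i)).label a)).shape)
        a p)) = ⟨k, p'⟩
  | 0, _, a, _, _, _, _, _ => a.elim
  | 1, x, a, p, k, hk, p', hp => by
    subst hk
    exact Sigma.ext rfl ((castIso_heq (Amap_tens F x) _).trans hp)
  | n + 2, x, .inl a, p, k, hk, p', hp => by
    subst hk
    -- The equality `Amap_tens F x` is factored as `e1`, whose two sides have the same shape so that
    -- variables stay fixed, followed by `e2`, which acts on the second tensor factor alone. By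
    -- proof irrelevance the casts compose.
    have e1 : (Amap F).obj (tens fun i => of (x i)) =
        (F.obj (x 0)).tensor ((Amap F).obj (tens fun i : Fin (n + 1) => of (x i.succ))) := by
      change LShape.mk _ _ = LShape.mk _ _
      congr 1
      funext a; rcases a with a | a <;> rfl
    have e2 := congrArg ((F.obj (x 0)).tensor) (Amap_tens F fun i : Fin (n + 1) => x i.succ)
    have h1 := castIso_label e1 (.inl p)
    have h2 := castIso_tensor_inl rfl (Amap_tens F fun i : Fin (n + 1) => x i.succ) e2 p
    have h3 := (castIso_trans e1 e2 (.inl p)).trans ((congrArg _ h1).trans h2)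
    exact (congrArg (tensVar fun i => F.obj (x i)) h3).trans (Sigma.ext rfl hp)
  | n + 2, x, .inr a, p, k, hk, p', hp => by
    subst hk
    have e1 : (Amap F).obj (tens fun i => of (x i)) =
        (F.obj (x 0)).tensor ((Amap F).obj (tens fun i : Fin (n + 1) => of (x i.succ))) := by
      change LShape.mk _ _ = LShape.mk _ _
      congr 1
      funext a; rcases a with a | a <;> rfl
    have e2 := congrArg ((F.obj (x 0)).tensor) (Amap_tens F fun i : Fin (n + 1) => x i.succ)
    let q := (tens fun i : Fin (n + 1) => of (x i.succ)).shape.glue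
      (fun a => (F.obj ((tens fun i : Fin (n + 1) => of (x i.succ)).label a)).shape) a p
    have h1 := castIso_label e1 (.inr q)
    have h2 := castIso_tensor_inr rfl (Amap_tens F fun i : Fin (n + 1) => x i.succ) e2 q
    have h3 := (castIso_trans e1 e2 (.inr q)).trans ((congrArg _ h1).trans h2)
    refine (congrArg (tensVar fun i => F.obj (x i)) h3).trans ?_
    -- A variable of the second tensor factor has its index computed in the tail of the list, and
    -- that index is then shifted by one.
    have ih := tensVar_castIso F (fun i : Fin (n + 1) => x i.succ) a p _ rfl p' hp
    exact congrArg (fun s : Σ i : Fin (n + 1), (F.obj (x i.succ)).shape.Var =>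
      (⟨s.1.succ, s.2⟩ : Σ i : Fin (n + 2), (F.obj (x i)).shape.Var)) ih

/-- The same factorization as for tensor products: a comparison of labellings that moves no
variable, then the equality `Amap_tens` in the first argument of `[ , ]`. -/
theorem castIso_arrow_inl (F : C ⥤ LShape D) {n : ℕ} (x : Fin n → C) (y : C)
    (a : ((Amap F).obj (tens fun i => of (x i))).shape.Var) :
    (castIso (Amap_arrow F x y)).e (.inl a) = .inl ((castIso (Amap_tens F x)).e a) := by
  have e1 : (Amap F).obj (arrow x y) = ((Amap F).obj (tens fun i => of (x i))).hom (F.obj y) := by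
    change LShape.mk _ _ = LShape.mk _ _
    congr 1
    funext a; rcases a with a | a <;> rfl
  have e2 := congrArg (fun α => LShape.hom α (F.obj y)) (Amap_tens F x)
  exact (castIso_trans e1 e2 (.inl a)).trans
    ((congrArg _ (castIso_label e1 (.inl a))).trans (castIso_hom_inl (Amap_tens F x) rfl e2 a))

theorem castIso_arrow_inr (F : C ⥤ LShape D) {n : ℕ} (x : Fin n → C) (y : C)
    (p : (F.obj y).shape.Var) : (castIso (Amap_arrow F x y)).e (.inr p) = .inr p := by
  have e1 : (Amap F).obj (arrow x y) = ((Amap F).obj (tens fun i => of (x i))).hom (F.obj y) := by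
    change LShape.mk _ _ = LShape.mk _ _
    congr 1
    funext a; rcases a with a | a <;> rfl
  have e2 := congrArg (fun α => LShape.hom α (F.obj y)) (Amap_tens F x)
  exact (castIso_trans e1 e2 (.inr p)).trans
    ((congrArg _ (castIso_label e1 (.inr p))).trans (castIso_hom_inr (Amap_tens F x) rfl e2 p))

end LShape

/-! ### Realization of substituted graphs and of graphs out of the unit -/

namespace Linking

/-- The relation `Edge` allows the ends of a label to be any objects equal to the labels of the
variables. The families of points on the label's variables are then only heterogeneously equal to
the given ones. -/
theorem HSits.flat_edge {X Y : SignedSet (LShape D)} {ξ : X ⟶ Y} {S : Sys D}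
    {i : X.flat.Var → S.V} {j : Y.flat.Var → S.V} (H : HSits (flatHom ξ) S i j)
    {a b : (X.hom Y).Var} {c d : LShape D} {h : c ⟶ d} (e : Edge (X := X.hom Y) ξ a b h)
    {i' : c.shape.Var → S.V} {j' : d.shape.Var → S.V} (hi : HEq i' (flatVal i j a))
    (hj : HEq j' (flatVal i j b)) : HSits h.1 S i' j' := by
  cases e with
  | mk e =>
    obtain rfl := eq_of_heq hi
    obtain rfl := eq_of_heq hj
    exact (hsits_flatHom.1 H).2 _ _ _ e

/-- Passing from `I ⟶ [X, Y]` to `X ⟶ Y` only regroups variables, and since `I` has none the family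
`i₀` carries no information. -/
theorem hsits_unname {X Y : SignedSet C} {θ : SignedSet.unit C ⟶ X.hom Y} {S : Sys C}
    {i₀ : Empty → S.V} {i : X.Var → S.V} {j : Y.Var → S.V} :
    HSits (unname θ) S i j ↔ HSits θ S i₀ (Sum.elim i j) := by
  obtain rfl : i₀ = fun a => a.elim := funext fun a => a.elim
  have h := hsits_ofSIso_comp (e := LShape.leftUnit X) (ξ := uncurry θ) (S := S)
    (i := Sum.elim (fun a => a.elim) i) (j := j)
  refine h.trans hsits_uncurry

end Linking

namespace Conf
variable {Q : SymMulticat.{w} C} {n n' : ℕ} {fs : Fin n → Elt Q} {fs' : Fin n' → Elt Q}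
  {f g : Elt Q}

/-! ### Composites of configurations with unary configurations -/

theorem act_eq_self (σ : Fin n ≃ Fin n) (h : ∀ i, fs i = fs (σ i)) (ζ : Conf fs f)
    (hσ : ∀ i, σ i = i) : act σ h ζ = ζ := by
  obtain rfl : σ = Equiv.refl _ := Equiv.ext hσ
  exact act_refl ζ

/-- Naturality of `sigmaOne` moves the single inner configuration past the bijection; what remains
of the bijections is the renumbering of a list of one list. -/
theorem one_comp' (δ : f ⟶ g) (ζ : Conf fs f) :
    comp (one δ) (fun _ => ζ) = act (sumOne n) (concat_sumOne fs) (ζ ≫ Elt.frMap δ) := by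
  unfold comp one act
  rw [← Category.assoc (sigmaMap fun _ => ζ), sigmaMap_one, ← splitOne, ← ofSIso_trans]
  simp only [Category.assoc]

/-- A disjoint union of unary configurations splits into a disjoint union of relabellings and one of
the graphs `frMap (γ i)`; the relabellings combine into the renumbering of a list of singletons. -/
theorem comp_one (ζ : Conf fs f) {gs : Fin n → Elt Q} (γ : ∀ i, gs i ⟶ fs i) :
    comp ζ (fun i => one (γ i)) =
      act (sumOnes n) (concat_sumOnes gs) (sigmaMap (fun i => Elt.frMap (γ i)) ≫ ζ) := by
  unfold comp act one
  rw [sigmaMap_comp, sigmaMap_ofSIso]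
  simp only [← Category.assoc]
  rw [ofSIso_trans]
  congr 3
  refine SIso.ext fun ⟨k, a⟩ => (actIso_eq rfl ?_).symm
  exact heq_of_eq (SIso.sigmaOne_apply (gs _).fr _ a)

/-- The renumbering built into `post` undoes the one from `one_comp'`, leaving a composite of
graphs. The same happens for `pre` with `comp_one`. -/
theorem conf_post (δ : f ⟶ g) (ζ : Q.conf.Hom fs f) :
    (Q.conf.post δ ζ).1 = ζ.1 ≫ Elt.frMap δ := by
  refine (congrArg (act (sumOne n).symm _) (one_comp' δ ζ.1)).trans ?_
  exact (act_act _ _ _ _ _).trans (act_eq_self _ _ _ (by simp))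

theorem conf_pre {gs : Fin n → Elt Q} (γ : ∀ i, gs i ⟶ fs i) (ζ : Q.conf.Hom fs f) :
    (Q.conf.pre γ ζ).1 = sigmaMap (fun i => Elt.frMap (γ i)) ≫ ζ.1 := by
  refine (congrArg (act (sumOnes n).symm _) (comp_one ζ.1 γ)).trans ?_
  exact (act_act _ _ _ _ _).trans (act_eq_self _ _ _ (by simp))

theorem conf_act (σ : Fin n' ≃ Fin n) (ζ : Q.conf.Hom fs f) :
    (Q.conf.act (x' := fun i => fs (σ i)) σ (fun _ => rfl) ζ).1 =
      ofSIso (SIso.reindex σ fun i => (fs i).fr) ≫ ζ.1 := by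
  have h2 : actIso (fs' := fun i => fs (σ i)) σ (fun _ => rfl) =
      SIso.reindex σ fun i => (fs i).fr := SIso.ext fun ⟨k, a⟩ => rfl
  exact congrArg (fun e => ofSIso e ≫ ζ.1) h2

end Conf

/-! ### Operations of the slice in terms of configurations -/

namespace SymMulticat
variable (M : SymMulticat.{w} C) (H : ∀ {n : ℕ}, (Fin n → C) → C → Type w')
    (e : ∀ {n : ℕ} {x : Fin n → C} {y : C}, H x y ≃ M.Hom x y)

/-- The transporting bijections commute with the basic operations by construction, hence with the
derived operations `post` and `pre`. -/
theorem transport_post {n : ℕ} {x : Fin n → C} {y y' : C} (h : y ⟶ y') (f : H x y) :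
    e ((M.transport H e).post h f) = M.post h (e f) := by
  unfold post transport
  simp only [Equiv.apply_symm_apply]

theorem transport_pre {n : ℕ} {x x' : Fin n → C} {y : C} (t : ∀ i, x' i ⟶ x i) (f : H x y) :
    e ((M.transport H e).pre t f) = M.pre t (e f) := by
  unfold pre transport
  simp only [Equiv.apply_symm_apply]

theorem transport_act {n n' : ℕ} {x : Fin n → C} {x' : Fin n' → C} {y : C} (σ : Fin n' ≃ Fin n)
    (h : ∀ i, x' i = x (σ i)) (f : H x y) :
    e ((M.transport H e).act σ h f) = M.act σ h (e f) :=
  e.apply_symm_apply _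

end SymMulticat

namespace Elt
variable {Q : SymMulticat.{w} C}

/-- The configuration of an arrow of the slice multicategory -/
noncomputable abbrev conf (X : Elt Q.slice) : Conf X.src X.tgt := (Conf.ofName X.arrow.1).1

/-- This is the condition `m.comm`, read in terms of graphs: permuting the inputs and composing with
the unary arrows of `m` are composition with a relabelling and with the graphs `frMap`. -/
theorem conf_eq {X Y : Elt Q.slice} (m : X ⟶ Y) :
    Y.conf = (sigmaMap (fun i => frMap (m.src i)) ≫
      ofSIso (SIso.reindex m.perm fun i => (X.src i).fr) ≫ X.conf) ≫ frMap m.tgt := by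
  -- The bijection along which `SymMulticat.slice` is transported, repeated so that the lemmas on
  -- `transport` apply to `Q.slice` by definitional unfolding.
  let e : ∀ {n : ℕ} {fs : Fin n → Elt Q} {f : Elt Q},
      {θ : LShape.unit C ⟶ (LShape.Amap (frame Q)).obj (LShape.arrow fs f) //
        Composes (Conf.ofName θ).1} ≃ Q.conf.Hom fs f := fun {n fs f} =>
    (Equiv.subtypeEquiv Conf.ofName (q := fun ζ => Composes ζ.1)
      fun _ => Iff.rfl).trans (Equiv.subtypeSubtypeEquivSubtypeInter
        (fun ζ : Conf fs f => ζ.Allow) fun ζ => Composes ζ)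
  have h := congrArg (fun θ => (e θ).1) m.comm
  have h1 := Q.conf.transport_post _ e m.tgt
    (Q.slice.pre m.src (Q.slice.act m.perm (fun _ => rfl) X.arrow))
  have h2 := Q.conf.transport_pre _ e m.src (Q.slice.act m.perm (fun _ => rfl) X.arrow)
  have h3 := Q.conf.transport_act _ e m.perm (fun _ => rfl) X.arrow
  refine h.trans ((congrArg Subtype.val h1).trans ((Conf.conf_post _ _).trans ?_))
  refine congrArg (fun ζ => ζ ≫ frMap m.tgt) ?_
  refine (congrArg Subtype.val h2).trans ((Conf.conf_pre _ _).trans ?_)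
  refine congrArg (fun ζ => sigmaMap (fun i => frMap (m.src i)) ≫ ζ) ?_
  exact (congrArg Subtype.val h3).trans (Conf.conf_act _ _)

end Elt

end

/-! ### The frame functor of the slice and the graphs substituted into it -/

section
variable {C : Type u} [Category.{v} C] {Q : SymMulticat.{w} C}

namespace Conf
variable {n : ℕ} {fs : Fin n → Elt Q} {f : Elt Q}

/-- The points of `A φ [f₁ ⊗ ⋯ ⊗ fₙ, f]`, where `φ` is the frame functor -/
noncomputable def ptsIso (fs : Fin n → Elt Q) (f : Elt Q) :
    SIso ((LShape.Amap (Elt.frame Q)).obj (LShape.arrow fs f)).signed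
      ((SignedSet.sigma fun k => (fs k).fr).hom f.fr) :=
  (LShape.castIso (LShape.Amap_arrow (Elt.frame Q) fs f)).trans ((confIso fs).hom f.frameIso)

/-- The graph `θ` and its configuration have the same edges up to the bijection `ptsIso`, so they
are realized by the same paths. This transfers the comparison of names `I ⟶ Aφ [⋯]` to one of
configurations. -/
theorem hsits_ofName {θ : LShape.unit C ⟶ (LShape.Amap (Elt.frame Q)).obj (LShape.arrow fs f)}
    {S : Sys C} {i₀ : Empty → S.V} {k} :
    HSits (ofName θ).1 S (fun a => k ((ptsIso fs f).e.symm (.inl a)))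
      (fun a => k ((ptsIso fs f).e.symm (.inr a))) ↔ HSits θ.1 S i₀ k := by
  -- Any placement of the variables factors through `ptsIso`, so the inverse bijection cancels on
  -- the configuration side.
  obtain ⟨k, rfl⟩ := exists_precomp (ptsIso fs f) k
  have h1 : (ofName θ).1 = conj (confIso fs) f.frameIso (unname (X := (frames fs).signed)
      (Y := ((Elt.frame Q).obj f).signed)
      (θ ≫ eqToHom (LShape.Amap_arrow (Elt.frame Q) fs f)).1) := rfl
  have h2 : (θ ≫ eqToHom (LShape.Amap_arrow (Elt.frame Q) fs f)).1 =
    θ.1 ≫ ofSIso (LShape.castIso (LShape.Amap_arrow (Elt.frame Q) fs f)) :=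
    congrArg (fun ζ => θ.1 ≫ ζ) (LShape.eqToHom_val _)
  refine (Iff.of_eq (congrArg (fun ζ : Conf fs f => HSits ζ S _ _) h1)).trans
    (hsits_conj.trans ((hsits_unname (i₀ := i₀)).trans ?_))
  refine (Iff.of_eq (congrArg (fun ζ => HSits ζ S i₀ _) h2)).trans (hsits_comp_ofSIso.trans ?_)
  have : ∀ b, k ((ptsIso fs f).e ((ptsIso fs f).e.symm b)) = k b := fun b =>
    congrArg k (Equiv.apply_symm_apply _ _)
  simp only [this]
  refine Iff.of_eq (congrArg (HSits θ.1 S i₀) (funext fun a => ?_))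
  change _ = k (((confIso fs).hom f.frameIso).e ((LShape.castIso
    (LShape.Amap_arrow (Elt.frame Q) fs f)).e a))
  generalize (LShape.castIso (LShape.Amap_arrow (Elt.frame Q) fs f)).e a = b
  rcases b with b | b <;> rfl

/-- The variables substituted for the `k`-th variable of `f₁ ⊗ ⋯ ⊗ fₙ` go to the boundary of the
`k`-th node. The label at `a` equals `fs k` only propositionally, which is why `p` and `p'` are
related by `HEq`. -/
theorem ptsIso_inl (a : (LShape.tens fun i => LShape.of (fs i)).shape.Var)
    (p : ((Elt.frame Q).obj ((LShape.tens fun i => LShape.of (fs i)).label a)).shape.Var)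
    (k : Fin n) (hk : (LShape.tensVar _ a).1 = k) (p' : ((Elt.frame Q).obj (fs k)).shape.Var)
    (hp : HEq p p') : (ptsIso fs f).e ((LShape.arrow fs f).shape.glue
      (fun a => ((Elt.frame Q).obj ((LShape.arrow fs f).label a)).shape) (.inl a) p) =
        .inl ⟨k, (fs k).frameIso.e p'⟩ := by
  have h1 := LShape.castIso_arrow_inl (Elt.frame Q) fs f
    ((LShape.tens fun i => LShape.of (fs i)).shape.glue
      (fun a => ((Elt.frame Q).obj ((LShape.tens fun i => LShape.of (fs i)).label a)).shape) a p)
  have h2 := LShape.tensVar_castIso (Elt.frame Q) fs a p k hk p' hp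
  refine (congrArg ((confIso fs).hom f.frameIso).e h1).trans ?_
  exact congrArg (fun s : Σ k, ((Elt.frame Q).obj (fs k)).shape.Var =>
    (Sum.inl ⟨s.1, (fs s.1).frameIso.e s.2⟩ : (Σ k, (fs k).fr.Var) ⊕ f.fr.Var)) h2

theorem ptsIso_inr (p : ((Elt.frame Q).obj f).shape.Var) :
    (ptsIso fs f).e ((LShape.arrow fs f).shape.glue
      (fun a => ((Elt.frame Q).obj ((LShape.arrow fs f).label a)).shape) (.inr ()) p) =
        .inr (f.frameIso.e p) :=
  congrArg ((confIso fs).hom f.frameIso).e (LShape.castIso_arrow_inr (Elt.frame Q) fs f p)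

end Conf

namespace Elt

theorem hsits_of_frame_map {f g : Elt Q} {γ : f ⟶ g} {S : Sys C} {i : f.fr.Var → S.V}
    {j : g.fr.Var → S.V} (h : HSits ((frame Q).map γ).1 S (fun a => i (f.frameIso.e a))
      fun a => j (g.frameIso.e a)) : HSits (frMap γ) S i j := by
  have h' : HSits (conj f.frIso.symm g.frIso.symm (frMap γ)) S _ _ := h
  refine (hsits_conj.1 h').congr (fun a => congrArg i ?_) fun a => congrArg j ?_
  · exact f.frIso.e.apply_symm_apply a
  · exact g.frIso.e.apply_symm_apply a

/-- The edges of the frame of `m` are labelled `m.src i` and `m.tgt`, and `Aφ` replaces each of them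
by the frame graph of its label. A realization of the whole graph therefore realizes each of these
graphs, placed at the ends of its edge. -/
theorem hsits_Amap_frame {X Y : Elt Q.slice} (m : X ⟶ Y) {S : Sys C} {j k}
    (H : HSits ((LShape.Amap (frame Q)).map ((frame Q.slice).map m)).1 S j k) :
    (∀ i, HSits (frMap (m.src i)) S
      (fun a => k ((Conf.ptsIso Y.src Y.tgt).e.symm (.inl ⟨i, a⟩)))
      (fun a => j ((Conf.ptsIso X.src X.tgt).e.symm (.inl ⟨m.perm i, a⟩)))) ∧
    HSits (frMap m.tgt) S (fun a => j ((Conf.ptsIso X.src X.tgt).e.symm (.inr a)))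
      (fun a => k ((Conf.ptsIso Y.src Y.tgt).e.symm (.inr a))) := by
  -- On morphisms, `Aφ` applies `φ` to the labels, flattens, and conjugates by the gluing
  -- bijections; the last step is removed here.
  have H1 : HSits (flatHom (mapHom (frame Q) ((frame Q.slice).map m).1)) S
      (fun p => j ((LShape.arrow X.src X.tgt).shape.glue
        (fun a => ((frame Q).obj ((LShape.arrow X.src X.tgt).label a)).shape) p.1 p.2))
      (fun p => k ((LShape.arrow Y.src Y.tgt).shape.glue
        (fun a => ((frame Q).obj ((LShape.arrow Y.src Y.tgt).label a)).shape) p.1 p.2)) :=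
    hsits_conj.1 H
  obtain ⟨e1, e2⟩ := hsits_frMap.1 (hsits_self (frMap m))
  -- A path from a negative to a positive point in the system of a single graph is one edge: it is
  -- not empty, by the signs, and cannot continue, since no edge starts at a positive point.
  have edge : ∀ {a b : (X.fr.hom Y.fr).Var} {c d : Elt Q} {h : c ⟶ d},
      (X.fr.hom Y.fr).sign a = false → (X.fr.hom Y.fr).sign b = true →
      (hsys (frMap m)).Path a b h → Edge (X := X.fr.hom Y.fr) (frMap m) a b h := by
    intro a b c d h ha hb p
    cases p with
    | refl => exact Bool.noConfusion (ha.symm.trans hb)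
    | cons s q =>
      cases q with
      | refl => rw [Category.comp_id]; exact s
      | cons s' _ => exact Bool.noConfusion (s'.neg.symm.trans s.pos)
  -- The frame functor conjugates `frMap m` by the bijections `frIso`, so the ends of edges have to
  -- be moved to variables of the labelled shapes.
  have edge' : ∀ {a b : (X.fr.hom Y.fr).Var} {c d : Elt Q} {h : c ⟶ d},
      Edge (X := X.fr.hom Y.fr) (frMap m) a b h →
      Edge (X := ((frame Q.slice).obj X).signed.hom ((frame Q.slice).obj Y).signed)
        ((frame Q.slice).map m).1 ((X.frIso.symm.hom Y.frIso.symm).e a)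
        ((X.frIso.symm.hom Y.frIso.symm).e b) h := by
    intro a b c d h e
    refine map_Edge.2 ?_
    have ha := (X.frIso.symm.hom Y.frIso.symm).e.symm_apply_apply a
    have hb := (X.frIso.symm.hom Y.frIso.symm).e.symm_apply_apply b
    exact (congrArg₂ (fun a b => Edge (X := X.fr.hom Y.fr) (frMap m) a b h) ha hb).mpr e
  refine ⟨fun i => hsits_of_frame_map (H1.flat_edge (mapHom_Edge.2
    (.mk (F := frame Q) (edge' (edge rfl rfl (e1 i))))) ?_ ?_), hsits_of_frame_map
    (H1.flat_edge (mapHom_Edge.2 (.mk (F := frame Q) (edge' (edge rfl rfl e2)))) ?_ ?_)⟩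
  -- The edge for `m.src i` starts at the variable of the `i`-th input of `Y` and ends at that of
  -- the input `m.perm i` of `X`. The points substituted for these variables are identified by
  -- `ptsIso_inl`, and those for the two outputs by `ptsIso_inr`.
  · refine LShape.heq_of_apply (congrArg (frame Q).obj (edge' (edge rfl rfl (e1 i))).lab.1)
      fun p p' hp => congrArg k ((Equiv.symm_apply_eq _).2 (Conf.ptsIso_inl _ p' i ?_ p hp.symm).symm)
    exact congrArg Sigma.fst (((LShape.tensIso fun i => LShape.of (Y.src i)).e.apply_symm_apply ⟨i, ()⟩))
  · refine LShape.heq_of_apply (congrArg (frame Q).obj (edge' (edge rfl rfl (e1 i))).lab.2)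
      fun p p' hp => congrArg j ((Equiv.symm_apply_eq _).2
        (Conf.ptsIso_inl _ p' (m.perm i) ?_ p hp.symm).symm)
    exact congrArg Sigma.fst ((LShape.tensIso fun i => LShape.of (X.src i)).e.apply_symm_apply
      ⟨m.perm i, ()⟩)
  · refine heq_of_eq (funext fun p => congrArg j ((Equiv.symm_apply_eq _).2 (Conf.ptsIso_inr p).symm))
  · refine heq_of_eq (funext fun p => congrArg k ((Equiv.symm_apply_eq _).2 (Conf.ptsIso_inr p).symm))

/-- The action of morphisms on the arrows of the slice multicategory -/
theorem slice_arrow {X Y : Elt Q.slice} (m : X ⟶ Y) :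
    Y.arrow.1 = X.arrow.1 ≫ (LShape.Amap (frame Q)).map ((frame Q.slice).map m) := by
  -- To identify a composite it is enough to realize the candidate in every system in which both
  -- factors are realized with the same placement of the middle variables.
  refine Subtype.ext (eq_comp fun S i j k h h' => ?_)
  obtain ⟨h1, h2⟩ := hsits_Amap_frame m h'
  refine Conf.hsits_ofName.1 ?_
  refine (congrArg (fun ζ : Conf Y.src Y.tgt => HSits ζ S _ _) (conf_eq m)).mpr ?_
  have h3 := Conf.hsits_ofName.2 h
  -- The graphs at the inputs end at inputs of `X` numbered through `m.perm`; the relabelling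
  -- `reindex` then leads to the placement on which the configuration of `X` is realized.
  have h4 := (hsits_sigmaMap (ξ := fun i => frMap (m.src i)) (S := S)
    (i := fun a => k ((Conf.ptsIso Y.src Y.tgt).e.symm (.inl a)))
    (j := fun a => j ((Conf.ptsIso X.src X.tgt).e.symm (.inl ⟨m.perm a.1, a.2⟩)))).2 h1
  refine HSits.comp (HSits.comp h4 (HSits.comp ?_ h3)) h2
  exact hsits_ofSIso (fun _ => rfl) fun a => h3.left _

end Elt
-- Recovering a list and a target from a labelled shape
namespace LShape

/-- Lists of length zero, one and at least two give tensor products whose shapes have distinct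
outermost constructors, so the shape determines the length by recursion, and the labelling then
determines the entries. -/
theorem arrow_injective : ∀ {n n' : ℕ} {x : Fin n → C} {x' : Fin n' → C} {y y' : C},
    arrow x y = arrow x' y' → n = n' ∧ HEq x x' ∧ y = y' := by
  have tens_inj : ∀ {n n' : ℕ} {x : Fin n → C} {x' : Fin n' → C},
      (tens fun i => of (x i)) = (tens fun i => of (x' i)) → n = n' ∧ HEq x x' := by
    intro n
    induction n using Nat.strong_induction_on with
    | _ n ih =>
      intro n' x x' h
      match n, n', x, x' with
      | 0, 0, x, x' => exact ⟨rfl, heq_of_eq (funext fun i => i.elim0)⟩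
      | 1, 1, x, x' =>
        refine ⟨rfl, heq_of_eq (funext fun i => ?_)⟩
        obtain rfl := Subsingleton.elim i 0
        have : (fun _ : Unit => x 0) = fun _ => x' 0 := by
          have h' : LShape.mk .one (fun _ => x 0) = LShape.mk .one (fun _ => x' 0) := h
          injection h'
        exact congrFun this ()
      | n + 2, n' + 2, x, x' =>
        -- Injectivity of the constructor identifies the shapes of the factors; their labellings are
        -- the restrictions of a common function on the sum of the variables.
        have key : ∀ {α α' β β' : LShape C}, α.tensor β = α'.tensor β' → α = α' ∧ β = β' := by
          rintro ⟨s, l⟩ ⟨s', l'⟩ ⟨t, k⟩ ⟨t', k'⟩ h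
          injection h with h1 h2
          injection h1 with h3 h4
          subst h3 h4
          have h5 := eq_of_heq h2
          obtain rfl : l = l' := funext fun a => congrFun h5 (.inl a)
          obtain rfl : k = k' := funext fun a => congrFun h5 (.inr a)
          exact ⟨rfl, rfl⟩
        obtain ⟨h1, h2⟩ := key h
        obtain ⟨h3, h4⟩ := ih (n + 1) (by omega) (x := fun i => x i.succ)
          (x' := fun i => x' i.succ) h2
        obtain rfl : n = n' := by omega
        refine ⟨rfl, heq_of_eq (funext fun i => ?_)⟩
        refine Fin.cases ?_ (fun i => congrFun (eq_of_heq h4) i) i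
        injection h1 with _ h1
        exact congrFun h1 ()
      | 0, 1, x, x' => injection h with h _; cases h
      | 1, 0, x, x' => injection h with h _; cases h
      | 0, n' + 2, x, x' => injection h with h _; cases h
      | 1, n' + 2, x, x' => injection h with h _; cases h
      | n + 2, 0, x, x' => injection h with h _; cases h
      | n + 2, 1, x, x' => injection h with h _; cases h
  have key : ∀ {α α' β β' : LShape C}, α.hom β = α'.hom β' → α = α' ∧ β = β' := by
    rintro ⟨s, l⟩ ⟨s', l'⟩ ⟨t, k⟩ ⟨t', k'⟩ h
    injection h with h1 h2
    injection h1 with h3 h4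
    subst h3 h4
    have h5 := eq_of_heq h2
    obtain rfl : l = l' := funext fun a => congrFun h5 (.inl a)
    obtain rfl : k = k' := funext fun a => congrFun h5 (.inr a)
    exact ⟨rfl, rfl⟩
  intro n n' x x' y y' h
  obtain ⟨h1, h2⟩ := key h
  obtain ⟨h3, h4⟩ := tens_inj h1
  refine ⟨h3, h4, ?_⟩
  injection h2 with _ h2
  exact congrFun h2 ()

end LShape

/-! ### The functor to the comma category is full, faithful and injective on objects -/

namespace Elt
variable (Q)

/-- The arrows of the slice multicategory, as objects of the comma category -/
noncomputable def sliceObj (X : Elt Q.slice) :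
    StructuredArrow (LShape.unit C) (LShape.Amap (frame Q)) :=
  StructuredArrow.mk (Y := (frame Q.slice).obj X) X.arrow.1

/-- The object of `A(elt Q)` determines the sources and the target, and the structure map is the
graph itself. The remaining component of an arrow of the slice is a proof. -/
theorem sliceObj_injective : Function.Injective (sliceObj Q) := by
  intro X Y h
  obtain ⟨n, fs, f, θ⟩ := X
  obtain ⟨n', fs', f', θ'⟩ := Y
  have h1 : LShape.arrow fs f = LShape.arrow fs' f' := congrArg (fun Z => Z.right) h
  obtain ⟨rfl, h2, rfl⟩ := LShape.arrow_injective h1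
  obtain rfl := eq_of_heq h2
  have h3 : θ.1 = θ'.1 := by
    unfold sliceObj StructuredArrow.mk at h
    injection h
  rw [Subtype.ext h3]

/-- The objects of the comma category which are arrows of the slice multicategory -/
def isSliceObj : ObjectProperty (StructuredArrow (LShape.unit C) (LShape.Amap (frame Q))) :=
  fun Y => ∃ X, sliceObj Q X = Y

/-- The category of elements of the slice multicategory, as a category of objects of the comma
category -/
noncomputable def sliceFunctor : Elt Q.slice ⥤ (isSliceObj Q).FullSubcategory where
  obj X := ⟨sliceObj Q X, X, rfl⟩
  map {X Y} m := ObjectProperty.homMk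
    -- The triangle required of a morphism of the comma category is exactly `slice_arrow`.
    (StructuredArrow.homMk (f := sliceObj Q X) (f' := sliceObj Q Y) ((frame Q.slice).map m)
      (slice_arrow m).symm)
  map_id X := by
    -- Morphisms of the full subcategory and of the comma category are determined by their component
    -- in `A(elt Q)`, where functoriality is that of the frame functor.
    ext : 2
    exact (frame Q.slice).map_id X
  map_comp m m' := by
    ext : 2
    exact (frame Q.slice).map_comp m m'

/-- The component in `A(elt Q)` is the frame of the morphism, and the frame functor of the slice is
faithful, `Q.slice` being itself a symmetric multicategory. -/
instance : (sliceFunctor Q).Faithful where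
  map_injective {X Y m m'} h :=
    frame_map_injective (congrArg (fun k => k.hom.right) h)

/-- The underlying graph lifts to a morphism `m` out of `X` by `exists_frame_map`, whose target has
the sources and target of `Y` but an arrow `q` not yet known. Both `slice_arrow` for `m` and the
comma triangle compute the graph of the target arrow as the same composite. -/
instance : (sliceFunctor Q).Full where
  map_surjective {X Y} k := by
    obtain ⟨q, m, hm⟩ := exists_frame_map X Y k.hom.right
    have h1 := slice_arrow m
    rw [hm] at h1
    have h2 : X.arrow.1 ≫ (LShape.Amap (frame Q)).map k.hom.right = Y.arrow.1 :=
      StructuredArrow.w k.hom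
    -- Arrows of the slice are graphs with a proof that composition gives the target, so equality of
    -- graphs suffices; after substitution `m` ends at `Y`.
    obtain rfl : q = Y.arrow := Subtype.ext (h1.trans h2)
    refine ⟨m, ?_⟩
    ext : 2
    exact hm

theorem sliceFunctor_bijective : Function.Bijective (sliceFunctor Q).obj :=
  ⟨fun X Y h => sliceObj_injective Q (congrArg (fun Z => Z.obj) h),
    fun ⟨_, X, h⟩ => ⟨X, by subst h; rfl⟩⟩

end Elt
end

/-- A fully faithful functor that is bijective on objects is an isomorphism of categories. -/
theorem exists_inverse {A : Type*} [Category A] {B : Type*} [Category B] (F : A ⥤ B) [F.Full]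
    [F.Faithful] (h : Function.Bijective F.obj) : ∃ G : B ⥤ A, F ⋙ G = 𝟭 A ∧ G ⋙ F = 𝟭 B := by
  let e := Equiv.ofBijective F.obj h
  have he : ∀ b, F.obj (e.symm b) = b := e.apply_symm_apply
  let G : B ⥤ A :=
    { obj := e.symm
      -- Objects are recovered only up to propositional equality, so a morphism is conjugated into
      -- one between values of `F` before it is lifted by fullness.
      map := fun {b b'} k => F.preimage (eqToHom (he b) ≫ k ≫ eqToHom (he b').symm)
      map_id := fun b => F.map_injective (by simp)
      map_comp := fun k k' => F.map_injective (by simp) }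
  refine ⟨G, CategoryTheory.Functor.ext (fun a => e.symm_apply_apply a) fun a a' k => F.map_injective ?_,
    CategoryTheory.Functor.ext he fun b b' k => ?_⟩
  -- The proof `q` is independent of `p`, because the equalities supplied by `he` are not images
  -- under `F.obj` of equalities in `A`.
  · have hF : ∀ {a a' : A} (p : a = a') (q : F.obj a = F.obj a'), F.map (eqToHom p) = eqToHom q := by
      rintro a _ rfl q
      simp
    refine (F.map_preimage _).trans ?_
    rw [F.map_comp, F.map_comp]
    exact congrArg₂ (fun p q => p ≫ F.map k ≫ q)
      (hF (e.symm_apply_apply a) (he (F.obj a))).symm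
      (hF (e.symm_apply_apply a').symm (he (F.obj a')).symm).symm
  · simp [G]

end KML

theorem mainTheorem2 {C : Type u} [Category.{v} C] (Q : KML.SymMulticat.{w} C) :
    ∃ (P : ObjectProperty
        (StructuredArrow (KML.LShape.unit C) (KML.LShape.Amap (KML.Elt.frame Q))))
      (F : KML.Elt Q.slice ⥤ P.FullSubcategory) (G : P.FullSubcategory ⥤ KML.Elt Q.slice),
      F ⋙ G = 𝟭 (KML.Elt Q.slice) ∧ G ⋙ F = 𝟭 P.FullSubcategory ∧
      (∀ X : KML.Elt Q.slice,
        (F.obj X).obj = StructuredArrow.mk (Y := (KML.Elt.frame Q.slice).obj X) X.arrow.1) ∧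
      KML.Elt.frame Q.slice = F ⋙ P.ι ⋙
        StructuredArrow.proj (KML.LShape.unit C) (KML.LShape.Amap (KML.Elt.frame Q)) := by
  obtain ⟨G, h1, h2⟩ := KML.exists_inverse _ (KML.Elt.sliceFunctor_bijective Q)
  -- The last two clauses are definitional: the functor was defined with the arrow itself as
  -- structure map and with the frame functor of the slice as its component in `A(elt Q)`.
  exact ⟨_, KML.Elt.sliceFunctor Q, G, h1, h2, fun _ => rfl, rfl⟩
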